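/- Let $\pi\colon Y\to\operatorname{Spec}\mathbb{C}$ be a smooth variety (a smooth, separated scheme of finite type over $\mathbb{C}$) and let $D\subset Y$ be a normal crossing divisor: étale locally on $Y$ there are étale coordinates $z_1,\dots,z_n$ such that $D$ is the zero scheme of a product $\prod_{i\in S}z_i$ of distinct coordinates (self-crossings of components are allowed). Let $Y\log D$ be the divisorial log scheme: $\mathscr M\subset\mathcal O_Y$ is the étale sheaf of monoids of regular functions invertible on $Y\setminus D$. Let $K=(Y\log D)^{\log}$ be its Kato–Nakayama space. Its points are the pairs $(p,\arg)$ of a point $p\in Y(\mathbb{C})$ and a monoid homomorphism $\arg\colon\mathscr M_p\to S^1$ with $\arg f=f(p)/|f(p)|$ for units $f$. Its topology and $C^\infty$ structure are those for which, étale locally, the real and imaginary parts of regular functions $f$ and the functions $|m|$, $\arg m$ for $m\in\mathscr M$ are the basic functions; so it is a manifold with corners with local coordinates $r_i=|z_i|\ge 0$, $\theta_i=\arg z_i$ for the components $z_i=0$ of $D$ and $\operatorname{Re}z_j,\operatorname{Im}z_j$ for the other coordinates. It carries its basic log structure $\mathscr M_K$, the sheaf of functions that are locally $g\cdot|m|$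 with $g$ a positive $C^\infty$ function and $m\in\mathscr M$. Consider the following four sets. 1. $A$: weak morphisms $\varphi\colon\operatorname{Spec}\mathbb{C}\to Y\log D$, i.e. a point $p\in Y(\mathbb{C})$ with a morphism of sheaves of monoids $\varphi^*\colon p^{-1}\mathscr M\to\mathcal O^\times_{\operatorname{Spec}\mathbb{C}}$ (that is, a homomorphism $\mathscr M_p\to\mathbb{C}^\times$) with $\varphi^*f=f(p)$ for units $f$ (and no condition on the other sections of $\mathscr M$). 2. $B$: weak morphisms $s\colon *\to K$, i.e. a point $x\in K$ with a morphism of sheaves of monoids $s^*\colon x^{-1}\mathscr M_K\to\mathbb{R}_{>0}$ with $s^*g=g(x)$ for positive $C^\infty$ functions $g$. 3. $T^{\mathrm{alg}}$: Deligne's algebraic tangential basepoints, i.e. a point $p\in Y(\mathbb{C})$ together with, for every local (étale) irreducible component $D_q$ of $D$ through $p$, a nonzero normal vector $v_q\in T_pY/T_pD_q$. 4. $T^{\infty}$: $C^\infty$ tangential basepoints of $K$, i.e. a point $x\in K$ with a positive normal vector $v\in N_x^{>0}K$. Here $T_xK$ is the space of derivations of the germs of $C^\infty$ functions, $T^{\ge0}_xK$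 consists of the $w\in T_xK$ with $\langle w,\mathrm df\rangle\ge0$ for all germs $f\ge0$ with $f(x)=0$, $F_xK$ consists of those $w$ with $\langle w,\mathrm df\rangle=0$ for all such $f$, and $N^{>0}_xK$ is the image in $T_xK/F_xK$ of the interior of $T_x^{\ge0}K$. Then there are bijections $$e_{12}\colon A\to B,\qquad e_{13}\colon A\to T^{\mathrm{alg}},\qquad e_{24}\colon B\to T^\infty,\qquad e_{43}\colon T^\infty\to T^{\mathrm{alg}},\qquad e_{43}\circ e_{24}\circ e_{12}=e_{13},$$ which are canonical in that each is uniquely characterized as follows. * $e_{12}(\varphi)=s$ if and only if $s$ lies over the point $(p,\arg)\in K$ with $p$ the point of $\varphi$ and $\arg m=\varphi^*m/|\varphi^*m|$, and $s^*|m|=|\varphi^*m|$, for all $m\in\mathscr M_p$. * $e_{13}(\varphi)=(p,(v_q)_q)$ if and only if $p$ is the point of $\varphi$ and $\varphi^*z=\langle v_q,\mathrm dz\rangle$ for every local equation $z\in\mathscr M_p$ of every local component $D_q$. * $e_{24}(s)=(x,v)$ if and only if $x$ is the point of $s$ and $s^*r=\langle v,\mathrm dr\rangle$ for every local section $r$ of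 $\mathscr M_K$ at $x$ with $r(x)=0$ and $\mathrm dr|_x\ne0$. * $e_{43}(x,v)=(p,(v_q)_q)$ if and only if $p$ is the image of $x$ and, for every $w\in T_xK$ representing $v$, each $v_q$ is the class of the image of $w$ under the differential of the canonical map $K\to Y(\mathbb{C})$. (In coordinates, $|c|\,\partial_r|_{(r=0,\theta=\arg c)}$ corresponds to $c\,\partial_z|_{z=0}$.) -/

import Mathlib

open CategoryTheory AlgebraicGeometry Opposite Limits TopologicalSpace
open scoped Topology ContDiff

namespace LogGeom

noncomputable section

/-- The structure sheaf of the small étale site of `X`. -/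
def etaleO (X : Scheme.{0}) : X.Etaleᵒᵖ ⥤ CommRingCat.{0} :=
  (Scheme.Etale.forget X ⋙ Over.forget X).op ⋙ Scheme.Γ

theorem isContinuous_overForget (P : MorphismProperty Scheme.{0}) [P.IsMultiplicative]
    [P.IsStableUnderBaseChange] [P.HasOfPostcompProperty P] (X : Scheme.{0}) :
    (MorphismProperty.Over.forget P ⊤ X ⋙ Over.forget X).IsContinuous
      (X.smallGrothendieckTopology P) (Scheme.grothendieckTopology P) := by
  have : PreservesLimitsOfShape WalkingCospan (MorphismProperty.Over.forget P ⊤ X) := inferInstance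
  have := hasFiniteLimits_of_hasTerminal_and_pullbacks (C := P.Over ⊤ X)
  have := preservesFiniteLimits_of_preservesTerminal_and_pullbacks
    (MorphismProperty.Over.forget P ⊤ X)
  have : RepresentablyFlat (MorphismProperty.Over.forget P ⊤ X) := flat_of_preservesFiniteLimits _
  have : (MorphismProperty.Over.forget P ⊤ X).IsContinuous
      (X.smallGrothendieckTopology P) ((Scheme.grothendieckTopology P).over X) := by
    rw [Functor.isContinuous_iff_coverPreserving]
    exact Functor.coverPreserving_restrictedTopology (MorphismProperty.Over.forget P ⊤ X) _
  exact Functor.isContinuous_comp _ _ _ ((Scheme.grothendieckTopology P).over X) _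

theorem gamma_isSheaf :
    Presheaf.IsSheaf Scheme.fpqcTopology.{0} (Scheme.Γ ⋙ forget CommRingCat) := by
  let e : yoneda.obj (Spec (CommRingCat.of (MvPolynomial PUnit (ULift ℤ)))) ≅
      Scheme.Γ ⋙ forget CommRingCat.{0} :=
    NatIso.ofComponents (fun U ↦ Equiv.toIso
      ((AffineSpace.toSpecMvPolyIntEquiv PUnit).trans (Equiv.funUnique PUnit _)))
      (fun f ↦ rfl)
  rw [← Presheaf.isSheaf_of_iso_iff e, isSheaf_iff_isSheaf_of_type]
  exact GrothendieckTopology.Subcanonical.isSheaf_of_isRepresentable _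

theorem etaleO_isSheaf (X : Scheme.{0}) :
    Presheaf.IsSheaf X.smallEtaleTopology (etaleO X ⋙ forget CommRingCat) := by
  have h2 : Presheaf.IsSheaf Scheme.etaleTopology.{0} (Scheme.Γ ⋙ forget CommRingCat) :=
    gamma_isSheaf.of_le
      (Scheme.etaleTopology_le_proetaleTopology.trans Scheme.proetaleTopology_le_fpqcTopology)
  have : (Scheme.Etale.forget X ⋙ Over.forget X).IsContinuous X.smallEtaleTopology
      Scheme.etaleTopology := isContinuous_overForget @Etale X
  exact (Scheme.Etale.forget X ⋙ Over.forget X).op_comp_isSheaf_of_isSheaf _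
    Scheme.etaleTopology _ h2

/-- A log scheme over `ℂ`: a scheme over `ℂ` with a sheaf of commutative monoids `M` on its small
étale site and a morphism `α` from `M` to the multiplicative monoid of the structure sheaf that
identifies the preimage of the sheaf of units with the sheaf of units. -/
structure LogScheme where
  X : Scheme.{0}
  str : X ⟶ Spec (.of ℂ)
  M : X.Etaleᵒᵖ ⥤ CommMonCat.{0}
  isSheaf : Presheaf.IsSheaf X.smallEtaleTopology (M ⋙ forget CommMonCat)
  α (U : X.Etale) : M.obj (op U) →* Γ(U.left, ⊤)
  α_naturality {U V : X.Etale} (f : U ⟶ V) (m : M.obj (op V)) :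
    α U (M.map f.op m) = f.left.appTop (α V m)
  existsUnique_of_isUnit (U : X.Etale) (f : Γ(U.left, ⊤)) : IsUnit f → ∃! m, α U m = f

/-- Base change along `f`, for objects with structure morphism in `P`. -/
def basePullback (P : MorphismProperty Scheme.{0}) [P.IsMultiplicative]
    [P.IsStableUnderBaseChange] {X Y : Scheme.{0}} (f : X ⟶ Y) : P.Over ⊤ Y ⥤ P.Over ⊤ X :=
  MorphismProperty.Over.pullback P ⊤ f

/-- Base change of étale `Y`-schemes to étale `X`-schemes. -/
def etalePullback {X Y : Scheme.{0}} (f : X ⟶ Y) : Y.Etale ⥤ X.Etale :=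
  basePullback @Etale f

/-- The projection from the base change `U ×_Y X` to `U`. -/
def etalePullbackFst {X Y : Scheme.{0}} (f : X ⟶ Y) (U : Y.Etale) :
    ((etalePullback f).obj U).left ⟶ U.left :=
  pullback.fst U.hom f

/-- A weak morphism: a morphism `φ` of the underlying `ℂ`-schemes and a morphism of sheaves of
monoids `M_Y ⟶ φ_* M_X` (equivalently `φ⁻¹ M_Y ⟶ M_X`) which commutes with `α` on the sheaf of
units of `Y`; nothing is required of the other sections of `M_Y`. -/
structure LogScheme.WeakHom (X Y : LogScheme) where
  base : X.X ⟶ Y.X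
  base_str : base ≫ Y.str = X.str
  pull : Y.M ⟶ (etalePullback base).op ⋙ X.M
  pull_unit (U : Y.X.Etale) (m : Y.M.obj (op U)) : IsUnit (Y.α U m) →
    X.α ((etalePullback base).obj U) (pull.app (op U) m) =
      (etalePullbackFst base U).appTop (Y.α U m)

/-- The functions on `U` that are invertible over the open subset `W` of `X`. -/
def logSections (X : Scheme.{0}) (W : X.Opens) (U : X.Etale) : Submonoid Γ(U.left, ⊤) where
  carrier := {f | U.hom ⁻¹ᵁ W ≤ U.left.basicOpen f}
  mul_mem' {f g} hf hg := by
    simp only [Set.mem_ofPred_eq, Scheme.basicOpen_mul] at *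
    exact le_inf hf hg
  one_mem' := by simp

theorem logSections_map {X : Scheme.{0}} (W : X.Opens) {U V : X.Etale} (f : U ⟶ V)
    {m : Γ(V.left, ⊤)} (hm : m ∈ logSections X W V) :
    f.left.appTop m ∈ logSections X W U := by
  have hm' : V.hom ⁻¹ᵁ W ≤ V.left.basicOpen m := hm
  have hw : f.left ≫ V.hom = U.hom := CategoryTheory.Over.w ((Scheme.Etale.forget X).map f)
  have h1 : U.left.basicOpen (f.left.appTop m) = f.left ⁻¹ᵁ V.left.basicOpen m :=
    (Scheme.preimage_basicOpen_top f.left m).symm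
  change U.hom ⁻¹ᵁ W ≤ U.left.basicOpen (f.left.appTop m)
  rw [h1, ← hw, Scheme.Hom.comp_preimage]
  exact fun x hx ↦ hm' hx

def logSectionsMap {X : Scheme.{0}} (W : X.Opens) {U V : X.Etale} (f : U ⟶ V) :
    logSections X W V →* logSections X W U where
  toFun m := ⟨f.left.appTop m.1, logSections_map W f m.2⟩
  map_one' := Subtype.ext (map_one _)
  map_mul' _ _ := Subtype.ext (map_mul _ _ _)

/-- The sheaf of regular functions that are invertible over `W`. -/
def divisorialM (X : Scheme.{0}) (W : X.Opens) : X.Etaleᵒᵖ ⥤ CommMonCat.{0} where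
  obj U := CommMonCat.of (logSections X W U.unop)
  map f := CommMonCat.ofHom (logSectionsMap W f.unop)
  map_id U := by
    ext m
    exact congr($((etaleO X).map_id U) m.1)
  map_comp f g := by
    ext m
    exact congr($((etaleO X).map_comp f g) m.1)

def divisorialSubfunctor (X : Scheme.{0}) (W : X.Opens) :
    Subfunctor (etaleO X ⋙ forget CommRingCat) where
  obj U := (logSections X W U.unop : Set Γ(U.unop.left, ⊤))
  map f _ hm := logSections_map W f.unop hm

theorem exists_of_mem_smallEtaleTopology {X : Scheme.{0}} {U : X.Etale} {S : Sieve U}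
    (hS : S ∈ X.smallEtaleTopology U) (x : U.left) :
    ∃ (V : X.Etale) (f : V ⟶ U) (v : V.left), S f ∧ f.left v = x := by
  obtain ⟨ι, Z, g, rfl⟩ := S.exists_eq_ofArrows
  rw [Scheme.ofArrows_mem_smallEtaleTopology_iff] at hS
  have hx : x ∈ ⋃ i, Set.range (g i).left := hS ▸ Set.mem_univ x
  obtain ⟨i, v, hv⟩ := Set.mem_iUnion.1 hx
  exact ⟨Z i, g i, v, ⟨_, 𝟙 _, _, ⟨i⟩, Category.id_comp _⟩, hv⟩

theorem divisorial_isSheaf (X : Scheme.{0}) (W : X.Opens) :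
    Presheaf.IsSheaf X.smallEtaleTopology (divisorialM X W ⋙ forget CommMonCat) := by
  let e : divisorialM X W ⋙ forget CommMonCat ≅ (divisorialSubfunctor X W).toFunctor :=
    NatIso.ofComponents (fun U ↦ Iso.refl _) (fun f ↦ rfl)
  rw [Presheaf.isSheaf_of_iso_iff e, isSheaf_iff_isSheaf_of_type, Subfunctor.isSheaf_iff _
    ((isSheaf_iff_isSheaf_of_type _ _).1 (etaleO_isSheaf X))]
  intro U s hs x hx
  obtain ⟨V, f, v, hf, hv⟩ : ∃ (V : X.Etale) (f : V ⟶ U.unop) (v : V.left),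
      (divisorialSubfunctor X W).sieveOfSection s f ∧ f.left v = x :=
    exists_of_mem_smallEtaleTopology hs x
  have h1 : V.hom ⁻¹ᵁ W ≤ V.left.basicOpen (f.left.appTop s) := hf
  have hw : f.left ≫ U.unop.hom = V.hom := CategoryTheory.Over.w ((Scheme.Etale.forget X).map f)
  have h2 : v ∈ V.left.basicOpen (f.left.appTop s) := by
    apply h1
    rw [← hw, Scheme.Hom.comp_preimage]
    change f.left v ∈ U.unop.hom ⁻¹ᵁ W
    rw [hv]; exact hx
  have h3 : V.left.basicOpen (f.left.appTop s) = f.left ⁻¹ᵁ U.unop.left.basicOpen s :=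
    (Scheme.preimage_basicOpen_top f.left s).symm
  rw [h3] at h2
  have h4 : f.left v ∈ U.unop.left.basicOpen s := h2
  rwa [hv] at h4

/-- The divisorial log scheme: `α` is the inclusion of the sheaf of regular functions that are
invertible on the open set `W` (the complement of a divisor). For `W = ⊤` this is the trivial log
structure. -/
def LogScheme.divisorial (X : Scheme.{0}) (str : X ⟶ Spec (.of ℂ)) (W : X.Opens) : LogScheme where
  X := X
  str := str
  M := divisorialM X W
  isSheaf := divisorial_isSheaf X W
  α U := (logSections X W U).subtype
  α_naturality _ _ := rfl
  existsUnique_of_isUnit U f hf := by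
    refine ⟨⟨f, ?_⟩, rfl, fun m hm ↦ Subtype.ext hm⟩
    change U.hom ⁻¹ᵁ W ≤ U.left.basicOpen f
    rw [Scheme.basicOpen_of_isUnit _ hf]
    exact le_top

/-- A topological space with a sheaf of algebras of real functions, the smooth functions. -/
structure SmoothSpace where
  space : TopCat.{0}
  smooth (W : Opens space) : Subalgebra ℝ (W → ℝ)
  restrict {V W : Opens space} (h : V ≤ W) {g : W → ℝ} (hg : g ∈ smooth W) :
    (fun y : V ↦ g ⟨y, h y.2⟩) ∈ smooth V
  glue (W : Opens space) (g : W → ℝ) (hg : ∀ x : W, ∃ (V : Opens space) (h : V ≤ W),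
    x.1 ∈ V ∧ (fun y : V ↦ g ⟨y, h y.2⟩) ∈ smooth V) : g ∈ smooth W

namespace SmoothSpace

variable (S : SmoothSpace)

/-- The ring of germs of smooth functions at `x`. -/
def smoothGerms (x : S.space) : Subring ((𝓝 x).Germ ℝ) where
  carrier := {γ | ∃ (W : Opens S.space) (g : S.space → ℝ), x ∈ W ∧
    (fun y : W ↦ g y) ∈ S.smooth W ∧ γ = (g : (𝓝 x).Germ ℝ)}
  mul_mem' := by
    rintro _ _ ⟨W, g, hx, hg, rfl⟩ ⟨W', g', hx', hg', rfl⟩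
    exact ⟨W ⊓ W', g * g', ⟨hx, hx'⟩,
      mul_mem (S.restrict inf_le_left hg) (S.restrict inf_le_right hg'), rfl⟩
  add_mem' := by
    rintro _ _ ⟨W, g, hx, hg, rfl⟩ ⟨W', g', hx', hg', rfl⟩
    exact ⟨W ⊓ W', g + g', ⟨hx, hx'⟩,
      add_mem (S.restrict inf_le_left hg) (S.restrict inf_le_right hg'), rfl⟩
  one_mem' := ⟨⊤, 1, trivial, (S.smooth ⊤).one_mem, rfl⟩
  zero_mem' := ⟨⊤, 0, trivial, (S.smooth ⊤).zero_mem, rfl⟩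
  neg_mem' := by
    rintro _ ⟨W, g, hx, hg, rfl⟩
    exact ⟨W, -g, hx, neg_mem hg, rfl⟩

def constGerm (x : S.space) (c : ℝ) : S.smoothGerms x :=
  ⟨((fun _ ↦ c : S.space → ℝ) : (𝓝 x).Germ ℝ), ⊤, _, trivial, (S.smooth ⊤).algebraMap_mem c, rfl⟩

def germ {W : Opens S.space} {g : W → ℝ} (hg : g ∈ S.smooth W) {x : S.space} (hx : x ∈ W) :
    S.smoothGerms x :=
  ⟨(Function.extend Subtype.val g 0 : S.space → ℝ), W, _, hx, by
    convert hg with y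
    exact Subtype.val_injective.extend_apply g 0 y, rfl⟩

/-- The tangent space: derivations of the ring of germs of smooth functions at `x`. -/
def tangentSpace (x : S.space) : Submodule ℝ (S.smoothGerms x → ℝ) where
  carrier := {v | (∀ f g, v (f + g) = v f + v g) ∧ (∀ c : ℝ, v (S.constGerm x c) = 0) ∧
    ∀ f g, v (f * g) = f.1.value * v g + g.1.value * v f}
  add_mem' := by
    rintro v w ⟨h1, h2, h3⟩ ⟨k1, k2, k3⟩
    refine ⟨fun f g ↦ ?_, fun c ↦ ?_, fun f g ↦ ?_⟩
    · simp only [Pi.add_apply, h1, k1]; ring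
    · simp only [Pi.add_apply, h2, k2]; ring
    · simp only [Pi.add_apply, h3, k3]; ring
  zero_mem' := by simp
  smul_mem' := by
    rintro c v ⟨h1, h2, h3⟩
    refine ⟨fun f g ↦ ?_, fun c ↦ ?_, fun f g ↦ ?_⟩
    · simp only [Pi.smul_apply, smul_eq_mul, h1]; ring
    · simp only [Pi.smul_apply, smul_eq_mul, h2]; ring
    · simp only [Pi.smul_apply, smul_eq_mul, h3]; ring

/-- Tangent vectors pointing into the space: those that are nonnegative on every nonnegative germ
vanishing at `x`. In corner coordinates `r_1, …, r_j` (and further coordinates without boundary)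
at a point of depth `j` these are the vectors with `dr_i v ≥ 0` for `i ≤ j`. -/
def nonnegTangent (x : S.space) : Set (S.tangentSpace x) :=
  {v | ∀ f : S.smoothGerms x, 0 ≤ f.1 → f.1.value = 0 → 0 ≤ v.1 f}

/-- Strictly positive tangent vectors, the interior of the nonnegative ones; the topology is that
of pointwise convergence, which is the usual one when the tangent space is finite dimensional. -/
def posTangent (x : S.space) : Set (S.tangentSpace x) := interior (S.nonnegTangent x)

/-- The tangent space of the stratum through `x`, which is the largest linear subspace of
`nonnegTangent`. -/
def tangentFace (x : S.space) : Submodule ℝ (S.tangentSpace x) where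
  carrier := {v | ∀ f : S.smoothGerms x, 0 ≤ f.1 → f.1.value = 0 → v.1 f = 0}
  add_mem' hv hw f h0 h1 := by
    simp [hv f h0 h1, hw f h0 h1]
  zero_mem' _ _ _ := rfl
  smul_mem' c v hv f h0 h1 := by
    simp [hv f h0 h1]

/-- The normal space of the stratum through `x`. -/
abbrev normalSpace (x : S.space) : Type := S.tangentSpace x ⧸ S.tangentFace x

/-- Positive normal vectors. -/
def posNormal (x : S.space) : Set (S.normalSpace x) :=
  (S.tangentFace x).mkQ '' S.posTangent x

/-- A `C^∞` tangential basepoint: a point with a positive normal vector. -/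
structure TangentialBasepoint where
  pt : S.space
  vec : S.normalSpace pt
  pos : vec ∈ S.posNormal pt

end SmoothSpace

/-- A positive log structure: a sheaf of monoids with a map `α` to the nonnegative smooth functions
that identifies the preimage of the positive smooth functions with the positive smooth functions. -/
structure PositiveLogSpace extends SmoothSpace where
  M : TopCat.Presheaf CommMonCat.{0} space
  isSheaf : TopCat.Presheaf.IsSheaf M
  α (W : Opens space) : M.obj (op W) →* (W → ℝ)
  α_smooth (W : Opens space) (m : M.obj (op W)) : α W m ∈ smooth W
  α_nonneg (W : Opens space) (m : M.obj (op W)) (y : W) : 0 ≤ α W m y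
  α_naturality {V W : Opens space} (h : V ≤ W) (m : M.obj (op W)) (y : V) :
    α V (M.map (homOfLE h).op m) y = α W m ⟨y, h y.2⟩
  existsUnique_of_pos (W : Opens space) (g : W → ℝ) :
    g ∈ smooth W → (∀ y, 0 < g y) → ∃! m, α W m = g

/-- A weak morphism: a smooth map with a pullback morphism of sheaves of monoids
`M_T ⟶ map_* M_S` which commutes with `α` on the positive smooth functions. -/
structure PositiveLogSpace.WeakHom (S T : PositiveLogSpace) where
  map : S.space ⟶ T.space
  smooth_comp (W : Opens T.space) (g : W → ℝ) (hg : g ∈ T.smooth W) :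
    (fun x : (Opens.map map).obj W ↦ g ⟨map x, x.2⟩) ∈ S.smooth ((Opens.map map).obj W)
  pull : T.M ⟶ (TopCat.Presheaf.pushforward CommMonCat map).obj S.M
  pull_pos (W : Opens T.space) (m : T.M.obj (op W)) : (∀ y, 0 < T.α W m y) →
    ∀ x : (Opens.map map).obj W,
      S.α ((Opens.map map).obj W) (pull.app (op W) m) x = T.α W m ⟨map x, x.2⟩

/-- The presheaf of monoids given by submonoids of functions. -/
def functionPresheaf {X : TopCat.{0}} (N : ∀ W : Opens X, Submonoid (W → ℝ))
    (res : ∀ {V W : Opens X} (h : V ≤ W) {g : W → ℝ}, g ∈ N W →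
      (fun y : V ↦ g ⟨y, h y.2⟩) ∈ N V) : TopCat.Presheaf CommMonCat.{0} X where
  obj W := CommMonCat.of (N W.unop)
  map {W V} i := CommMonCat.ofHom
    { toFun g := ⟨fun y ↦ g.1 ⟨y, i.unop.le y.2⟩, res i.unop.le g.2⟩
      map_one' := rfl
      map_mul' _ _ := rfl }

/-- The positive log structure given by a sheaf of submonoids of the nonnegative smooth functions
that contains the positive ones; `α` is the inclusion. -/
def PositiveLogSpace.ofFunctions (S : SmoothSpace) (N : ∀ W : Opens S.space, Submonoid (W → ℝ))
    (res : ∀ {V W : Opens S.space} (h : V ≤ W) {g : W → ℝ}, g ∈ N W →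
      (fun y : V ↦ g ⟨y, h y.2⟩) ∈ N V)
    (glue : ∀ (W : Opens S.space) (g : W → ℝ), (∀ x : W, ∃ (V : Opens S.space) (h : V ≤ W),
      x.1 ∈ V ∧ (fun y : V ↦ g ⟨y, h y.2⟩) ∈ N V) → g ∈ N W)
    (smooth : ∀ W, ∀ g ∈ N W, g ∈ S.smooth W)
    (nonneg : ∀ W, ∀ g ∈ N W, ∀ y, 0 ≤ g y)
    (pos : ∀ W, ∀ g ∈ S.smooth W, (∀ y, 0 < g y) → g ∈ N W) : PositiveLogSpace where
  toSmoothSpace := S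
  M := functionPresheaf N res
  isSheaf := by
    let P : TopCat.LocalPredicate (fun _ : S.space ↦ ℝ) :=
      { pred := fun {W} g ↦ g ∈ N W
        res := fun i g hg ↦ res i.le hg
        locality := fun {W} g hg ↦ glue W g fun x ↦ by
          obtain ⟨V, hV, i, h⟩ := hg x
          exact ⟨V, i.le, hV, h⟩ }
    rw [TopCat.Presheaf.isSheaf_iff_isSheaf_comp (forget CommMonCat)]
    let e : functionPresheaf N res ⋙ forget CommMonCat ≅
      (TopCat.subpresheafToTypes P.toPrelocalPredicate) :=
      NatIso.ofComponents (fun U ↦ Iso.refl _) (fun f ↦ rfl)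
    exact TopCat.Presheaf.isSheaf_of_iso e.symm (TopCat.subpresheafToTypes.isSheaf P)
  α W := (N W).subtype
  α_smooth W m := smooth W m.1 m.2
  α_nonneg W m := nonneg W m.1 m.2
  α_naturality _ _ _ := rfl
  existsUnique_of_pos W g hg h := ⟨⟨g, pos W g hg h⟩, rfl, fun m hm ↦ Subtype.ext hm⟩

def SmoothSpace.point : SmoothSpace where
  space := TopCat.of PUnit
  smooth _ := ⊤
  restrict _ _ _ := trivial
  glue _ _ _ := trivial

/-- The point with its trivial positive log structure, the monoid of positive numbers. -/
def PositiveLogSpace.point : PositiveLogSpace :=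
  .ofFunctions SmoothSpace.point
    (fun W ↦ { carrier := {g | ∀ y, 0 < g y}
               mul_mem' := fun hf hg y ↦ mul_pos (hf y) (hg y)
               one_mem' := fun _ ↦ one_pos })
    (fun h _ hg y ↦ hg ⟨y, h y.2⟩)
    (fun W g hg y ↦ by
      obtain ⟨V, h, hy, hV⟩ := hg y
      exact hV ⟨y, hy⟩)
    (fun _ _ _ ↦ trivial) (fun _ _ hg y ↦ (hg y).le) (fun _ _ _ h ↦ h)

section Stalks

variable {Y : Scheme.{0}}

/-- Lifts of the `ℂ`-point `p` to `U`; these pairs `(U, u)` are the étale neighbourhoods of `p`. -/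
abbrev Lift (p : Spec (.of ℂ) ⟶ Y) (U : Y.Etale) : Type := (Scheme.pointSmallEtale p).fiber.obj U

def Lift.toHom {p : Spec (.of ℂ) ⟶ Y} {U : Y.Etale} (u : Lift p U) : Spec (.of ℂ) ⟶ U.left :=
  CommaMorphism.left (show Over.mk p ⟶ (Scheme.Etale.forget Y).obj U from u)

def Lift.map {p : Spec (.of ℂ) ⟶ Y} {U V : Y.Etale} (j : U ⟶ V) (u : Lift p U) : Lift p V :=
  (Scheme.pointSmallEtale p).fiber.map j u

theorem Lift.toHom_comp {p : Spec (.of ℂ) ⟶ Y} {U : Y.Etale} (u : Lift p U) :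
    u.toHom ≫ U.hom = p :=
  Over.w (show Over.mk p ⟶ (Scheme.Etale.forget Y).obj U from u)

theorem Lift.map_toHom {p : Spec (.of ℂ) ⟶ Y} {U V : Y.Etale} (j : U ⟶ V) (u : Lift p U) :
    (u.map j).toHom = u.toHom ≫ j.left := rfl

theorem exists_common_lift {p : Spec (.of ℂ) ⟶ Y} {U V : Y.Etale} (u : Lift p U) (v : Lift p V) :
    ∃ (W : Y.Etale) (w : Lift p W) (i : W ⟶ U) (j : W ⟶ V), w.map i = u ∧ w.map j = v := by
  let F := (Scheme.pointSmallEtale p).fiber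
  let a : F.Elements := ⟨U, u⟩
  let b : F.Elements := ⟨V, v⟩
  exact ⟨(IsCofiltered.min a b).1, (IsCofiltered.min a b).2, (IsCofiltered.minToLeft a b).1,
    (IsCofiltered.minToRight a b).1, (IsCofiltered.minToLeft a b).2,
    (IsCofiltered.minToRight a b).2⟩

theorem exists_common_lift_over {p : Spec (.of ℂ) ⟶ Y} {U V T : Y.Etale} (u : Lift p U)
    (v : Lift p V) (a : U ⟶ T) (b : V ⟶ T) (h : u.map a = v.map b) :
    ∃ (W : Y.Etale) (w : Lift p W) (i : W ⟶ U) (j : W ⟶ V),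
      w.map i = u ∧ w.map j = v ∧ i ≫ a = j ≫ b := by
  let F := (Scheme.pointSmallEtale p).fiber
  let eu : F.Elements := ⟨U, u⟩
  let ev : F.Elements := ⟨V, v⟩
  let et : F.Elements := ⟨T, v.map b⟩
  let ia : eu ⟶ et := ⟨a, h⟩
  let ib : ev ⟶ et := ⟨b, rfl⟩
  obtain ⟨w, i, j, hij⟩ := IsCofiltered.cospan ia ib
  exact ⟨w.1, w.2, i.1, j.1, i.2, j.2, congrArg Subtype.val hij⟩

theorem Lift.map_map {p : Spec (.of ℂ) ⟶ Y} {U V T : Y.Etale} (u : Lift p U) (a : U ⟶ V)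
    (b : V ⟶ T) : (u.map a).map b = u.map (a ≫ b) :=
  congr($((Scheme.pointSmallEtale p).fiber.map_comp a b) u).symm

def Lift.self (p : Spec (.of ℂ) ⟶ Y) : Lift p (Scheme.Etale.mk (𝟙 Y)) :=
  (Over.homMk p : Over.mk p ⟶ Over.mk (𝟙 Y))

/-- The stalk of the structure sheaf at `p` in the étale topology. -/
def stalk (p : Spec (.of ℂ) ⟶ Y) : CommRingCat.{0} :=
  (Scheme.pointSmallEtale p).presheafFiber.obj (etaleO Y)

def Lift.germ {p : Spec (.of ℂ) ⟶ Y} {U : Y.Etale} (u : Lift p U) :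
    Γ(U.left, ⊤) →+* stalk p :=
  ((Scheme.pointSmallEtale p).toPresheafFiber U u (etaleO Y)).hom

theorem Lift.germ_map {p : Spec (.of ℂ) ⟶ Y} {U V : Y.Etale} (j : U ⟶ V) (u : Lift p U)
    (f : Γ(V.left, ⊤)) : u.germ (j.left.appTop f) = (u.map j).germ f :=
  congr($((Scheme.pointSmallEtale p).toPresheafFiber_w j u (etaleO Y)).hom f)

/-- The value at the point `u` of a function on `U`. -/
def Lift.eval {p : Spec (.of ℂ) ⟶ Y} {U : Y.Etale} (u : Lift p U) : Γ(U.left, ⊤) →+* ℂ :=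
  (Scheme.ΓSpecIso (.of ℂ)).hom.hom.comp u.toHom.appTop.hom

theorem Lift.eval_map {p : Spec (.of ℂ) ⟶ Y} {U V : Y.Etale} (j : U ⟶ V) (u : Lift p U)
    (f : Γ(V.left, ⊤)) : u.eval (j.left.appTop f) = (u.map j).eval f := by
  change _ = (Scheme.ΓSpecIso (.of ℂ)).hom.hom ((u.toHom ≫ j.left).appTop.hom f)
  rw [Scheme.Hom.comp_appTop]
  rfl

/-- The value at `p` of a germ. -/
def stalkEval (p : Spec (.of ℂ) ⟶ Y) : stalk p →+* ℂ :=
  ((Scheme.pointSmallEtale p).presheafFiberDesc (P := etaleO Y) (T := .of ℂ)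
    (fun U u ↦ CommRingCat.ofHom (Lift.eval (U := U) u))
    (fun U V j u ↦ by
      ext f
      exact Lift.eval_map j u f)).hom

theorem stalkEval_germ {p : Spec (.of ℂ) ⟶ Y} {U : Y.Etale} (u : Lift p U) (f : Γ(U.left, ⊤)) :
    stalkEval p (u.germ f) = u.eval f :=
  congr($((Scheme.pointSmallEtale p).toPresheafFiber_presheafFiberDesc (P := etaleO Y)
    (T := .of ℂ) (fun U u ↦ CommRingCat.ofHom (Lift.eval (U := U) u)) (fun U V j u ↦ by
      ext f
      exact Lift.eval_map j u f) U u).hom f)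

/-- The constant function `c` on `U`. -/
def constSection (π : Y ⟶ Spec (.of ℂ)) (U : Y.Etale) (c : ℂ) : Γ(U.left, ⊤) :=
  (U.hom ≫ π).appTop ((Scheme.ΓSpecIso (.of ℂ)).inv c)

end Stalks

section KatoNakayama

variable {Y : Scheme.{0}} (π : Y ⟶ Spec (.of ℂ)) (D : Y.IdealSheafData)

/-- The complement of the divisor cut out by the ideal sheaf `D`. -/
def divisorCompl : Y.Opens := D.support.compl

/-- The stalk at `p` of the sheaf of functions invertible off `D`, inside the stalk of the
structure sheaf. -/
def stalkM (p : Spec (.of ℂ) ⟶ Y) : Submonoid (stalk p) where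
  carrier := {x | ∃ (U : Y.Etale) (u : Lift p U) (m : logSections Y (divisorCompl D) U),
    u.germ m.1 = x}
  mul_mem' := by
    rintro _ _ ⟨U, u, m, rfl⟩ ⟨V, v, n, rfl⟩
    obtain ⟨W, w, i, j, rfl, rfl⟩ := exists_common_lift u v
    refine ⟨W, w, logSectionsMap _ i m * logSectionsMap _ j n, ?_⟩
    rw [← Lift.germ_map, ← Lift.germ_map, ← map_mul]
    rfl
  one_mem' := ⟨_, Lift.self p, 1, map_one _⟩

def Lift.germM {p : Spec (.of ℂ) ⟶ Y} {U : Y.Etale} (u : Lift p U)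
    (m : logSections Y (divisorCompl D) U) : stalkM D p :=
  ⟨u.germ m.1, U, u, m, rfl⟩

/-- A point of the Kato--Nakayama space of `Y log D`: a `ℂ`-point of `Y` and a homomorphism `arg`
from the stalk of the monoid to the circle with `arg f = f / |f|` for units `f`. -/
structure KNPoint where
  pt : Spec (.of ℂ) ⟶ Y
  pt_str : pt ≫ π = 𝟙 _
  arg : stalkM D pt →* Circle
  arg_unit (m : stalkM D pt) : IsUnit (m : stalk pt) →
    (arg m : ℂ) * ‖stalkEval pt m‖ = stalkEval pt m

/-- The pullback to `U` of the Kato--Nakayama space of `Y log D`. -/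
structure KNOver (U : Y.Etale) where
  pt : KNPoint π D
  lift : Lift pt.pt U

variable {π D}

def KNOver.map {U V : Y.Etale} (j : U ⟶ V) (y : KNOver π D U) : KNOver π D V :=
  ⟨y.pt, y.lift.map j⟩

/-- The basic functions on the pullback to `U` of the Kato--Nakayama space: real and imaginary
parts of regular functions, and absolute values and (cosine and sine of) arguments of sections of
the log structure. -/
inductive IsCoordinate (U : Y.Etale) : (KNOver π D U → ℝ) → Prop
  | re (f : Γ(U.left, ⊤)) : IsCoordinate U fun y ↦ (y.lift.eval f).re
  | im (f : Γ(U.left, ⊤)) : IsCoordinate U fun y ↦ (y.lift.eval f).im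
  | abs (m : logSections Y (divisorCompl D) U) : IsCoordinate U fun y ↦ ‖y.lift.eval m.1‖
  | cos (m : logSections Y (divisorCompl D) U) :
      IsCoordinate U fun y ↦ (y.pt.arg (y.lift.germM D m) : ℂ).re
  | sin (m : logSections Y (divisorCompl D) U) :
      IsCoordinate U fun y ↦ (y.pt.arg (y.lift.germM D m) : ℂ).im

theorem Lift.germM_map {p : Spec (.of ℂ) ⟶ Y} {U V : Y.Etale} (j : U ⟶ V) (u : Lift p U)
    (m : logSections Y (divisorCompl D) V) :
    u.germM D (logSectionsMap _ j m) = (u.map j).germM D m :=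
  Subtype.ext (u.germ_map j m.1)

theorem IsCoordinate.comp_map {U V : Y.Etale} (j : U ⟶ V) {e : KNOver π D V → ℝ}
    (he : IsCoordinate V e) : IsCoordinate U (fun y ↦ e (y.map j)) := by
  cases he with
  | re f => simpa only [Lift.eval_map] using! IsCoordinate.re (j.left.appTop f)
  | im f => simpa only [Lift.eval_map] using! IsCoordinate.im (j.left.appTop f)
  | abs m => simpa only [logSectionsMap, MonoidHom.coe_mk, OneHom.coe_mk, Lift.eval_map] using!
      IsCoordinate.abs (logSectionsMap _ j m)
  | cos m => simpa only [Lift.germM_map] using! IsCoordinate.cos (logSectionsMap _ j m)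
  | sin m => simpa only [Lift.germM_map] using! IsCoordinate.sin (logSectionsMap _ j m)

/-- The coarsest topology on the pullback to `U` in which the basic functions are continuous. -/
@[reducible]
def coordTopology (U : Y.Etale) : TopologicalSpace (KNOver π D U) :=
  ⨅ e : {e : KNOver π D U → ℝ // IsCoordinate U e}, .induced e.1 inferInstance

theorem isOpen_preimage_map {U V : Y.Etale} (j : U ⟶ V) {N : Set (KNOver π D V)}
    (hN : IsOpen[coordTopology V] N) : IsOpen[coordTopology U] (KNOver.map j ⁻¹' N) := by
  have : @Continuous _ _ (coordTopology U) (coordTopology V)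
      (KNOver.map j : KNOver π D U → KNOver π D V) := by
    refine continuous_iInf_rng.2 fun e ↦ continuous_induced_rng.2 ?_
    exact continuous_iInf_dom (i := ⟨_, e.2.comp_map j⟩) continuous_induced_dom
  exact @Continuous.isOpen_preimage _ _ (coordTopology U) (coordTopology V) _ this N hN

/-- The topology on the pullback to `U`, generated by the images of the subsets given by the basic
functions over étale `U`-schemes: local equations of the branches of `D` may exist only there. -/
instance (U : Y.Etale) : TopologicalSpace (KNOver π D U) :=
  .generateFrom {N | ∃ (V : Y.Etale) (j : V ⟶ U) (B : Set (KNOver π D V)),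
    IsOpen[coordTopology V] B ∧ N = KNOver.map j '' B}

/-- The topology of the Kato--Nakayama space, given by the basic functions étale locally. -/
instance : TopologicalSpace (KNPoint π D) :=
  .generateFrom {N | ∃ (V : Y.Etale) (B : Set (KNOver π D V)),
    IsOpen[coordTopology V] B ∧ N = KNOver.pt '' B}

theorem KNOver.continuous_fst (U : Y.Etale) :
    Continuous (KNOver.pt : KNOver π D U → KNPoint π D) := by
  refine continuous_generateFrom_iff.2 ?_
  rintro _ ⟨V, B, hB, rfl⟩
  refine isOpen_iff_forall_mem_open.2 ?_
  rintro ⟨x, u⟩ ⟨⟨x', v⟩, hv, h⟩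
  obtain rfl : x' = x := h
  obtain ⟨W, w, i, j, rfl, rfl⟩ := exists_common_lift u v
  refine ⟨KNOver.map i '' (KNOver.map j ⁻¹' B), ?_, .basic _ ⟨W, i, _, isOpen_preimage_map j hB, rfl⟩,
    ⟨⟨_, w⟩, hv, rfl⟩⟩
  rintro _ ⟨y, hy, rfl⟩
  exact ⟨_, hy, rfl⟩

theorem KNOver.continuous_map {U V : Y.Etale} (j : U ⟶ V) :
    Continuous (KNOver.map j : KNOver π D U → KNOver π D V) := by
  refine continuous_generateFrom_iff.2 ?_
  rintro _ ⟨T, k, B, hB, rfl⟩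
  refine isOpen_iff_forall_mem_open.2 ?_
  rintro ⟨x, u⟩ ⟨⟨x', v⟩, hv, h⟩
  obtain rfl : x' = x := (KNOver.mk.inj h).1
  have h' : v.map k = u.map j := eq_of_heq (KNOver.mk.inj h).2
  obtain ⟨W, w, a, b, rfl, rfl, hab⟩ := exists_common_lift_over v u k j h'
  refine ⟨KNOver.map b '' (KNOver.map a ⁻¹' B), ?_,
    .basic _ ⟨W, b, _, isOpen_preimage_map a hB, rfl⟩, ⟨⟨_, w⟩, hv, rfl⟩⟩
  rintro _ ⟨y, hy, rfl⟩
  refine ⟨_, hy, ?_⟩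
  simp only [KNOver.map, Lift.map_map, hab]

/-- A function on the Kato--Nakayama space is smooth at `x` if near `x`, over an étale
neighbourhood, it is a smooth function of finitely many of the basic functions. Near a point where
`D` is `z_1 ⋯ z_k = 0` this means: a smooth function of `r_i = |z_i| ≥ 0` and `arg z_i` for
`i ≤ k` and of the real and imaginary parts of the other coordinates `z_j`. -/
def KNSmoothAt (g : KNPoint π D → ℝ) (x : KNPoint π D) : Prop :=
  ∃ (U : Y.Etale) (u : Lift x.pt U) (ι : Type) (_ : Fintype ι) (e : ι → KNOver π D U → ℝ)
    (F : (ι → ℝ) → ℝ), (∀ i, IsCoordinate U (e i)) ∧ ContDiff ℝ ∞ F ∧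
      ∀ᶠ y in 𝓝 (⟨x, u⟩ : KNOver π D U), g y.pt = F fun i ↦ e i y

/-- A function is monomial at `x` if near `x` it is `g * |m|` with `g` smooth and positive and `m`
a local section of the log structure. -/
def KNMonomialAt (h : KNPoint π D → ℝ) (x : KNPoint π D) : Prop :=
  ∃ g : KNPoint π D → ℝ, KNSmoothAt g x ∧ (∀ᶠ y in 𝓝 x, 0 < g y) ∧
    ∃ (U : Y.Etale) (u : Lift x.pt U) (m : logSections Y (divisorCompl D) U),
      ∀ᶠ y in 𝓝 (⟨x, u⟩ : KNOver π D U), h y.pt = g y.pt * ‖y.lift.eval m.1‖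

theorem KNSmoothAt.congr {g h : KNPoint π D → ℝ} {x : KNPoint π D} (hg : KNSmoothAt g x)
    (hgh : g =ᶠ[𝓝 x] h) : KNSmoothAt h x := by
  obtain ⟨U, u, ι, _, e, F, he, hF, H⟩ := hg
  refine ⟨U, u, ι, _, e, F, he, hF, ?_⟩
  filter_upwards [H, (KNOver.continuous_fst U).continuousAt.eventually hgh] with y h1 h2
  rw [← h2, h1]

theorem KNMonomialAt.congr {g h : KNPoint π D → ℝ} {x : KNPoint π D} (hg : KNMonomialAt g x)
    (hgh : g =ᶠ[𝓝 x] h) : KNMonomialAt h x := by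
  obtain ⟨k, hk, hpos, U, u, m, H⟩ := hg
  refine ⟨k, hk, hpos, U, u, m, ?_⟩
  filter_upwards [H, (KNOver.continuous_fst U).continuousAt.eventually hgh] with y h1 h2
  rw [← h2, h1]

theorem KNOver.eventually_map {U V : Y.Etale} (j : U ⟶ V) {x : KNPoint π D} (u : Lift x.pt U)
    {P : KNOver π D V → Prop} (h : ∀ᶠ y in 𝓝 (⟨x, u.map j⟩ : KNOver π D V), P y) :
    ∀ᶠ y in 𝓝 (⟨x, u⟩ : KNOver π D U), P (y.map j) :=
  (KNOver.continuous_map j).continuousAt.eventually h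

theorem KNSmoothAt.map₂ {g h : KNPoint π D → ℝ} {x : KNPoint π D} (hg : KNSmoothAt g x)
    (hh : KNSmoothAt h x) {φ : ℝ × ℝ → ℝ} (hφ : ContDiff ℝ ∞ φ) :
    KNSmoothAt (fun y ↦ φ (g y, h y)) x := by
  obtain ⟨U, u, ι, _, e, F, he, hF, H⟩ := hg
  obtain ⟨V, v, κ, _, e', F', he', hF', H'⟩ := hh
  obtain ⟨W, w, i, j, rfl, rfl⟩ := exists_common_lift u v
  refine ⟨W, w, ι ⊕ κ, inferInstance,
    Sum.elim (fun a y ↦ e a (y.map i)) (fun a y ↦ e' a (y.map j)),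
    fun z ↦ φ (F fun a ↦ z (.inl a), F' fun a ↦ z (.inr a)), ?_, ?_, ?_⟩
  · rintro (a | a)
    · exact (he a).comp_map i
    · exact (he' a).comp_map j
  · refine hφ.comp ((hF.comp ?_).prodMk (hF'.comp ?_))
    · exact contDiff_pi.2 fun a ↦ contDiff_apply ℝ ℝ (Sum.inl a)
    · exact contDiff_pi.2 fun a ↦ contDiff_apply ℝ ℝ (Sum.inr a)
  · filter_upwards [KNOver.eventually_map i w H, KNOver.eventually_map j w H'] with y h1 h2
    exact congrArg φ (Prod.ext h1 h2)

theorem KNSmoothAt.mul {g h : KNPoint π D → ℝ} {x : KNPoint π D} (hg : KNSmoothAt g x)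
    (hh : KNSmoothAt h x) : KNSmoothAt (g * h) x :=
  hg.map₂ hh (contDiff_fst.mul contDiff_snd)

theorem KNSmoothAt.add {g h : KNPoint π D → ℝ} {x : KNPoint π D} (hg : KNSmoothAt g x)
    (hh : KNSmoothAt h x) : KNSmoothAt (g + h) x :=
  hg.map₂ hh (contDiff_fst.add contDiff_snd)

theorem KNSmoothAt.const (c : ℝ) (x : KNPoint π D) : KNSmoothAt (fun _ ↦ c) x :=
  ⟨_, Lift.self x.pt, Empty, inferInstance, Empty.elim, fun _ ↦ c, fun i ↦ i.elim,
    contDiff_const, .of_forall fun _ ↦ rfl⟩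

theorem KNMonomialAt.smoothAt {h : KNPoint π D → ℝ} {x : KNPoint π D} (hh : KNMonomialAt h x) :
    KNSmoothAt h x := by
  obtain ⟨g, ⟨U, u, ι, _, e, F, he, hF, H⟩, -, V, v, m, H'⟩ := hh
  obtain ⟨W, w, i, j, rfl, rfl⟩ := exists_common_lift u v
  refine ⟨W, w, Option ι, inferInstance,
    fun a ↦ a.elim (fun y ↦ ‖(y.map j).lift.eval m.1‖) (fun a y ↦ e a (y.map i)),
    fun z ↦ (F fun a ↦ z (some a)) * z none, ?_, ?_, ?_⟩
  · rintro (_ | a)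
    · exact (IsCoordinate.abs m).comp_map j
    · exact (he a).comp_map i
  · refine (hF.comp ?_).mul (contDiff_apply ℝ ℝ none)
    exact contDiff_pi.2 fun a ↦ contDiff_apply ℝ ℝ (some a)
  · filter_upwards [KNOver.eventually_map i w H, KNOver.eventually_map j w H'] with y h1 h2
    exact h2.trans (congrArg (· * _) h1)

theorem KNMonomialAt.nonneg {h : KNPoint π D → ℝ} {x : KNPoint π D} (hh : KNMonomialAt h x) :
    0 ≤ h x := by
  obtain ⟨g, -, hpos, U, u, m, H⟩ := hh
  have h1 : h x = g x * ‖u.eval m.1‖ := H.self_of_nhds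
  rw [h1]
  exact mul_nonneg hpos.self_of_nhds.le (norm_nonneg _)

theorem KNMonomialAt.mul {g h : KNPoint π D → ℝ} {x : KNPoint π D} (hg : KNMonomialAt g x)
    (hh : KNMonomialAt h x) : KNMonomialAt (g * h) x := by
  obtain ⟨k, hk, kpos, U, u, m, H⟩ := hg
  obtain ⟨l, hl, lpos, V, v, n, H'⟩ := hh
  obtain ⟨W, w, i, j, rfl, rfl⟩ := exists_common_lift u v
  refine ⟨k * l, hk.mul hl, ?_, W, w, logSectionsMap _ i m * logSectionsMap _ j n, ?_⟩
  · filter_upwards [kpos, lpos] with y h1 h2 using mul_pos h1 h2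
  · filter_upwards [KNOver.eventually_map i w H, KNOver.eventually_map j w H'] with y h1 h2
    have e1 : y.lift.eval (logSectionsMap _ i m * logSectionsMap _ j n).1 =
        (y.map i).lift.eval m.1 * (y.map j).lift.eval n.1 :=
      (map_mul y.lift.eval _ _).trans
        (congrArg₂ (· * ·) (Lift.eval_map i y.lift m.1) (Lift.eval_map j y.lift n.1))
    rw [e1, norm_mul]
    calc (g * h) y.pt = (k y.pt * ‖(y.map i).lift.eval m.1‖) * (l y.pt * ‖(y.map j).lift.eval n.1‖) :=
          congrArg₂ (· * ·) h1 h2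
      _ = _ := by simp only [Pi.mul_apply]; ring

theorem KNMonomialAt.of_pos {g : KNPoint π D → ℝ} {x : KNPoint π D} (hg : KNSmoothAt g x)
    (hpos : ∀ᶠ y in 𝓝 x, 0 < g y) : KNMonomialAt g x :=
  ⟨g, hg, hpos, _, Lift.self x.pt, 1, .of_forall fun y ↦ by simp⟩

variable (π D)

/-- Extension by zero. -/
def zeroExtend {X : TopCat.{0}} {W : Opens X} (g : W → ℝ) : X → ℝ :=
  Function.extend Subtype.val g 0

theorem zeroExtend_apply {X : TopCat.{0}} {W : Opens X} (g : W → ℝ) (y : W) :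
    zeroExtend g y = g y :=
  Subtype.val_injective.extend_apply g 0 y

theorem zeroExtend_restrict_eventuallyEq {X : TopCat.{0}} {V W : Opens X} (h : V ≤ W) (g : W → ℝ)
    {x : X} (hx : x ∈ V) : zeroExtend (fun y : V ↦ g ⟨y, h y.2⟩) =ᶠ[𝓝 x] zeroExtend g := by
  filter_upwards [V.isOpen.mem_nhds hx] with y hy
  exact (zeroExtend_apply _ ⟨y, hy⟩).trans (zeroExtend_apply g ⟨y, h hy⟩).symm

theorem zeroExtend_mul {X : TopCat.{0}} {W : Opens X} (g h : W → ℝ) :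
    zeroExtend (g * h) = zeroExtend g * zeroExtend h := by
  funext x
  by_cases hx : x ∈ W
  · exact (zeroExtend_apply (g * h) ⟨x, hx⟩).trans
      (congrArg₂ (· * ·) (zeroExtend_apply g ⟨x, hx⟩) (zeroExtend_apply h ⟨x, hx⟩)).symm
  · have h0 : ∀ k : W → ℝ, zeroExtend k x = 0 := fun k ↦
      Function.extend_apply' _ _ _ (by rintro ⟨y, rfl⟩; exact hx y.2)
    simp [h0]

theorem zeroExtend_add {X : TopCat.{0}} {W : Opens X} (g h : W → ℝ) :
    zeroExtend (g + h) = zeroExtend g + zeroExtend h := by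
  funext x
  by_cases hx : x ∈ W
  · exact (zeroExtend_apply (g + h) ⟨x, hx⟩).trans
      (congrArg₂ (· + ·) (zeroExtend_apply g ⟨x, hx⟩) (zeroExtend_apply h ⟨x, hx⟩)).symm
  · have h0 : ∀ k : W → ℝ, zeroExtend k x = 0 := fun k ↦
      Function.extend_apply' _ _ _ (by rintro ⟨y, rfl⟩; exact hx y.2)
    simp [h0]

theorem zeroExtend_const {X : TopCat.{0}} {W : Opens X} (c : ℝ) {x : X} (hx : x ∈ W) :
    (fun _ ↦ c) =ᶠ[𝓝 x] zeroExtend (fun _ : W ↦ c) := by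
  filter_upwards [W.isOpen.mem_nhds hx] with y hy
  exact (zeroExtend_apply (fun _ : W ↦ c) ⟨y, hy⟩).symm

/-- The Kato--Nakayama space with its sheaf of smooth functions. -/
def KNSmooth : SmoothSpace where
  space := TopCat.of (KNPoint π D)
  smooth W :=
    { carrier := {g | ∀ x : W, KNSmoothAt (zeroExtend g) x.1}
      mul_mem' := fun {g h} hg hh x ↦ by
        rw [zeroExtend_mul]
        exact (hg x).mul (hh x)
      add_mem' := fun {g h} hg hh x ↦ by
        rw [zeroExtend_add]
        exact (hg x).add (hh x)
      algebraMap_mem' := fun c x ↦ (KNSmoothAt.const c x.1).congr (zeroExtend_const c x.2) }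
  restrict h _ hg x := (hg ⟨x, h x.2⟩).congr (zeroExtend_restrict_eventuallyEq h _ x.2).symm
  glue W g hg x := by
    obtain ⟨V, h, hx, hV⟩ := hg x
    exact (hV ⟨x, hx⟩).congr (zeroExtend_restrict_eventuallyEq h g hx)

/-- The Kato--Nakayama space of `Y log D` with the positive log structure given by the absolute
values of sections of the log structure times positive smooth functions; this is the basic log
structure of the manifold with corners, its monomial functions in the `r_i`. -/
def KN : PositiveLogSpace :=
  .ofFunctions (KNSmooth π D)
    (fun W ↦
      { carrier := {g | ∀ x : W, KNMonomialAt (zeroExtend g) x.1}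
        mul_mem' := fun {g h} hg hh x ↦ by
          rw [zeroExtend_mul]
          exact (hg x).mul (hh x)
        one_mem' := fun x ↦
          (KNMonomialAt.of_pos (KNSmoothAt.const 1 x.1) (.of_forall fun _ ↦ one_pos)).congr
            (zeroExtend_const 1 x.2) })
    (fun h _ hg x ↦ (hg ⟨x, h x.2⟩).congr (zeroExtend_restrict_eventuallyEq h _ x.2).symm)
    (fun W g hg x ↦ by
      obtain ⟨V, h, hx, hV⟩ := hg x
      exact (hV ⟨x, hx⟩).congr (zeroExtend_restrict_eventuallyEq h g hx))
    (fun W g hg x ↦ (hg x).smoothAt)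
    (fun W g hg x ↦ by
      rw [← zeroExtend_apply g x]
      exact (hg x).nonneg)
    (fun W g hg hpos x ↦ KNMonomialAt.of_pos (hg x) (by
      filter_upwards [W.isOpen.mem_nhds x.2] with y hy
      exact (hpos ⟨y, hy⟩).trans_eq (zeroExtend_apply g ⟨y, hy⟩).symm))

end KatoNakayama

section Algebraic

variable {Y : Scheme.{0}} (π : Y ⟶ Spec (.of ℂ)) (D : Y.IdealSheafData)

/-- `D` is a normal crossing divisor: étale locally on `Y` there are étale coordinates `z_1, …, z_n`
such that the ideal of `D` is generated by a product of distinct coordinates. The empty product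
occurs where `D` is empty. Components of `D` may cross themselves. -/
def IsNormalCrossing : Prop :=
  ∀ y : Y, ∃ (U : Y.Etale) (y' : U.left), U.hom y' = y ∧
    ∃ (n : ℕ) (z : U.left ⟶ 𝔸(Fin n; Spec (.of ℂ))) (S : Finset (Fin n)),
      Etale z ∧ z ≫ (𝔸(Fin n; Spec (.of ℂ)) ↘ Spec (.of ℂ)) = U.hom ≫ π ∧
      D.comap U.hom = Scheme.IdealSheafData.ofIdealTop
        (Ideal.span {∏ i ∈ S, z.appTop (AffineSpace.coord (Spec (.of ℂ)) i)})

/-- The ideal of `D` in the étale stalk at `p`: germs of functions that vanish on `D` (which is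
reduced). -/
def divisorIdeal (p : Spec (.of ℂ) ⟶ Y) : Ideal (stalk p) :=
  Ideal.span {x | ∃ (U : Y.Etale) (u : Lift p U) (f : Γ(U.left, ⊤)),
    U.left.basicOpen f ≤ U.hom ⁻¹ᵁ divisorCompl D ∧ u.germ f = x}

/-- The local irreducible components of `D` through `p`. -/
def Branch (p : Spec (.of ℂ) ⟶ Y) : Type := {q : Ideal (stalk p) // q ∈ (divisorIdeal D p).minimalPrimes}

/-- The tangent space of `Y` at `p`: derivations over `ℂ` of the local ring. -/
def algTangent (p : Spec (.of ℂ) ⟶ Y) : Submodule ℂ (stalk p → ℂ) where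
  carrier := {v | (∀ f g, v (f + g) = v f + v g) ∧
    (∀ (U : Y.Etale) (u : Lift p U) (c : ℂ), v (u.germ (constSection π U c)) = 0) ∧
    ∀ f g, v (f * g) = stalkEval p f * v g + stalkEval p g * v f}
  add_mem' := by
    rintro v w ⟨h1, h2, h3⟩ ⟨k1, k2, k3⟩
    refine ⟨fun f g ↦ ?_, fun U u c ↦ ?_, fun f g ↦ ?_⟩
    · simp only [Pi.add_apply, h1, k1]; ring
    · simp only [Pi.add_apply, h2, k2]; ring
    · simp only [Pi.add_apply, h3, k3]; ring
  zero_mem' := by simp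
  smul_mem' := by
    rintro c v ⟨h1, h2, h3⟩
    refine ⟨fun f g ↦ ?_, fun U u c ↦ ?_, fun f g ↦ ?_⟩
    · simp only [Pi.smul_apply, smul_eq_mul, h1]; ring
    · simp only [Pi.smul_apply, smul_eq_mul, h2]; ring
    · simp only [Pi.smul_apply, smul_eq_mul, h3]; ring

/-- The tangent space at `p` of the branch with ideal `q`. -/
def branchTangent (p : Spec (.of ℂ) ⟶ Y) (q : Ideal (stalk p)) :
    Submodule ℂ (algTangent π p) where
  carrier := {v | ∀ f ∈ q, v.1 f = 0}
  add_mem' hv hw f hf := by simp [hv f hf, hw f hf]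
  zero_mem' _ _ := rfl
  smul_mem' c v hv f hf := by simp [hv f hf]

/-- The normal space at `p` of the branch with ideal `q`. -/
abbrev branchNormal (p : Spec (.of ℂ) ⟶ Y) (q : Ideal (stalk p)) : Type :=
  algTangent π p ⧸ branchTangent π p q

/-- An algebraic tangential basepoint: a `ℂ`-point of `Y` with a nonzero normal vector to each local
irreducible component of `D` through it. -/
structure AlgBasepoint where
  pt : Spec (.of ℂ) ⟶ Y
  pt_str : pt ≫ π = 𝟙 _
  vec (q : Branch D pt) : branchNormal π pt q.1
  ne (q : Branch D pt) : vec q ≠ 0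

end Algebraic

section Comparison

variable {Y : Scheme.{0}} {π : Y ⟶ Spec (.of ℂ)} {D : Y.IdealSheafData}

/-- `Spec ℂ` with the trivial log structure. -/
def LogScheme.point : LogScheme := .divisorial (Spec (.of ℂ)) (𝟙 _) ⊤

variable (π D) in
def logPair : LogScheme := .divisorial Y π (divisorCompl D)

/-- Weak morphisms `Spec ℂ ⟶ Y log D`. -/
abbrev AlgWeakPoint (π : Y ⟶ Spec (.of ℂ)) (D : Y.IdealSheafData) : Type 1 :=
  LogScheme.WeakHom LogScheme.point (logPair π D)

/-- Weak morphisms from the point to the Kato--Nakayama space. -/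
abbrev KNWeakPoint (π : Y ⟶ Spec (.of ℂ)) (D : Y.IdealSheafData) : Type :=
  PositiveLogSpace.WeakHom PositiveLogSpace.point (KN π D)

def AlgWeakPoint.pt (w : AlgWeakPoint π D) : Spec (.of ℂ) ⟶ Y := w.base

theorem AlgWeakPoint.pt_str (w : AlgWeakPoint π D) : w.pt ≫ π = 𝟙 _ := w.base_str

/-- The point of the fibre of `U` over `w.pt` that is given by the lift `u`. -/
def AlgWeakPoint.fibreSection (w : AlgWeakPoint π D) {U : Y.Etale} (u : Lift w.pt U) :
    Spec (.of ℂ) ⟶ ((etalePullback w.base).obj U).left :=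
  pullback.lift u.toHom (𝟙 _) (u.toHom_comp.trans (Category.id_comp _).symm)

/-- The number `w^* m`, computed at the lift `u`. -/
def AlgWeakPoint.value (w : AlgWeakPoint π D) {U : Y.Etale} (u : Lift w.pt U)
    (m : logSections Y (divisorCompl D) U) : ℂ :=
  (Scheme.ΓSpecIso (.of ℂ)).hom ((w.fibreSection u).appTop
    (LogScheme.point.α ((etalePullback w.base).obj U) (w.pull.app (op U) m)))

def KNWeakPoint.pt (s : KNWeakPoint π D) : KNPoint π D := s.map PUnit.unit

/-- The number `s^* r`. -/
def KNWeakPoint.value (s : KNWeakPoint π D) {V : Opens (KN π D).space} (hV : s.pt ∈ V)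
    (r : (KN π D).M.obj (op V)) : ℝ :=
  PositiveLogSpace.point.α ((Opens.map s.map).obj V) (s.pull.app (op V) r) ⟨PUnit.unit, hV⟩

/-- `s` is the morphism of Kato--Nakayama spaces induced by `w`: its point is `w.pt` with
`arg m = w^* m / |w^* m|`, and `s^* |m| = |w^* m|`, for all local sections `m`. -/
def KNMatches (w : AlgWeakPoint π D) (s : KNWeakPoint π D) : Prop :=
  ∃ (arg : stalkM D w.pt →* Circle)
    (arg_unit : ∀ m : stalkM D w.pt, IsUnit (m : stalk w.pt) →
      (arg m : ℂ) * ‖stalkEval w.pt m‖ = stalkEval w.pt m),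
    s.pt = ⟨w.pt, w.pt_str, arg, arg_unit⟩ ∧
    ∀ (U : Y.Etale) (u : Lift w.pt U) (m : logSections Y (divisorCompl D) U),
      (arg (u.germM D m) : ℂ) * ‖w.value u m‖ = w.value u m ∧
      ∀ (V : Opens (KN π D).space) (hV : s.pt ∈ V) (r : (KN π D).M.obj (op V)),
        (∀ᶠ y in 𝓝 (⟨⟨w.pt, w.pt_str, arg, arg_unit⟩, u⟩ : KNOver π D U),
          ∀ hy : y.pt ∈ V, (KN π D).α V r ⟨y.pt, hy⟩ = ‖y.lift.eval m.1‖) →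
        s.value hV r = ‖w.value u m‖

/-- The basepoint `a` is the one with `w^* z = ⟨v_q, dz⟩` for every local equation `z` of every
branch `q` of `D`, where `v_q` is its normal vector to `q`. -/
def AlgMatches (w : AlgWeakPoint π D) (a : AlgBasepoint π D) : Prop :=
  ∃ (vec : ∀ q : Branch D w.pt, branchNormal π w.pt q.1) (ne : ∀ q, vec q ≠ 0),
    a = ⟨w.pt, w.pt_str, vec, ne⟩ ∧
    ∀ (U : Y.Etale) (u : Lift w.pt U) (m : logSections Y (divisorCompl D) U) (q : Branch D w.pt),
      Ideal.span {u.germ m.1} = q.1 → ∀ v : algTangent π w.pt,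
        (branchTangent π w.pt q.1).mkQ v = vec q → w.value u m = v.1 (u.germ m.1)

/-- The basepoint `b` is the one with `s^* r = ⟨v, dr⟩` for every local section `r` of the log
structure which vanishes at the point to first order, where `v` is its normal vector. -/
def SmoothMatches (s : KNWeakPoint π D) (b : (KN π D).TangentialBasepoint) : Prop :=
  ∃ (vec : (KN π D).normalSpace s.pt) (pos : vec ∈ (KN π D).posNormal s.pt),
    b = ⟨s.pt, vec, pos⟩ ∧
    ∀ (V : Opens (KN π D).space) (hV : s.pt ∈ V) (r : (KN π D).M.obj (op V)),
      (KN π D).α V r ⟨s.pt, hV⟩ = 0 →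
      (∃ t : (KN π D).tangentSpace s.pt, t.1 ((KN π D).germ ((KN π D).α_smooth V r) hV) ≠ 0) →
      ∀ v : (KN π D).tangentSpace s.pt, ((KN π D).tangentFace s.pt).mkQ v = vec →
        s.value hV r = v.1 ((KN π D).germ ((KN π D).α_smooth V r) hV)

/-- The germ at `x` of a function. -/
def KNGerm (x : (KN π D).space) (g : (KN π D).space → ℝ) : (𝓝 x).Germ ℝ := g

/-- `t` is the image of `v` under the differential at `x` of the projection from the
Kato--Nakayama space to `Y(ℂ)`: for every regular function `f` near `x.pt`, pulled back to the
Kato--Nakayama space as `c`, one has `t f = v (re c) + i v (im c)`. -/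
def IsDifferential (x : KNPoint π D) (v : (KN π D).tangentSpace x) (t : algTangent π x.pt) : Prop :=
  ∀ (U : Y.Etale) (u : Lift x.pt U) (f : Γ(U.left, ⊤)),
    ∃ c : KNPoint π D → ℂ,
      (∀ᶠ y in 𝓝 (⟨x, u⟩ : KNOver π D U), c y.pt = y.lift.eval f) ∧
      ∃ (hre : KNGerm x (fun y ↦ (c y).re) ∈ (KN π D).smoothGerms x)
        (him : KNGerm x (fun y ↦ (c y).im) ∈ (KN π D).smoothGerms x),
        t.1 (u.germ f) = (v.1 ⟨_, hre⟩ : ℂ) + (v.1 ⟨_, him⟩ : ℂ) * Complex.I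

def basepointPt (b : (KN π D).TangentialBasepoint) : KNPoint π D := b.pt

/-- The basepoint `a` is the image of `b` under the differential of the projection from the
Kato--Nakayama space to `Y(ℂ)`. -/
def DiffMatches (b : (KN π D).TangentialBasepoint) (a : AlgBasepoint π D) : Prop :=
  ∃ (vec : ∀ q : Branch D (basepointPt b).pt, branchNormal π (basepointPt b).pt q.1)
    (ne : ∀ q, vec q ≠ 0),
    a = ⟨(basepointPt b).pt, (basepointPt b).pt_str, vec, ne⟩ ∧
    ∀ v : (KN π D).tangentSpace b.pt, ((KN π D).tangentFace b.pt).mkQ v = b.vec →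
      ∃ t : algTangent π (basepointPt b).pt, IsDifferential (basepointPt b) v t ∧
        ∀ q, (branchTangent π (basepointPt b).pt q.1).mkQ t = vec q

end Comparison

end

end LogGeom

namespace LogGeom

noncomputable section

/-! Over a fixed `ℂ`-point `p` all four kinds of data amount to one nonzero complex number `c_i` for
each branch of `D` through `p`. Let `g_i`, `i ∈ S₀`, be the coordinates of an étale chart that cut
out these branches. The étale stalk at `p` is a domain in which the `g_i` are pairwise
non-associated primes (`Chart.isDomain_stalk`, `Chart.prime`, `Chart.not_dvd`). Hence every section
of the log structure is a unit times a monomial in the `g_i` (`Chart.exists_monomial`), and the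
branches are exactly the ideals `(g_i)` (`Chart.branch_bijective`).

A weak point of `Y log D` is a homomorphism `φ` on the stalk of the monoid that is prescribed on
units, so it is given by `c_i = φ g_i`. A family of normal vectors is given by `c_i = v_q(g_i)`,
nonzero because `v_q` is. A point of the Kato–Nakayama space over `p` records `arg g_i = c_i /
|c_i|`; a weak point there adds the positive values `|c_i|` on `|g_i|`, and a positive normal vector
adds the positive derivatives of `|g_i|`. The comparison with the projection to `Y` is the Leibniz
rule for `g = arg g · |g|` at a point with `|g| = 0`: the derivative of `g` is `arg g` times the
derivative of `|g|` (`Chart.proj_g`).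

Each parametrisation needs uniqueness and existence. Uniqueness follows from generation: of the
monoid by units and the `g_i` (`Chart.stalkM_induction`), of algebraic derivations by the
coordinates, since étale algebras are unramified (`Chart.tangent_eq_zero`), and of `C^∞` derivations
by the basic functions, through Hadamard's lemma (`KNTangent.eq_zero`, `Chart.knTangent_eq_zero`).

Existence comes from differentiable arcs, which replace local charts of the manifold with corners.
By the implicit function theorem an arc in affine space lifts through étale coordinates
(`exists_arc`, `Chart.exists_arc`). Its velocity is an algebraic tangent vector. An arc with `g_i =
t ρ_i arg(g_i) exp(i η_i t)`, `ρ_i > 0`, leaves `D` for `t > 0` and lifts to the Kato–Nakayama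
space, where its one-sided velocity is a tangent vector with prescribed polar components
(`Chart.exists_regular`). The leading coefficients of functions along an arc are multiplicative and
equal the value on units; this yields homomorphisms with prescribed values on the `g_i`, both on the
monoid of `Y` (`Chart.exists_hom`) and on monomial functions (`Chart.exists_isPosEval`).

Two passages from sheaves to stalks are needed. The Kato–Nakayama space is covered by its étale
pullbacks, and these are locally injective over it, so local functions descend
(`KNOver.exists_descend`). A scheme étale over `ℂ` is a discrete set of reduced points, so a weak
morphism from `Spec ℂ` is the same as a homomorphism on the stalk (`AlgWeakPoint.exists_eq_ofHom`).
-/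

/-! ### Étale algebras, arcs in them, and Hadamard's lemma -/

-- The pairs come from the element `t` of `B ⊗ B` with image `1` in `B` and `(1 ⊗ b - b ⊗ 1) t = 0`:
-- applying `f ⊗ g` gives `(g b - f b) · (f ⊗ g)(t) = 0`. Nonvanishing of the sum is an open
-- condition, which later turns agreement at one point into agreement nearby.
open scoped TensorProduct in
theorem exists_separating_of_formallyUnramified (R B K : Type*) [CommRing R] [CommRing B]
    [Algebra R B] [Algebra.FormallyUnramified R B] [Algebra.EssFiniteType R B] [Field K] :
    ∃ (s : Finset (B × B)), (∀ f : B →+* K, ∑ i ∈ s, f i.1 * f i.2 = 1) ∧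
      ∀ f g : B →+* K, f.comp (algebraMap R B) = g.comp (algebraMap R B) →
        ∑ i ∈ s, f i.1 * g i.2 ≠ 0 → f = g := by
  obtain ⟨t, ht, h1⟩ := (Algebra.FormallyUnramified.iff_exists_tensorProduct (R := R)
    (S := B)).1 inferInstance
  obtain ⟨s, rfl⟩ := TensorProduct.exists_finset t
  refine ⟨s, fun f ↦ ?_, fun f g hfg h ↦ ?_⟩
  · simpa [map_sum] using congrArg f h1
  · let : Algebra R K := (f.comp (algebraMap R B)).toAlgebra
    let f' : B →ₐ[R] K := { f with commutes' := fun r ↦ rfl }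
    let g' : B →ₐ[R] K := { g with commutes' := fun r ↦ congr($hfg r).symm }
    let φ : B ⊗[R] B →ₐ[R] K := Algebra.TensorProduct.lift f' g' fun _ _ ↦ mul_comm _ _
    have hφ (a b : B) : φ (a ⊗ₜ[R] b) = f a * g b := Algebra.TensorProduct.lift_tmul ..
    ext b
    have h2 := congrArg φ (ht b)
    rw [map_mul, map_zero, map_sum] at h2
    have h3 : ∑ i ∈ s, φ (i.1 ⊗ₜ[R] i.2) = ∑ i ∈ s, f i.1 * g i.2 := by
      simp [hφ]
    rw [h3, mul_eq_zero, or_iff_left h, map_sub, sub_eq_zero] at h2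
    have h4 : g b = f b := by simpa [hφ] using h2
    exact h4.symm

-- As `R` is integrally closed, the integral closure of `R` in `K` is the image of `R`, so tensoring
-- with it adds nothing to `S`.
open scoped TensorProduct in
theorem exists_tmul_one_eq_toIntegralClosure {R S K : Type*} [CommRing R] [CommRing S]
    [Algebra R S] [Field K] [Algebra R K] [IsFractionRing R K] [IsIntegrallyClosed R]
    (y : S ⊗[R] integralClosure R K) :
    ∃ a : S, a ⊗ₜ[R] (1 : K) = (TensorProduct.toIntegralClosure R S K y).1 := by
  induction y with
  | zero => exact ⟨0, by simp⟩
  | add y z hy hz =>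
    obtain ⟨a, ha⟩ := hy
    obtain ⟨b, hb⟩ := hz
    exact ⟨a + b, by rw [map_add, TensorProduct.add_tmul, ha, hb]; rfl⟩
  | tmul s c =>
    have hc : IsIntegral R c.1 := c.2
    obtain ⟨r, hr⟩ := IsIntegrallyClosed.isIntegral_iff.1 hc
    refine ⟨r • s, ?_⟩
    rw [TensorProduct.smul_tmul, Algebra.smul_def, mul_one, hr]
    rfl

theorem isIntegral_of_mul_self_eq (R : Type*) {A : Type*} [CommRing R] [CommRing A] [Algebra R A]
    {e : A} (he : e * e = e) : IsIntegral R e := by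
  refine ⟨.X ^ 2 - .X, Polynomial.monic_X_pow_sub (n := 2)
    (Polynomial.degree_X_le.trans_lt (by norm_num)), ?_⟩
  simp [pow_two, he]

open scoped TensorProduct in
/-- Étale algebras over normal domains are locally domains. -/
theorem exists_mul_eq_zero_of_etale {R S k : Type} [CommRing R] [CommRing S] [Algebra R S]
    [IsDomain R] [IsIntegrallyClosed R] [Algebra.Etale R S] [Field k] (w : S →+* k) {f g : S}
    (hfg : f * g = 0) : ∃ a, w a ≠ 0 ∧ (a * f = 0 ∨ a * g = 0) := by
  let K := FractionRing R
  have hflat : Module.Flat R S := inferInstance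
  have hinj : Function.Injective (Algebra.TensorProduct.includeLeft : S →ₐ[S] S ⊗[R] K) :=
    Algebra.TensorProduct.includeLeft_injective (IsFractionRing.injective R K)
  obtain ⟨I, _, A, _, _, E, -⟩ := (Algebra.FormallyEtale.iff_exists_algEquiv_prod K (K ⊗[R] S)).1
    inferInstance
  let ψ : S ⊗[R] K ≃+* Π i, A i := (Algebra.TensorProduct.comm R S K).toRingEquiv.trans E.toRingEquiv
  classical
  -- Over the fraction field the étale algebra is a product of fields. The idempotent `e` is the
  -- indicator of the factors on which `f` is nonzero; there `g` must vanish.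
  let e : S ⊗[R] K := ψ.symm fun i ↦ if ψ (f ⊗ₜ 1) i = 0 then 0 else 1
  have he : e * e = e := by
    apply ψ.injective
    rw [map_mul]
    funext i
    simp only [e, RingEquiv.apply_symm_apply, Pi.mul_apply]
    split_ifs <;> simp
  have hef : e * (f ⊗ₜ 1) = f ⊗ₜ 1 := by
    apply ψ.injective
    rw [map_mul]
    funext i
    simp only [e, RingEquiv.apply_symm_apply, Pi.mul_apply]
    split_ifs with h <;> simp [h]
  have heg : e * (g ⊗ₜ 1) = 0 := by
    apply ψ.injective
    rw [map_mul, map_zero]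
    funext i
    have h0 : ψ (f ⊗ₜ 1) i * ψ (g ⊗ₜ 1) i = 0 := by
      rw [← Pi.mul_apply, ← map_mul, Algebra.TensorProduct.tmul_mul_tmul, hfg]
      simp
    simp only [e, RingEquiv.apply_symm_apply, Pi.mul_apply]
    split_ifs with h
    · simp
    · simpa using (mul_eq_zero.1 h0).resolve_left h
  have hint : IsIntegral S e := isIntegral_of_mul_self_eq S he
  clear_value e
  -- Integral closure commutes with smooth base change, so the integral element `e` already lies in
  -- `S`.
  obtain ⟨y, hy⟩ := (TensorProduct.toIntegralClosure_bijective_of_smooth (R := R) (S := S)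
    (B := K)).2 ⟨e, hint⟩
  obtain ⟨a, ha⟩ := exists_tmul_one_eq_toIntegralClosure y
  rw [hy] at ha
  replace ha : a ⊗ₜ[R] (1 : K) = e := ha
  have haf : a * f = f := hinj (by
    simpa [← ha] using hef)
  have hag : a * g = 0 := hinj (by
    simpa [← ha] using heg)
  -- One of `a` and `1 - a` is nonzero under `w`; the first kills `g`, the second kills `f`.
  by_cases hw : w a = 0
  · exact ⟨1 - a, by simp [hw], .inl (by rw [sub_mul, haf, one_mul, sub_self])⟩
  · exact ⟨a, hw, .inr hag⟩

theorem exists_ringHom_of_standardEtale {R B K : Type*} [CommRing R] [CommRing B] [Algebra R B]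
    [Field K] (P : StandardEtalePresentation R B) (φ : R →+* K) (s : K)
    (hf : P.f.eval₂ φ s = 0) (hg : P.g.eval₂ φ s ≠ 0) :
    ∃ l : B →+* K, l.comp (algebraMap R B) = φ ∧ l P.x = s := by
  let := φ.toAlgebra
  have h : P.HasMap s := ⟨hf, isUnit_iff_ne_zero.2 hg⟩
  let l : B →ₐ[R] K := (P.lift s h).comp P.equivRing.toAlgHom
  refine ⟨l, l.comp_algebraMap, ?_⟩
  change P.lift s h (P.equivRing P.x) = s
  rw [P.equivRing_x, P.lift_X]

theorem contDiffAt_eval_mvPolynomial {σ : Type*} [Finite σ] {E : Type*} [NormedAddCommGroup E]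
    [NormedSpace ℝ E] {n : WithTop ℕ∞} {z : E → σ → ℂ} {x : E} (hz : ∀ i, ContDiffAt ℝ n (z · i) x)
    (p : MvPolynomial σ ℂ) : ContDiffAt ℝ n (fun y ↦ MvPolynomial.eval (z y) p) x := by
  induction p using MvPolynomial.induction_on with
  | C a => simpa using contDiffAt_const
  | add p q hp hq => simpa using hp.add hq
  | mul_X p i hp => simpa using hp.mul (hz i)

theorem contDiffAt_eval₂_mvPolynomial {σ : Type*} [Finite σ] {E : Type*} [NormedAddCommGroup E]
    [NormedSpace ℝ E] {n : WithTop ℕ∞} {z : E → σ → ℂ} {s : E → ℂ} {x : E}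
    (hz : ∀ i, ContDiffAt ℝ n (z · i) x) (hs : ContDiffAt ℝ n s x)
    (p : Polynomial (MvPolynomial σ ℂ)) :
    ContDiffAt ℝ n (fun y ↦ p.eval₂ (MvPolynomial.eval (z y)) (s y)) x := by
  simp only [Polynomial.eval₂_eq_sum_range]
  exact ContDiffAt.sum fun i _ ↦ (contDiffAt_eval_mvPolynomial hz _).mul (hs.pow i)

/-- Étale coordinates lift arcs: a curve in affine space lifts to every étale algebra. -/
theorem exists_arc {σ B : Type} [Finite σ] [CommRing B] [Algebra (MvPolynomial σ ℂ) B]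
    [Algebra.Etale (MvPolynomial σ ℂ) B] (w : B →+* ℂ) (z : ℝ → σ → ℂ)
    (hz : ∀ i, ContDiff ℝ 1 (z · i))
    (hw : w.comp (algebraMap _ _) = MvPolynomial.eval (z 0)) :
    ∃ l : ℝ → B →+* ℂ, l 0 = w ∧
      (∀ᶠ t in 𝓝 0, (l t).comp (algebraMap _ _) = MvPolynomial.eval (z t)) ∧
      ∀ b, DifferentiableAt ℝ (fun t ↦ l t b) 0 := by
  classical
  have : (RingHom.ker w).IsPrime := RingHom.ker_isPrime w
  obtain ⟨a, ha, ⟨⟨P⟩⟩⟩ := Algebra.IsEtaleAt.exists_isStandardEtale (R := MvPolynomial σ ℂ)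
    (RingHom.ker w)
  let B' := Localization.Away a
  have ha' : w a ≠ 0 := ha
  let w' : B' →+* ℂ := IsLocalization.Away.lift a (isUnit_iff_ne_zero.2 ha')
  have hw' (b : B) : w' (algebraMap B B' b) = w b := IsLocalization.Away.lift_eq ..
  have hw₀ : w'.comp (algebraMap (MvPolynomial σ ℂ) B') = MvPolynomial.eval (z 0) := by
    rw [← hw, IsScalarTower.algebraMap_eq (MvPolynomial σ ℂ) B B']
    ext <;> simp [hw']
  have hval (p : Polynomial (MvPolynomial σ ℂ)) :
      p.eval₂ (MvPolynomial.eval (z 0)) (w' P.x) = w' (Polynomial.aeval P.x p) := by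
    rw [← hw₀, Polynomial.aeval_def, Polynomial.hom_eval₂]
  -- Locally the algebra is standard étale, generated by `P.x` subject to `P.f = 0` with `P.g`
  -- inverted. The arc is lifted by solving `P.f = 0` for the generator with the implicit function
  -- theorem; the partial derivative `d` is the value of a unit.
  let F : ℝ × ℂ → ℂ := fun y ↦ P.f.eval₂ (MvPolynomial.eval (z y.1)) y.2
  have hF : ContDiffAt ℝ 1 F (0, w' P.x) :=
    contDiffAt_eval₂_mvPolynomial (fun i ↦ ((hz i).comp contDiff_fst).contDiffAt) contDiffAt_snd _
  have hF0 : F (0, w' P.x) = 0 := by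
    change P.f.eval₂ _ _ = 0
    rw [hval, P.hasMap.1, map_zero]
  let d := P.f.derivative.eval₂ (MvPolynomial.eval (z 0)) (w' P.x)
  have hd : d ≠ 0 := by
    change P.f.derivative.eval₂ _ _ ≠ 0
    rw [hval]
    exact (P.hasMap.isUnit_derivative_f.map w').ne_zero
  have hFs := hF.hasStrictFDerivAt one_ne_zero
  have hinv : (fderiv ℝ F (0, w' P.x) ∘L .inr ℝ ℝ ℂ).IsInvertible := by
    have h1 : HasFDerivAt (fun s : ℂ ↦ F (0, s)) (fderiv ℝ F (0, w' P.x) ∘L .inr ℝ ℝ ℂ) (w' P.x) :=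
      hFs.hasFDerivAt.comp (f := fun s : ℂ ↦ ((0 : ℝ), s)) _ (hasFDerivAt_prodMk_right _ _)
    have h2 : HasDerivAt (fun s : ℂ ↦ F (0, s)) d (w' P.x) := by
      have := (P.f.map (MvPolynomial.eval (z 0))).hasDerivAt (w' P.x)
      simpa only [Polynomial.eval_map, Polynomial.derivative_map] using this
    have h3 := h1.unique (h2.hasFDerivAt.restrictScalars ℝ)
    rw [h3]
    refine ContinuousLinearMap.IsInvertible.of_inverse
      (g := ContinuousLinearMap.mul ℝ ℂ d⁻¹) ?_ ?_ <;> ext <;> simp <;> field_simp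
  let s := hFs.implicitFunctionOfProdDomain hinv
  have hs : DifferentiableAt ℝ s 0 :=
    (hFs.hasStrictFDerivAt_implicitFunctionOfProdDomain hinv).hasFDerivAt.differentiableAt
  have hs0 : s 0 = w' P.x :=
    (hFs.eventually_apply_eq_iff_implicitFunctionOfProdDomain hinv).self_of_nhds.1 rfl
  have hFs' : ∀ᶠ t in 𝓝 (0 : ℝ), F (t, s t) = 0 := by
    simpa [hF0] using hFs.eventually_apply_implicitFunctionOfProdDomain hinv
  have hdiff (p : Polynomial (MvPolynomial σ ℂ)) :
      DifferentiableAt ℝ (fun t ↦ p.eval₂ (MvPolynomial.eval (z t)) (s t)) 0 :=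
    ((contDiffAt_eval₂_mvPolynomial (n := 1) (z := fun y : ℝ × ℂ ↦ z y.1) (s := Prod.snd)
      (x := (0, s 0)) (fun i ↦ ((hz i).comp contDiff_fst).contDiffAt) contDiffAt_snd
      p).differentiableAt one_ne_zero).comp (f := fun t ↦ (t, s t)) 0
      (differentiableAt_id.prodMk hs)
  have hg0 : P.g.eval₂ (MvPolynomial.eval (z 0)) (s 0) ≠ 0 := by
    rw [hs0, hval]
    exact (P.hasMap.2.map w').ne_zero
  have hg : ∀ᶠ t in 𝓝 (0 : ℝ), P.g.eval₂ (MvPolynomial.eval (z t)) (s t) ≠ 0 :=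
    (hdiff P.g).continuousAt.eventually_ne hg0
  have key (t : ℝ) : ∃ l : B' →+* ℂ, F (t, s t) = 0 →
      P.g.eval₂ (MvPolynomial.eval (z t)) (s t) ≠ 0 →
      l.comp (algebraMap _ _) = MvPolynomial.eval (z t) ∧ l P.x = s t := by
    by_cases h : F (t, s t) = 0 ∧ P.g.eval₂ (MvPolynomial.eval (z t)) (s t) ≠ 0
    · obtain ⟨l, hl⟩ := exists_ringHom_of_standardEtale P _ _ h.1 h.2
      exact ⟨l, fun _ _ ↦ hl⟩
    · exact ⟨w', fun h1 h2 ↦ (h ⟨h1, h2⟩).elim⟩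
  choose l hl using key
  have hl0 := hl 0 hFs'.self_of_nhds hg0
  have hev : ∀ᶠ t in 𝓝 (0 : ℝ), (l t).comp (algebraMap _ _) = MvPolynomial.eval (z t) ∧
      l t P.x = s t := by
    filter_upwards [hFs', hg] with t h1 h2 using hl t h1 h2
  refine ⟨fun t ↦ (l t).comp (algebraMap B B'), ?_, ?_, fun b ↦ ?_⟩
  · have hlw : l 0 = w' := by
      let := (MvPolynomial.eval (z 0)).toAlgebra
      let l₁ : B' →ₐ[MvPolynomial σ ℂ] ℂ := { l 0 with commutes' := fun r ↦ congr($(hl0.1) r) }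
      let l₂ : B' →ₐ[MvPolynomial σ ℂ] ℂ := { w' with commutes' := fun r ↦ congr($hw₀ r) }
      have : l₁ = l₂ := P.hom_ext (hl0.2.trans hs0)
      exact congrArg AlgHom.toRingHom this
    ext b
    simp [hlw, hw']
  · filter_upwards [hev] with t ht
    rw [RingHom.comp_assoc, ← IsScalarTower.algebraMap_eq]
    exact ht.1
  -- Every element of a standard étale algebra is a polynomial in the generator divided by a power
  -- of `P.g`, so it varies differentiably with `z` and `s`.
  · obtain ⟨p, n, hp⟩ := P.exists_mul_aeval_x_g_pow_eq_aeval_x (algebraMap B B' b)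
    have h1 : (fun t ↦ p.eval₂ (MvPolynomial.eval (z t)) (s t) /
        P.g.eval₂ (MvPolynomial.eval (z t)) (s t) ^ n) =ᶠ[𝓝 0]
        fun t ↦ (l t).comp (algebraMap B B') b := by
      filter_upwards [hev, hg] with t ht hgt
      have h2 (q : Polynomial (MvPolynomial σ ℂ)) :
          q.eval₂ (MvPolynomial.eval (z t)) (s t) = l t (Polynomial.aeval P.x q) := by
        rw [← ht.1, ← ht.2, Polynomial.aeval_def, Polynomial.hom_eval₂]
      rw [div_eq_iff (pow_ne_zero n hgt), h2, h2, ← map_pow]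
      simp [← hp]
    exact ((hdiff p).div ((hdiff P.g).pow n) (pow_ne_zero n hg0)).congr_of_eventuallyEq h1.symm

/-- Differentiation under the integral sign, by induction on `n`. The target `F` varies in the
induction because the derivative takes values in `E →L[ℝ] F`. -/
theorem contDiff_intervalIntegral {E : Type} [NormedAddCommGroup E] [NormedSpace ℝ E]
    [FiniteDimensional ℝ E] (n : ℕ) {F : Type} [NormedAddCommGroup F] [NormedSpace ℝ F]
    {H : E × ℝ → F} (hH : ContDiff ℝ n H) :
    ContDiff ℝ n (fun x ↦ ∫ s in (0 : ℝ)..1, H (x, s)) := by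
  induction n generalizing F with
  | zero =>
    rw [Nat.cast_zero, contDiff_zero] at hH ⊢
    exact intervalIntegral.continuous_parametric_intervalIntegral_of_continuous' (by fun_prop) _ _
  | succ n ih =>
    have hn : ((n + 1 : ℕ) : WithTop ℕ∞) ≠ 0 := by simp
    let H' : E × ℝ → E →L[ℝ] F := fun y ↦ fderiv ℝ H y ∘L .inl ℝ E ℝ
    have hH' : ContDiff ℝ n H' :=
      (hH.fderiv_right (m := n) (by simp)).clm_comp contDiff_const
    have hd (y : E × ℝ) : HasFDerivAt (fun x ↦ H (x, y.2)) (H' y) y.1 :=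
      (hH.differentiable hn y).hasFDerivAt.comp (f := fun x ↦ (x, y.2)) y.1
        (hasFDerivAt_prodMk_left _ _)
    have hproper : ProperSpace E := FiniteDimensional.proper_real E
    have hG (x : E) : HasFDerivAt (fun x ↦ ∫ s in (0 : ℝ)..1, H (x, s))
        (∫ s in (0 : ℝ)..1, H' (x, s)) x := by
      obtain ⟨C, hC⟩ := ((isCompact_closedBall x 1).prod
        (isCompact_Icc (a := (0 : ℝ)) (b := 1))).exists_bound_of_continuousOn
        hH'.continuous.continuousOn
      have hc (x : E) : Continuous fun s : ℝ ↦ H (x, s) := hH.continuous.comp (by fun_prop)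
      have hc' (x : E) : Continuous fun s : ℝ ↦ H' (x, s) := hH'.continuous.comp (by fun_prop)
      refine intervalIntegral.hasFDerivAt_integral_of_dominated_of_fderiv_le
        (F := fun x s ↦ H (x, s)) (F' := fun x s ↦ H' (x, s)) (bound := fun _ ↦ C)
        (Metric.closedBall_mem_nhds x one_pos) (.of_forall fun y ↦ ?_) ?_ ?_
        (.of_forall fun s hs y hy ↦ hC (y, s) ⟨hy, ?_⟩) ?_
        (.of_forall fun s _ y _ ↦ hd (y, s))
      · exact (hc y).aestronglyMeasurable
      · exact (hc x).intervalIntegrable _ _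
      · exact (hc' x).aestronglyMeasurable
      · rw [Set.uIoc_of_le zero_le_one] at hs
        exact Set.Ioc_subset_Icc_self hs
      · exact intervalIntegrable_const
    rw [Nat.cast_succ, contDiff_succ_iff_fderiv]
    refine ⟨fun x ↦ (hG x).differentiableAt, by simp, ?_⟩
    rw [show fderiv ℝ (fun x ↦ ∫ s in (0 : ℝ)..1, H (x, s)) =
      fun x ↦ ∫ s in (0 : ℝ)..1, H' (x, s) from funext fun x ↦ (hG x).fderiv]
    exact ih hH'

/-- Hadamard's lemma. -/
theorem exists_contDiff_eq_add_sum {ι : Type} [Fintype ι] {F : (ι → ℝ) → ℝ} (hF : ContDiff ℝ ∞ F)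
    (a : ι → ℝ) : ∃ G : ι → (ι → ℝ) → ℝ, (∀ i, ContDiff ℝ ∞ (G i)) ∧
      ∀ y, F y = F a + ∑ i, (y i - a i) * G i y := by
  classical
  have hF' : ContDiff ℝ ∞ (fderiv ℝ F) := hF.fderiv_right (by simp)
  -- The cofactor `G i` is the mean of the `i`-th partial derivative along the segment from `a` to
  -- `y`.
  let H (i : ι) : (ι → ℝ) × ℝ → ℝ := fun p ↦ fderiv ℝ F (a + p.2 • (p.1 - a)) (Pi.single i 1)
  have hH (i : ι) : ContDiff ℝ ∞ (H i) :=
    (hF'.comp (by fun_prop)).clm_apply contDiff_const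
  refine ⟨fun i y ↦ ∫ s in (0 : ℝ)..1, H i (y, s), fun i ↦ contDiff_infty.2 fun n ↦
    contDiff_intervalIntegral n (contDiff_infty.1 (hH i) n), fun y ↦ ?_⟩
  have hd (s : ℝ) : HasDerivAt (fun s : ℝ ↦ F (a + s • (y - a)))
      (∑ i, (y i - a i) * H i (y, s)) s := by
    have h1 : HasDerivAt (fun s : ℝ ↦ a + s • (y - a)) (y - a) s := by
      simpa using ((hasDerivAt_id s).smul_const (y - a)).const_add a
    have h2 := ((hF.differentiable (by simp)) (a + s • (y - a))).hasFDerivAt.comp_hasDerivAt s h1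
    have h3 (i : ι) : fderiv ℝ F (a + s • (y - a)) (Pi.single i ((y - a) i)) =
        (y i - a i) * H i (y, s) := by
      have h4 : (Pi.single i ((y - a) i) : ι → ℝ) = (y i - a i) • Pi.single i (1 : ℝ) := by
        rw [← Pi.single_smul]; simp
      rw [h4, map_smul]
      rfl
    have h5 := congrArg (fderiv ℝ F (a + s • (y - a))) (Finset.univ_sum_single (y - a))
    rw [map_sum, Finset.sum_congr rfl fun i _ ↦ h3 i] at h5
    rw [h5]
    exact h2
  have hc (i : ι) : Continuous fun s : ℝ ↦ (y i - a i) * H i (y, s) :=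
    continuous_const.mul ((hH i).continuous.comp (by fun_prop))
  have h := intervalIntegral.integral_eq_sub_of_hasDerivAt (a := 0) (b := 1) (fun s _ ↦ hd s)
    ((continuous_finsetSum _ fun i _ ↦ hc i).intervalIntegrable _ _)
  rw [intervalIntegral.integral_finsetSum fun i _ ↦ (hc i).intervalIntegrable _ _] at h
  simp only [intervalIntegral.integral_const_mul, one_smul, zero_smul, add_zero,
    add_sub_cancel] at h
  rw [h]
  ring

/-! ### Étale neighbourhoods of a `ℂ`-point and the étale stalk -/

section EtaleNeighbourhoods

variable {Y : Scheme.{0}}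

theorem Lift.ext_toHom {p : Spec (.of ℂ) ⟶ Y} {U : Y.Etale} {u v : Lift p U}
    (h : u.toHom = v.toHom) : u = v :=
  Over.OverMorphism.ext h

def Lift.mk {p : Spec (.of ℂ) ⟶ Y} {U : Y.Etale} (a : Spec (.of ℂ) ⟶ U.left)
    (h : a ≫ U.hom = p) : Lift p U :=
  (Over.homMk a h : Over.mk p ⟶ (Scheme.Etale.forget Y).obj U)

/-- The image of the lift `u` in `U`. -/
def Lift.point {p : Spec (.of ℂ) ⟶ Y} {U : Y.Etale} (u : Lift p U) : U.left := u.toHom default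

theorem Lift.point_mem_basicOpen {p : Spec (.of ℂ) ⟶ Y} {U : Y.Etale} (u : Lift p U)
    (f : Γ(U.left, ⊤)) : u.point ∈ U.left.basicOpen f ↔ u.eval f ≠ 0 := by
  change default ∈ u.toHom ⁻¹ᵁ U.left.basicOpen f ↔ _
  rw [Scheme.preimage_basicOpen_top]
  constructor
  · intro h h0
    have h1 : u.toHom.appTop f = 0 :=
      (ConcreteCategory.bijective_of_isIso (Scheme.ΓSpecIso (.of ℂ)).hom).1
        ((show (Scheme.ΓSpecIso (.of ℂ)).hom (u.toHom.appTop f) = 0 from h0).trans (map_zero _).symm)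
    rw [h1, Scheme.basicOpen_zero] at h
    exact h
  · intro h
    have h1 : IsUnit (u.toHom.appTop f) := by
      have := (isUnit_iff_ne_zero.2 h).map (Scheme.ΓSpecIso (.of ℂ)).inv.hom
      convert this
      exact (congr($((Scheme.ΓSpecIso (.of ℂ)).hom_inv_id) (u.toHom.appTop f))).symm
    rw [Scheme.basicOpen_of_isUnit _ h1]
    trivial

theorem Lift.hom_point {p : Spec (.of ℂ) ⟶ Y} {U : Y.Etale} (u : Lift p U) :
    U.hom u.point = p default :=
  congr($(u.toHom_comp) default)

theorem exists_affine_openImmersion {X : Scheme.{0}} (a : Spec (.of ℂ) ⟶ X) (O : X.Opens)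
    (hO : a default ∈ O) : ∃ (A : Scheme.{0}) (i : A ⟶ X) (b : Spec (.of ℂ) ⟶ A),
      IsAffine A ∧ IsOpenImmersion i ∧ b ≫ i = a ∧ i ⁻¹ᵁ O = ⊤ := by
  obtain ⟨A, hA, haA, hAO⟩ := exists_isAffineOpen_mem_and_subset hO
  have hr : Set.range a ⊆ Set.range A.ι := by
    rintro _ ⟨c, rfl⟩
    rw [Subsingleton.elim c default, Scheme.Opens.range_ι]
    exact haA
  refine ⟨A, A.ι, IsOpenImmersion.lift A.ι a hr, hA, inferInstance,
    IsOpenImmersion.lift_fac A.ι a hr, ?_⟩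
  rw [eq_top_iff]
  intro x _
  exact hAO x.2

/-- Affine étale neighbourhoods inside a given open set. -/
theorem Lift.exists_affine {p : Spec (.of ℂ) ⟶ Y} {V : Y.Etale} (v : Lift p V)
    (O : V.left.Opens) (hO : v.point ∈ O) :
    ∃ (W : Y.Etale) (j : W ⟶ V) (w : Lift p W), IsAffine W.left ∧ w.map j = v ∧
      IsOpenImmersion j.left ∧ j.left ⁻¹ᵁ O = ⊤ := by
  obtain ⟨A, i, b, hA, hi, hb, hO⟩ := exists_affine_openImmersion v.toHom O hO
  let W : Y.Etale := Scheme.Etale.mk (i ≫ V.hom)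
  let j : W ⟶ V := MorphismProperty.Over.homMk i rfl (by trivial)
  refine ⟨W, j, Lift.mk b ?_, hA, Lift.ext_toHom hb, hi, hO⟩
  change b ≫ i ≫ V.hom = p
  rw [reassoc_of% hb, v.toHom_comp]

theorem Lift.ext_eval {p : Spec (.of ℂ) ⟶ Y} {U : Y.Etale} [IsAffine U.left] {u v : Lift p U}
    (h : u.eval = v.eval) : u = v := by
  refine Lift.ext_toHom (ext_of_isAffine ?_)
  ext f
  exact (ConcreteCategory.bijective_of_isIso (Scheme.ΓSpecIso (.of ℂ)).hom).1 congr($h f)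

theorem exists_lift_eval_eq {U : Y.Etale} [IsAffine U.left] (l : Γ(U.left, ⊤) →+* ℂ) :
    ∃ (p : Spec (.of ℂ) ⟶ Y) (u : Lift p U), u.eval = l := by
  let a : Spec (.of ℂ) ⟶ U.left := Spec.map (CommRingCat.ofHom l) ≫ U.left.isoSpec.inv
  refine ⟨a ≫ U.hom, Lift.mk a rfl, ?_⟩
  have h : a.appTop ≫ (Scheme.ΓSpecIso (.of ℂ)).hom = CommRingCat.ofHom l := by
    have h1 : a ≫ U.left.toSpecΓ = Spec.map (CommRingCat.ofHom l) := by
      change (_ ≫ _) ≫ U.left.isoSpec.hom = _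
      rw [Category.assoc, Iso.inv_hom_id, Category.comp_id]
    have h2 := Scheme.ΓSpecIso_naturality (CommRingCat.ofHom l)
    rw [← h1, Scheme.Hom.comp_appTop, Scheme.toSpecΓ_appTop, Category.assoc] at h2
    exact (cancel_epi _).1 h2
  ext f
  exact congr($h f)

theorem Lift.eval_constSection {π : Y ⟶ Spec (.of ℂ)} {p : Spec (.of ℂ) ⟶ Y}
    (hp : p ≫ π = 𝟙 _) {U : Y.Etale} (u : Lift p U) (c : ℂ) : u.eval (constSection π U c) = c := by
  have h : u.toHom ≫ U.hom ≫ π = 𝟙 _ := by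
    rw [← Category.assoc, u.toHom_comp, hp]
  have h1 : (U.hom ≫ π).appTop ≫ u.toHom.appTop = 𝟙 _ := by
    rw [← Scheme.Hom.comp_appTop, h]
    rfl
  change (Scheme.ΓSpecIso (.of ℂ)).hom (u.toHom.appTop ((U.hom ≫ π).appTop _)) = c
  rw [show u.toHom.appTop ((U.hom ≫ π).appTop ((Scheme.ΓSpecIso (.of ℂ)).inv c)) =
    (Scheme.ΓSpecIso (.of ℂ)).inv c from congr($h1 _)]
  exact congr($((Scheme.ΓSpecIso (.of ℂ)).inv_hom_id) c)

theorem Lift.comp_str_eq_id {π : Y ⟶ Spec (.of ℂ)} {p : Spec (.of ℂ) ⟶ Y} {U : Y.Etale}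
    (u : Lift p U) (h : ∀ c, u.eval (constSection π U c) = c) : p ≫ π = 𝟙 _ := by
  refine ext_of_isAffine ?_
  have h1 : p ≫ π = u.toHom ≫ U.hom ≫ π := by rw [← Category.assoc, u.toHom_comp]
  rw [h1, Scheme.Hom.comp_appTop]
  ext f
  apply (ConcreteCategory.bijective_of_isIso (Scheme.ΓSpecIso (.of ℂ)).hom).1
  obtain ⟨c, rfl⟩ := (ConcreteCategory.bijective_of_isIso (Scheme.ΓSpecIso (.of ℂ)).inv).2 f
  refine (h c).trans ?_
  exact (congr($((Scheme.ΓSpecIso (.of ℂ)).inv_hom_id) c)).symm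

theorem constSection_map (π : Y ⟶ Spec (.of ℂ)) {U V : Y.Etale} (j : U ⟶ V) (c : ℂ) :
    j.left.appTop (constSection π V c) = constSection π U c := by
  have hw : j.left ≫ V.hom = U.hom := CategoryTheory.Over.w ((Scheme.Etale.forget Y).map j)
  simp only [constSection, ← hw, Category.assoc]
  rw [Scheme.Hom.comp_appTop j.left]
  rfl

theorem Lift.germ_surjective {p : Spec (.of ℂ) ⟶ Y} (s : stalk p) :
    ∃ (U : Y.Etale) (u : Lift p U) (f : Γ(U.left, ⊤)), u.germ f = s :=
  (Scheme.pointSmallEtale p).toPresheafFiber_jointly_surjective (P := etaleO Y) s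

theorem Lift.germ_eq_iff_self {p : Spec (.of ℂ) ⟶ Y} {U : Y.Etale} (u : Lift p U)
    (f g : Γ(U.left, ⊤)) : u.germ f = u.germ g ↔
      ∃ (W : Y.Etale) (i : W ⟶ U) (w : Lift p W), w.map i = u ∧ i.left.appTop f = i.left.appTop g :=
  (Scheme.pointSmallEtale p).toPresheafFiber_eq_iff' (P := etaleO Y) U u f g

theorem Lift.germ_eq_iff {p : Spec (.of ℂ) ⟶ Y} {U V : Y.Etale} {u : Lift p U} {v : Lift p V}
    {f : Γ(U.left, ⊤)} {g : Γ(V.left, ⊤)} : u.germ f = v.germ g ↔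
      ∃ (W : Y.Etale) (w : Lift p W) (i : W ⟶ U) (j : W ⟶ V), w.map i = u ∧ w.map j = v ∧
        i.left.appTop f = j.left.appTop g := by
  constructor
  · intro h
    obtain ⟨W, w, i, j, rfl, rfl⟩ := exists_common_lift u v
    rw [← Lift.germ_map, ← Lift.germ_map, Lift.germ_eq_iff_self] at h
    obtain ⟨T, k, t, rfl, h⟩ := h
    refine ⟨T, t, k ≫ i, k ≫ j, (Lift.map_map _ _ _).symm, (Lift.map_map _ _ _).symm, ?_⟩
    change (k.left ≫ i.left).appTop f = (k.left ≫ j.left).appTop g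
    rw [Scheme.Hom.comp_appTop, Scheme.Hom.comp_appTop]
    exact h
  · rintro ⟨W, w, i, j, rfl, rfl, h⟩
    rw [← Lift.germ_map, ← Lift.germ_map, h]

theorem isUnit_appTop_of_preimage_eq_top {X Z : Scheme.{0}} (f : X ⟶ Z) (a : Γ(Z, ⊤))
    (h : f ⁻¹ᵁ Z.basicOpen a = ⊤) : IsUnit (f.appTop a) := by
  rw [Scheme.preimage_basicOpen_top] at h
  refine X.toRingedSpace.isUnit_of_isUnit_germ _ _ fun x hx ↦ ?_
  have hx' : x ∈ X.basicOpen (f.appTop a) := by rw [h]; trivial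
  exact (Scheme.mem_basicOpen_top X _ x).1 hx'

theorem Lift.exists_affine_isUnit {p : Spec (.of ℂ) ⟶ Y} {V : Y.Etale} (v : Lift p V)
    (f : Γ(V.left, ⊤)) (hf : v.eval f ≠ 0) :
    ∃ (W : Y.Etale) (j : W ⟶ V) (w : Lift p W), IsAffine W.left ∧ w.map j = v ∧
      IsUnit (j.left.appTop f) := by
  obtain ⟨W, j, w, hW, hw, -, h⟩ := v.exists_affine _ ((v.point_mem_basicOpen f).2 hf)
  exact ⟨W, j, w, hW, hw, isUnit_appTop_of_preimage_eq_top _ _ h⟩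

/-- A function that is nonzero at `p` becomes invertible on a smaller étale neighbourhood. -/
theorem isUnit_stalk_iff {p : Spec (.of ℂ) ⟶ Y} {s : stalk p} :
    IsUnit s ↔ stalkEval p s ≠ 0 := by
  refine ⟨fun h ↦ (h.map (stalkEval p)).ne_zero, fun h ↦ ?_⟩
  obtain ⟨U, u, f, rfl⟩ := Lift.germ_surjective s
  rw [stalkEval_germ] at h
  obtain ⟨W, j, w, -, rfl, hu⟩ := u.exists_affine_isUnit f h
  rw [← Lift.germ_map]
  exact hu.map w.germ

end EtaleNeighbourhoods

/-! ### The topology of the Kato–Nakayama space and its étale covers -/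

section Topology

variable {Y : Scheme.{0}} {π : Y ⟶ Spec (.of ℂ)} {D : Y.IdealSheafData}

/-- Étale neighbourhoods over a fixed `U` that agree at a point have a common refinement
(`exists_common_lift_over`), so the generating sets are a basis and neighbourhoods can be described
by one étale map and one coordinate-open set. -/
theorem KNOver.isTopologicalBasis (U : Y.Etale) :
    IsTopologicalBasis {N : Set (KNOver π D U) | ∃ (V : Y.Etale) (j : V ⟶ U)
      (B : Set (KNOver π D V)), IsOpen[coordTopology V] B ∧ N = KNOver.map j '' B} where
  exists_subset_inter := by
    rintro _ ⟨V, j, B, hB, rfl⟩ _ ⟨V', j', B', hB', rfl⟩ _ ⟨⟨⟨x, v⟩, hv, rfl⟩, ⟨⟨x', v'⟩, hv', h⟩⟩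
    obtain rfl : x' = x := (KNOver.mk.inj h).1
    have h' : v'.map j' = v.map j := eq_of_heq (KNOver.mk.inj h).2
    obtain ⟨W, w, a, b, rfl, rfl, hab⟩ := exists_common_lift_over v v' j j' h'.symm
    refine ⟨_, ⟨W, a ≫ j, KNOver.map a ⁻¹' B ∩ KNOver.map b ⁻¹' B',
      (coordTopology W).isOpen_inter _ _ (isOpen_preimage_map a hB)
        (isOpen_preimage_map b hB'), rfl⟩, ⟨⟨_, w⟩, ⟨hv, hv'⟩, by simp only [KNOver.map, Lift.map_map]⟩, ?_⟩
    rintro _ ⟨y, ⟨hy, hy'⟩, rfl⟩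
    refine ⟨⟨_, hy, ?_⟩, ⟨_, hy', ?_⟩⟩
    · simp only [KNOver.map, Lift.map_map]
    · simp only [KNOver.map, Lift.map_map, hab]
  sUnion_eq := Set.eq_univ_of_univ_subset fun y _ ↦
    ⟨_, ⟨U, 𝟙 U, Set.univ, @isOpen_univ _ (coordTopology U), rfl⟩, y, trivial, by
      simp only [KNOver.map, Lift.map, CategoryTheory.Functor.map_id]
      rfl⟩
  eq_generateFrom := rfl

theorem KNOver.eventually_nhds_iff {U : Y.Etale} {x : KNPoint π D} {u : Lift x.pt U}
    {P : KNOver π D U → Prop} : (∀ᶠ y in 𝓝 (⟨x, u⟩ : KNOver π D U), P y) ↔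
      ∃ (V : Y.Etale) (j : V ⟶ U) (v : Lift x.pt V) (B : Set (KNOver π D V)), v.map j = u ∧
        IsOpen[coordTopology V] B ∧ ⟨x, v⟩ ∈ B ∧ ∀ y ∈ B, P (y.map j) := by
  rw [Filter.Eventually, (KNOver.isTopologicalBasis U).mem_nhds_iff]
  constructor
  · rintro ⟨_, ⟨V, j, B, hB, rfl⟩, ⟨⟨x', v⟩, hv, h⟩, hP⟩
    obtain rfl : x' = x := (KNOver.mk.inj h).1
    exact ⟨V, j, v, B, eq_of_heq (KNOver.mk.inj h).2, hB, hv, fun y hy ↦ hP ⟨y, hy, rfl⟩⟩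
  · rintro ⟨V, j, v, B, rfl, hB, hv, hP⟩
    refine ⟨_, ⟨V, j, B, hB, rfl⟩, ⟨_, hv, rfl⟩, ?_⟩
    rintro _ ⟨y, hy, rfl⟩
    exact hP y hy

/-- Together with continuity, openness gives `KNOver.map_pt_nhds`, which lets statements near a
point be checked on any étale cover. -/
theorem KNOver.isOpenMap_pt (U : Y.Etale) :
    IsOpenMap (KNOver.pt : KNOver π D U → KNPoint π D) := by
  rw [(KNOver.isTopologicalBasis U).isOpenMap_iff]
  rintro _ ⟨V, j, B, hB, rfl⟩
  exact .basic _ ⟨V, B, hB, Set.image_image ..⟩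

theorem KNOver.isOpenMap_map {U V : Y.Etale} (j : U ⟶ V) :
    IsOpenMap (KNOver.map j : KNOver π D U → KNOver π D V) := by
  rw [(KNOver.isTopologicalBasis U).isOpenMap_iff]
  rintro _ ⟨T, k, B, hB, rfl⟩
  refine .basic _ ⟨T, k ≫ j, B, hB, ?_⟩
  rw [Set.image_image]
  simp only [KNOver.map, Lift.map_map]
  rfl

theorem KNOver.map_pt_nhds {U : Y.Etale} (y : KNOver π D U) :
    Filter.map KNOver.pt (𝓝 y) = 𝓝 y.pt :=
  ((KNOver.isOpenMap_pt U).nhds_le y).antisymm' (KNOver.continuous_fst U).continuousAt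

theorem KNOver.map_map_nhds {U V : Y.Etale} (j : U ⟶ V) (y : KNOver π D U) :
    Filter.map (KNOver.map j) (𝓝 y) = 𝓝 (y.map j) :=
  ((KNOver.isOpenMap_map j).nhds_le y).antisymm' (KNOver.continuous_map j).continuousAt

theorem KNOver.eventually_pt {x : KNPoint π D} {U : Y.Etale} (u : Lift x.pt U)
    {P : KNPoint π D → Prop} :
    (∀ᶠ y in 𝓝 (⟨x, u⟩ : KNOver π D U), P y.pt) ↔ ∀ᶠ y in 𝓝 x, P y := by
  rw [← Filter.eventually_map (m := KNOver.pt), KNOver.map_pt_nhds]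

theorem KNOver.eventually_map_iff {U V : Y.Etale} (j : U ⟶ V) {x : KNPoint π D} (u : Lift x.pt U)
    {P : KNOver π D V → Prop} : (∀ᶠ y in 𝓝 (⟨x, u⟩ : KNOver π D U), P (y.map j)) ↔
      ∀ᶠ y in 𝓝 (⟨x, u.map j⟩ : KNOver π D V), P y := by
  rw [← Filter.eventually_map (m := KNOver.map j), KNOver.map_map_nhds]
  rfl

theorem continuous_coordinate {U : Y.Etale} {e : KNOver π D U → ℝ} (he : IsCoordinate U e) :
    @Continuous _ _ (coordTopology U) _ e :=
  continuous_iInf_dom (i := ⟨e, he⟩) continuous_induced_dom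

theorem coordTopology_ge (U : Y.Etale) :
    (inferInstance : TopologicalSpace (KNOver π D U)) ≤ coordTopology U := fun B hB ↦
  .basic _ ⟨U, 𝟙 U, B, hB, by
    have : (KNOver.map (𝟙 U) : KNOver π D U → KNOver π D U) = id := by
      funext y
      simp only [KNOver.map, Lift.map, CategoryTheory.Functor.map_id]
      rfl
    rw [this, Set.image_id]⟩

theorem KNOver.coord_continuous_eval {U : Y.Etale} (f : Γ(U.left, ⊤)) :
    @Continuous _ _ (coordTopology U) _ fun y : KNOver π D U ↦ y.lift.eval f := by
  let := coordTopology (π := π) (D := D) U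
  have h : (fun y : KNOver π D U ↦ y.lift.eval f) =
      fun y ↦ ((y.lift.eval f).re : ℂ) + ((y.lift.eval f).im : ℂ) * Complex.I := by
    funext y
    exact (Complex.re_add_im _).symm
  rw [h]
  have h1 := continuous_coordinate (π := π) (D := D) (.re f)
  have h2 := continuous_coordinate (π := π) (D := D) (.im f)
  exact (Complex.continuous_ofReal.comp h1).add
    ((Complex.continuous_ofReal.comp h2).mul continuous_const)

theorem KNOver.continuous_eval {U : Y.Etale} (f : Γ(U.left, ⊤)) :
    Continuous fun y : KNOver π D U ↦ y.lift.eval f :=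
  continuous_le_dom (coordTopology_ge U) (KNOver.coord_continuous_eval f)

/-- Every étale neighbourhood contains an affine one whose points over a given `ℂ`-point are
separated by finitely many products of functions. -/
theorem Lift.exists_separating {p : Spec (.of ℂ) ⟶ Y} {U : Y.Etale} (u : Lift p U) :
    ∃ (W : Y.Etale) (j : W ⟶ U) (w : Lift p W), IsAffine W.left ∧ w.map j = u ∧
      ∃ s : Finset (Γ(W.left, ⊤) × Γ(W.left, ⊤)),
        (∀ (q : Spec (.of ℂ) ⟶ Y) (v : Lift q W), ∑ i ∈ s, v.eval i.1 * v.eval i.2 = 1) ∧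
        ∀ (q : Spec (.of ℂ) ⟶ Y) (v v' : Lift q W), ∑ i ∈ s, v.eval i.1 * v'.eval i.2 ≠ 0 →
          v = v' := by
  -- The separating functions come from rings, so both `W` and the open subset of `Y` below it are
  -- made affine. Lifts of one point `q` agree on `Γ(Y, A)`.
  obtain ⟨A, hA, hpA, -⟩ := exists_isAffineOpen_mem_and_subset (x := p default) (U := ⊤) trivial
  have hu : u.point ∈ U.hom ⁻¹ᵁ A := by
    change U.hom u.point ∈ A
    rwa [u.hom_point]
  obtain ⟨W, j, w, hW, rfl, -, hj⟩ := u.exists_affine _ hu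
  have hw : j.left ≫ U.hom = W.hom := CategoryTheory.Over.w ((Scheme.Etale.forget Y).map j)
  have hWA : (⊤ : W.left.Opens) ≤ W.hom ⁻¹ᵁ A := by
    rw [← hw, Scheme.Hom.comp_preimage, hj]
  let φ : Γ(Y, A) →+* Γ(W.left, ⊤) := (W.hom.appLE A ⊤ hWA).hom
  have hφ : φ.Etale := HasRingHomProperty.appLE @Etale W.hom W.prop ⟨A, hA⟩
    ⟨⊤, isAffineOpen_top W.left⟩ hWA
  algebraize [φ]
  obtain ⟨s, h1, h2⟩ := exists_separating_of_formallyUnramified Γ(Y, A) Γ(W.left, ⊤) ℂ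
  refine ⟨W, j, w, hW, rfl, s, fun q v ↦ h1 v.eval, fun q v v' h ↦ Lift.ext_eval (h2 _ _ ?_ h)⟩
  have key (a : Spec (.of ℂ) ⟶ W.left) (B : Y.Opens) (e : ⊤ ≤ W.hom ⁻¹ᵁ B) :
      W.hom.appLE B ⊤ e ≫ a.appTop = (a ≫ W.hom).appLE B ⊤ (fun x _ ↦ e (x := a x) trivial) := by
    rw [Scheme.Hom.appTop, Scheme.Hom.app_eq_appLE]
    exact Scheme.Hom.appLE_comp_appLE ..
  have h3 : W.hom.appLE A ⊤ hWA ≫ v.toHom.appTop = W.hom.appLE A ⊤ hWA ≫ v'.toHom.appTop := by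
    rw [key, key]
    congr 1
    rw [v.toHom_comp, v'.toHom_comp]
  ext r
  exact congrArg (Scheme.ΓSpecIso (.of ℂ)).hom congr($h3 r)

theorem KNOver.ext_of_separating {W : Y.Etale} {s : Finset (Γ(W.left, ⊤) × Γ(W.left, ⊤))}
    (hs : ∀ (q : Spec (.of ℂ) ⟶ Y) (v v' : Lift q W),
      ∑ i ∈ s, v.eval i.1 * v'.eval i.2 ≠ 0 → v = v')
    {y y' : KNOver π D W} (h : y.pt = y'.pt)
    (h' : ∑ i ∈ s, y.lift.eval i.1 * y'.lift.eval i.2 ≠ 0) : y = y' := by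
  obtain ⟨y, v⟩ := y
  obtain ⟨y', v'⟩ := y'
  change y = y' at h
  subst h
  rw [hs _ v v' h']

/-- The separating sum `Θ` is continuous and equals `1` at the diagonal point, hence is nonzero on
`t × t` for some neighbourhood `t`; two points of `t` with the same projection then coincide. -/
theorem KNOver.exists_injOn {x : KNPoint π D} {U : Y.Etale} (u : Lift x.pt U) :
    ∃ N ∈ 𝓝 (⟨x, u⟩ : KNOver π D U), Set.InjOn KNOver.pt N := by
  obtain ⟨W, j, w, hW, rfl, s, h1, h2⟩ := u.exists_separating
  let Θ : KNOver π D W × KNOver π D W → ℂ := fun y ↦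
    ∑ i ∈ s, y.1.lift.eval i.1 * y.2.lift.eval i.2
  have hΘ : Continuous Θ := continuous_finsetSum _ fun i _ ↦
    ((KNOver.continuous_eval i.1).comp _root_.continuous_fst).mul
      ((KNOver.continuous_eval i.2).comp continuous_snd)
  have h0 : Θ (⟨x, w⟩, ⟨x, w⟩) ≠ 0 := by
    change ∑ i ∈ s, w.eval i.1 * w.eval i.2 ≠ 0
    rw [h1]
    exact one_ne_zero
  have hev := hΘ.continuousAt.eventually_ne h0
  rw [nhds_prod_eq] at hev
  obtain ⟨t, ht, hev⟩ := (Filter.eventually_prod_self_iff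
    (r := fun a b ↦ Θ (a, b) ≠ 0)).1 hev
  refine ⟨KNOver.map j '' t, (KNOver.isOpenMap_map j).image_mem_nhds ht, ?_⟩
  rintro _ ⟨y, hy, rfl⟩ _ ⟨y', hy', rfl⟩ h
  exact congrArg (KNOver.map j) (KNOver.ext_of_separating h2 h (hev _ hy _ hy'))

/-- Functions near a point of an étale cover of the Kato--Nakayama space descend. -/
theorem KNOver.exists_descend {α : Type*} [Nonempty α] {x : KNPoint π D} {U : Y.Etale} (u : Lift x.pt U)
    (e : KNOver π D U → α) :
    ∃ c : KNPoint π D → α, ∀ᶠ y in 𝓝 (⟨x, u⟩ : KNOver π D U), c y.pt = e y := by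
  classical
  obtain ⟨N, hN, hinj⟩ := KNOver.exists_injOn u
  refine ⟨fun z ↦ if h : ∃ y ∈ N, y.pt = z then e h.choose else Classical.arbitrary α, ?_⟩
  filter_upwards [hN] with y hy
  have h : ∃ y' ∈ N, y'.pt = y.pt := ⟨y, hy, rfl⟩
  rw [dif_pos h, hinj h.choose_spec.1 hy h.choose_spec.2]

end Topology

/-! ### Germs on the Kato–Nakayama space defined on étale covers -/

section Descent

variable {Y : Scheme.{0}} {π : Y ⟶ Spec (.of ℂ)} {D : Y.IdealSheafData}

/-- The germ on the Kato--Nakayama space given by a function on an étale cover. -/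
def descend (x : KNPoint π D) {U : Y.Etale} (u : Lift x.pt U) (e : KNOver π D U → ℂ) :
    (𝓝 x).Germ ℂ :=
  ((KNOver.exists_descend u e).choose : KNPoint π D → ℂ)

theorem descend_eq_iff {x : KNPoint π D} {U : Y.Etale} {u : Lift x.pt U} {e : KNOver π D U → ℂ}
    {c : KNPoint π D → ℂ} :
    descend x u e = c ↔ ∀ᶠ y in 𝓝 (⟨x, u⟩ : KNOver π D U), c y.pt = e y := by
  have h := (KNOver.exists_descend u e).choose_spec
  rw [descend, Filter.Germ.coe_eq, Filter.EventuallyEq, ← KNOver.eventually_pt u]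
  constructor
  · intro h'
    filter_upwards [h, h'] with y h1 h2
    rw [← h2, h1]
  · intro h'
    filter_upwards [h, h'] with y h1 h2
    rw [h1, h2]

theorem descend_map {x : KNPoint π D} {U V : Y.Etale} (u : Lift x.pt U) (j : U ⟶ V)
    (e : KNOver π D V → ℂ) : descend x u (fun y ↦ e (y.map j)) = descend x (u.map j) e := by
  obtain ⟨c, hc⟩ := KNOver.exists_descend (u.map j) e
  rw [descend_eq_iff.2 hc, descend_eq_iff]
  exact (KNOver.eventually_map_iff j u).2 hc

theorem descend_map₂ {x : KNPoint π D} {U : Y.Etale} (u : Lift x.pt U)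
    (e e' : KNOver π D U → ℂ) (φ : ℂ → ℂ → ℂ) :
    descend x u (fun y ↦ φ (e y) (e' y)) = (descend x u e).map₂ φ (descend x u e') := by
  obtain ⟨c, hc⟩ := KNOver.exists_descend u e
  obtain ⟨c', hc'⟩ := KNOver.exists_descend u e'
  rw [descend_eq_iff.2 hc, descend_eq_iff.2 hc', Filter.Germ.map₂_coe, descend_eq_iff]
  filter_upwards [hc, hc'] with y h1 h2
  rw [← h1, ← h2]

theorem descend_const {x : KNPoint π D} {U : Y.Etale} (u : Lift x.pt U) (c : ℂ) :
    descend x u (fun _ ↦ c) = ((fun _ ↦ c : KNPoint π D → ℂ) : (𝓝 x).Germ ℂ) :=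
  descend_eq_iff.2 (.of_forall fun _ ↦ rfl)

/-- The germ at `x` of the function given by a regular function on an étale neighbourhood. -/
def Lift.evalGerm {x : KNPoint π D} {U : Y.Etale} (u : Lift x.pt U) :
    Γ(U.left, ⊤) →+* (𝓝 x).Germ ℂ where
  toFun f := descend x u fun y : KNOver π D U ↦ y.lift.eval f
  map_one' := by
    simp only [map_one]
    exact descend_const u 1
  map_zero' := by
    simp only [map_zero]
    exact descend_const u 0
  map_mul' f g := by
    simp only [map_mul]
    exact descend_map₂ u _ _ (· * ·)
  map_add' f g := by
    simp only [map_add]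
    exact descend_map₂ u _ _ (· + ·)

theorem Lift.evalGerm_map {x : KNPoint π D} {U V : Y.Etale} (j : U ⟶ V) (u : Lift x.pt U)
    (f : Γ(V.left, ⊤)) : u.evalGerm (j.left.appTop f) = (u.map j).evalGerm f := by
  refine Eq.trans ?_ (descend_map u j fun y : KNOver π D V ↦ y.lift.eval f)
  exact congrArg (descend x u) (funext fun y ↦ Lift.eval_map j y.lift f)

/-- The germ at `x` of the function on the Kato--Nakayama space given by a germ of regular
functions. -/
def evalGerm (x : KNPoint π D) : stalk x.pt →+* (𝓝 x).Germ ℂ :=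
  ((Scheme.pointSmallEtale x.pt).presheafFiberDesc (P := etaleO Y) (T := .of ((𝓝 x).Germ ℂ))
    (fun U u ↦ CommRingCat.ofHom (Lift.evalGerm (U := U) u))
    (fun U V j u ↦ by
      ext f
      exact Lift.evalGerm_map j u f)).hom

theorem evalGerm_germ (x : KNPoint π D) {U : Y.Etale} (u : Lift x.pt U) (f : Γ(U.left, ⊤)) :
    evalGerm x (u.germ f) = descend x u fun y ↦ y.lift.eval f :=
  congr($((Scheme.pointSmallEtale x.pt).toPresheafFiber_presheafFiberDesc (P := etaleO Y)
    (T := .of ((𝓝 x).Germ ℂ)) (fun U u ↦ CommRingCat.ofHom (Lift.evalGerm (U := U) u))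
    (fun U V j u ↦ by
      ext f
      exact Lift.evalGerm_map j u f) U u).hom f)

/-- Equal germs of sections become equal on a common étale neighbourhood. This makes `argGerm`
independent of representatives; the argument is not a ring homomorphism, so it is not obtained from
the universal property used for `evalGerm`. -/
theorem descend_arg_eq {x : KNPoint π D} {U V : Y.Etale} {u : Lift x.pt U} {v : Lift x.pt V}
    {m : logSections Y (divisorCompl D) U} {n : logSections Y (divisorCompl D) V}
    (h : u.germM D m = v.germM D n) :
    (descend x u fun y ↦ (y.pt.arg (y.lift.germM D m) : ℂ)) =
      descend x v fun y ↦ (y.pt.arg (y.lift.germM D n) : ℂ) := by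
  obtain ⟨W, w, i, j, rfl, rfl, hij⟩ := Lift.germ_eq_iff.1 (congrArg Subtype.val h)
  rw [← descend_map, ← descend_map]
  congr 1
  funext y
  have h1 : (y.lift.map i).germM D m = (y.lift.map j).germM D n := by
    rw [← Lift.germM_map, ← Lift.germM_map]
    exact congrArg (y.lift.germM D) (Subtype.ext hij)
  exact congrArg (fun z ↦ (y.pt.arg z : ℂ)) h1

/-- The germ at `x` of the argument of a section of the log structure. -/
def argGerm (x : KNPoint π D) (m : stalkM D x.pt) : (𝓝 x).Germ ℂ :=
  descend x m.2.choose_spec.choose fun y ↦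
    (y.pt.arg (y.lift.germM D m.2.choose_spec.choose_spec.choose) : ℂ)

theorem argGerm_germM (x : KNPoint π D) {U : Y.Etale} (u : Lift x.pt U)
    (m : logSections Y (divisorCompl D) U) :
    argGerm x (u.germM D m) = descend x u fun y ↦ (y.pt.arg (y.lift.germM D m) : ℂ) :=
  descend_arg_eq (Subtype.ext (u.germM D m).2.choose_spec.choose_spec.choose_spec)

theorem exists_germM_eq {p : Spec (.of ℂ) ⟶ Y} (m : stalkM D p) :
    ∃ (U : Y.Etale) (u : Lift p U) (n : logSections Y (divisorCompl D) U), u.germM D n = m := by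
  obtain ⟨_, U, u, n, rfl⟩ := m
  exact ⟨U, u, n, rfl⟩

theorem exists_germM_eq₂ {p : Spec (.of ℂ) ⟶ Y} (m m' : stalkM D p) :
    ∃ (U : Y.Etale) (u : Lift p U) (n n' : logSections Y (divisorCompl D) U),
      u.germM D n = m ∧ u.germM D n' = m' := by
  obtain ⟨U, u, n, rfl⟩ := exists_germM_eq m
  obtain ⟨V, v, n', rfl⟩ := exists_germM_eq m'
  obtain ⟨W, w, i, j, rfl, rfl⟩ := exists_common_lift u v
  exact ⟨W, w, logSectionsMap _ i n, logSectionsMap _ j n', Lift.germM_map _ _ _,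
    Lift.germM_map _ _ _⟩

theorem Lift.germM_mul {p : Spec (.of ℂ) ⟶ Y} {U : Y.Etale} (u : Lift p U)
    (m n : logSections Y (divisorCompl D) U) :
    u.germM D (m * n) = u.germM D m * u.germM D n :=
  Subtype.ext (map_mul u.germ m.1 n.1)

theorem argGerm_mul (x : KNPoint π D) (m n : stalkM D x.pt) :
    argGerm x (m * n) = argGerm x m * argGerm x n := by
  obtain ⟨U, u, m, n, rfl, rfl⟩ := exists_germM_eq₂ m n
  rw [← Lift.germM_mul, argGerm_germM, argGerm_germM, argGerm_germM]
  refine Eq.trans ?_ (descend_map₂ u _ _ (· * ·))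
  congr 1
  funext y
  rw [Lift.germM_mul, map_mul, Circle.coe_mul]

end Descent

/-! ### Charts: affine étale neighbourhoods with étale coordinates -/

section Charts

variable {Y : Scheme.{0}} (π : Y ⟶ Spec (.of ℂ)) (D : Y.IdealSheafData)

def constHom (U : Y.Etale) : ℂ →+* Γ(U.left, ⊤) :=
  (U.hom ≫ π).appTop.hom.comp (Scheme.ΓSpecIso (.of ℂ)).inv.hom

theorem constHom_apply (U : Y.Etale) (c : ℂ) : constHom π U c = constSection π U c := rfl

theorem constHom_map {U V : Y.Etale} (j : U ⟶ V) :
    j.left.appTop.hom.comp (constHom π V) = constHom π U :=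
  RingHom.ext fun c ↦ constSection_map π j c

/-- The homomorphism from a polynomial ring given by functions on `U`. -/
def coordHom (U : Y.Etale) {n : ℕ} (z : Fin n → Γ(U.left, ⊤)) :
    MvPolynomial (Fin n) ℂ →+* Γ(U.left, ⊤) :=
  MvPolynomial.eval₂Hom (constHom π U) z

/-- An affine étale neighbourhood of `p` with étale coordinates such that the complement of `D` is
the locus where the coordinates with index in `S` are invertible. -/
structure Chart (p : Spec (.of ℂ) ⟶ Y) where
  n : ℕ
  U : Y.Etale
  u : Lift p U
  affine : IsAffine U.left
  z : Fin n → Γ(U.left, ⊤)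
  S : Finset (Fin n)
  etale : (coordHom π U z).Etale
  compl : U.hom ⁻¹ᵁ divisorCompl D = U.left.basicOpen (∏ i ∈ S, z i)

variable {π D}

theorem coordHom_map {U V : Y.Etale} (j : U ⟶ V) {n : ℕ} (z : Fin n → Γ(V.left, ⊤)) :
    j.left.appTop.hom.comp (coordHom π V z) = coordHom π U fun i ↦ j.left.appTop (z i) := by
  ext i
  · simp [coordHom, ← constHom_map π j]
  · simp [coordHom]

theorem hom_preimage {U V : Y.Etale} (j : U ⟶ V) (W : Y.Opens) :
    U.hom ⁻¹ᵁ W = j.left ⁻¹ᵁ V.hom ⁻¹ᵁ W := by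
  have hw : j.left ≫ V.hom = U.hom := CategoryTheory.Over.w ((Scheme.Etale.forget Y).map j)
  rw [← hw, Scheme.Hom.comp_preimage]

/-- The chart over an affine étale neighbourhood that maps to a given chart. -/
def Chart.pull {p : Spec (.of ℂ) ⟶ Y} (c : Chart π D p) {W : Y.Etale} (hW : IsAffine W.left)
    (w : Lift p W) (j : W ⟶ c.U) : Chart π D p where
  n := c.n
  U := W
  u := w
  affine := hW
  z i := j.left.appTop (c.z i)
  S := c.S
  etale := by
    have := c.affine
    rw [← coordHom_map]
    exact RingHom.Etale.stableUnderComposition _ _ c.etale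
      (HasRingHomProperty.appTop @Etale j.left inferInstance)
  compl := by
    rw [hom_preimage j, c.compl, Scheme.preimage_basicOpen_top, map_prod]

/-- The log structure depends only on the complement of `D`, so the equality of ideal sheaves enters
only through supports. -/
theorem preimage_compl_support_eq {U : Scheme.{0}} (f : U ⟶ Y) {a : Γ(U, ⊤)}
    (h : D.comap f = Scheme.IdealSheafData.ofIdealTop (Ideal.span {a})) :
    f ⁻¹ᵁ divisorCompl D = U.basicOpen a := by
  have h1 := congrArg (fun I : U.IdealSheafData ↦ (I.support : Set U)) h
  simp only [Scheme.IdealSheafData.support_comap,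
    Scheme.IdealSheafData.coe_support_ofIdealTop, Scheme.zeroLocus_span,
    Scheme.zeroLocus_singleton] at h1
  ext x
  have h2 := Set.ext_iff.1 h1 x
  constructor
  · intro hx
    by_contra h3
    exact hx (h2.2 h3)
  · intro hx h3
    exact h2.1 h3 hx

/-- The homomorphism is `z.appTop` preceded by the isomorphism between the polynomial ring and the
global functions of affine space. -/
theorem etale_coordHom {U : Y.Etale} [IsAffine U.left] {n : ℕ}
    (z : U.left ⟶ 𝔸(Fin n; Spec (.of ℂ))) [Etale z]
    (hz : z ≫ (𝔸(Fin n; Spec (.of ℂ)) ↘ Spec (.of ℂ)) = U.hom ≫ π) :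
    (coordHom π U fun i ↦ z.appTop (AffineSpace.coord (Spec (.of ℂ)) i)).Etale := by
  have h1 : z.appTop.hom.Etale := HasRingHomProperty.appTop @Etale z inferInstance
  let φ : CommRingCat.of (MvPolynomial (Fin n) ℂ) ⟶ Γ(𝔸(Fin n; Spec (.of ℂ)), ⊤) :=
    CommRingCat.ofHom (MvPolynomial.eval₂Hom ((Scheme.ΓSpecIso (.of ℂ)).inv ≫
        (𝔸(Fin n; Spec (.of ℂ)) ↘ Spec (.of ℂ)).appTop).hom (AffineSpace.coord (Spec (.of ℂ))))
  have hφ : φ = (Scheme.ΓSpecIso _).inv ≫ (AffineSpace.SpecIso (Fin n) (.of ℂ)).hom.appTop := by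
    rw [AffineSpace.SpecIso_hom_appTop, Iso.inv_hom_id_assoc]
  have hiso : IsIso φ := by
    rw [hφ]
    exact IsIso.comp_isIso' inferInstance (inferInstanceAs (IsIso
      (Scheme.Γ.map (AffineSpace.SpecIso (Fin n) (CommRingCat.of ℂ)).hom.op)))
  have h2 := (RingHom.Etale.respectsIso.cancel_left_isIso φ z.appTop).2 h1
  have h3 : (coordHom π U fun i ↦ z.appTop (AffineSpace.coord (Spec (.of ℂ)) i)) =
      (φ ≫ z.appTop).hom := by
    refine MvPolynomial.ringHom_ext (fun c ↦ ?_) fun i ↦ ?_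
    · simp only [coordHom, constHom, ← hz, φ]
      simp
      rfl
    · simp [coordHom, φ]
  rw [h3]
  exact h2

/-- A variety with a normal crossing divisor has charts at every `ℂ`-point. -/
theorem exists_chart (hD : IsNormalCrossing π D) (p : Spec (.of ℂ) ⟶ Y) :
    Nonempty (Chart π D p) := by
  obtain ⟨U, y', hy', n, z, S, hz, hzπ, hS⟩ := hD (p default)
  -- The coordinates live near some point over the image of `p`; as `ℂ` is separably closed, `p`
  -- itself lifts to that point.
  obtain ⟨a, ha, -⟩ := Scheme.exists_fac_of_etale_of_isSepClosed U.hom p y' hy'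
  obtain ⟨W, j, w, hW, -, -, -⟩ := (Lift.mk a ha : Lift p U).exists_affine ⊤ trivial
  have hw : j.left ≫ U.hom = W.hom := CategoryTheory.Over.w ((Scheme.Etale.forget Y).map j)
  have : Etale (j.left ≫ z) := inferInstance
  refine ⟨⟨n, W, w, hW, _, S, etale_coordHom (j.left ≫ z) ?_, ?_⟩⟩
  · rw [Category.assoc, hzπ, ← Category.assoc, hw]
  · rw [hom_preimage j, preimage_compl_support_eq U.hom hS]
    refine (Scheme.preimage_basicOpen_top j.left _).trans (congrArg _ ?_)
    refine (map_prod j.left.appTop.hom _ _).trans (Finset.prod_congr rfl fun i _ ↦ ?_)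
    rw [Scheme.Hom.comp_appTop]
    rfl

end Charts

/-! ### Differentiable arcs in the étale topology -/

section Arcs

variable {Y : Scheme.{0}} {π : Y ⟶ Spec (.of ℂ)} {D : Y.IdealSheafData}

variable (π) in
/-- A `ℂ`-point of `V` over `ℂ`. -/
structure CPoint (V : Y.Etale) where
  pt : Spec (.of ℂ) ⟶ Y
  pt_str : pt ≫ π = 𝟙 _
  lift : Lift pt V

def CPoint.map {V W : Y.Etale} (j : V ⟶ W) (a : CPoint π V) : CPoint π W :=
  ⟨a.pt, a.pt_str, a.lift.map j⟩

theorem CPoint.map_map {V W T : Y.Etale} (j : V ⟶ W) (k : W ⟶ T) (a : CPoint π V) :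
    (a.map j).map k = a.map (j ≫ k) := by
  simp only [CPoint.map, Lift.map_map]

theorem CPoint.eval_map {V W : Y.Etale} (j : V ⟶ W) (a : CPoint π V) (f : Γ(W.left, ⊤)) :
    (a.map j).lift.eval f = a.lift.eval (j.left.appTop f) :=
  (Lift.eval_map j a.lift f).symm

theorem CPoint.ext_toHom {V : Y.Etale} {a b : CPoint π V} (h : a.lift.toHom = b.lift.toHom) :
    a = b := by
  obtain ⟨p, hp, u⟩ := a
  obtain ⟨q, hq, v⟩ := b
  have hpq : p = q := by
    rw [← u.toHom_comp, ← v.toHom_comp]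
    exact congrArg (· ≫ V.hom) h
  subst hpq
  have huv : u = v := Lift.ext_toHom h
  rw [huv]

theorem CPoint.ext_eval {V : Y.Etale} [IsAffine V.left] {a b : CPoint π V}
    (h : a.lift.eval = b.lift.eval) : a = b := by
  refine CPoint.ext_toHom (ext_of_isAffine ?_)
  ext f
  exact (ConcreteCategory.bijective_of_isIso (Scheme.ΓSpecIso (.of ℂ)).hom).1 congr($h f)

theorem CPoint.exists_eval_eq {V : Y.Etale} [IsAffine V.left] (l : Γ(V.left, ⊤) →+* ℂ)
    (hl : ∀ c, l (constSection π V c) = c) : ∃ a : CPoint π V, a.lift.eval = l := by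
  obtain ⟨p, u, rfl⟩ := exists_lift_eval_eq l
  exact ⟨⟨p, u.comp_str_eq_id hl, u⟩, rfl⟩

theorem exists_equalizing_lift {p : Spec (.of ℂ) ⟶ Y} {U T : Y.Etale} (u : Lift p U)
    (a b : U ⟶ T) (h : u.map a = u.map b) :
    ∃ (W : Y.Etale) (w : Lift p W) (i : W ⟶ U), w.map i = u ∧ i ≫ a = i ≫ b := by
  let F := (Scheme.pointSmallEtale p).fiber
  let eu : F.Elements := ⟨U, u⟩
  let et : F.Elements := ⟨T, u.map b⟩
  let ia : eu ⟶ et := ⟨a, h⟩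
  let ib : eu ⟶ et := ⟨b, rfl⟩
  exact ⟨(IsCofiltered.eq ia ib).1, (IsCofiltered.eq ia ib).2, (IsCofiltered.eqHom ia ib).1,
    (IsCofiltered.eqHom ia ib).2, congrArg Subtype.val (IsCofiltered.eq_condition ia ib)⟩

/-- `a` is a differentiable arc in `W` through `w` with coordinates `z` in the chart `c`. -/
structure Chart.IsArc {p : Spec (.of ℂ) ⟶ Y} (c : Chart π D p) (z : ℝ → Fin c.n → ℂ)
    {W : Y.Etale} (w : Lift p W) (j : W ⟶ c.U) (a : ℝ → CPoint π W) : Prop where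
  zero (f : Γ(W.left, ⊤)) : (a 0).lift.eval f = w.eval f
  diff (f : Γ(W.left, ⊤)) : DifferentiableAt ℝ (fun t ↦ (a t).lift.eval f) 0
  coord : ∀ᶠ t in 𝓝 0, ∀ i, (a t).lift.eval (j.left.appTop (c.z i)) = z t i

theorem Chart.IsArc.map {p : Spec (.of ℂ) ⟶ Y} {c : Chart π D p} {z : ℝ → Fin c.n → ℂ}
    {V W : Y.Etale} {v : Lift p V} {k : V ⟶ c.U} {a : ℝ → CPoint π V} (h : c.IsArc z v k a)
    (i : V ⟶ W) (j : W ⟶ c.U) (hk : i ≫ j = k) : c.IsArc z (v.map i) j fun t ↦ (a t).map i where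
  zero f := by rw [CPoint.eval_map, h.zero, Lift.eval_map]
  diff f := by
    simp only [CPoint.eval_map]
    exact h.diff _
  coord := by
    subst hk
    filter_upwards [h.coord] with t ht s
    rw [CPoint.eval_map, ← ht s]
    congr 1

/-- Arcs with equal coordinates agree on the polynomial ring. Their separating sum is `1` at `0` and
continuous there, so it stays nonzero nearby and forces the arcs to be equal. -/
theorem Chart.IsArc.eventuallyEq {p : Spec (.of ℂ) ⟶ Y} {c : Chart π D p} {z : ℝ → Fin c.n → ℂ}
    {W : Y.Etale} (hW : IsAffine W.left) {w : Lift p W} {j : W ⟶ c.U} {a b : ℝ → CPoint π W}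
    (ha : c.IsArc z w j a) (hb : c.IsArc z w j b) : ∀ᶠ t in 𝓝 0, a t = b t := by
  let φ : MvPolynomial (Fin c.n) ℂ →+* Γ(W.left, ⊤) := coordHom π W fun i ↦ j.left.appTop (c.z i)
  have het : φ.Etale := (c.pull hW w j).etale
  algebraize [φ]
  obtain ⟨s, h1, h2⟩ := exists_separating_of_formallyUnramified
    (MvPolynomial (Fin c.n) ℂ) Γ(W.left, ⊤) ℂ
  have hc : ContinuousAt (fun t ↦ ∑ i ∈ s, (a t).lift.eval i.1 * (b t).lift.eval i.2) 0 :=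
    tendsto_finsetSum _ fun i _ ↦ (ha.diff i.1).continuousAt.mul (hb.diff i.2).continuousAt
  have h0 : ∑ i ∈ s, (a 0).lift.eval i.1 * (b 0).lift.eval i.2 ≠ 0 := by
    simp only [ha.zero, hb.zero]
    rw [h1]
    exact one_ne_zero
  filter_upwards [hc.eventually_ne h0, ha.coord, hb.coord] with t ht hat hbt
  refine CPoint.ext_eval (h2 _ _ ?_ ht)
  refine MvPolynomial.ringHom_ext (fun r ↦ ?_) fun i ↦ ?_
  · change (a t).lift.eval (φ _) = (b t).lift.eval (φ _)
    simp only [φ, coordHom, MvPolynomial.coe_eval₂Hom, MvPolynomial.eval₂_C, constHom_apply]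
    rw [Lift.eval_constSection (a t).pt_str, Lift.eval_constSection (b t).pt_str]
  · change (a t).lift.eval (φ _) = (b t).lift.eval (φ _)
    simp only [φ, coordHom, MvPolynomial.coe_eval₂Hom, MvPolynomial.eval₂_X]
    rw [hat, hbt]

theorem Chart.exists_isArc_self {p : Spec (.of ℂ) ⟶ Y} (c : Chart π D p) (hp : p ≫ π = 𝟙 _)
    (z : ℝ → Fin c.n → ℂ) (hz : ∀ i, ContDiff ℝ 1 fun t ↦ z t i)
    (h0 : ∀ i, z 0 i = c.u.eval (c.z i)) :
    ∃ a : ℝ → CPoint π c.U, (∀ f, (a 0).lift.eval f = c.u.eval f) ∧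
      (∀ f, DifferentiableAt ℝ (fun t ↦ (a t).lift.eval f) 0) ∧
      ∀ᶠ t in 𝓝 0, ∀ i, (a t).lift.eval (c.z i) = z t i := by
  have := c.affine
  let φ : MvPolynomial (Fin c.n) ℂ →+* Γ(c.U.left, ⊤) := coordHom π c.U c.z
  have het : φ.Etale := c.etale
  algebraize [φ]
  have hX (l : Γ(c.U.left, ⊤) →+* ℂ) (i : Fin c.n) :
      l.comp (algebraMap (MvPolynomial (Fin c.n) ℂ) Γ(c.U.left, ⊤)) (MvPolynomial.X i) =
        l (c.z i) := by
    change l (φ _) = _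
    simp [φ, coordHom]
  have hC (l : Γ(c.U.left, ⊤) →+* ℂ) (r : ℂ) :
      l.comp (algebraMap (MvPolynomial (Fin c.n) ℂ) Γ(c.U.left, ⊤)) (MvPolynomial.C r) =
        l (constSection π c.U r) := by
    change l (φ _) = _
    simp [φ, coordHom, constHom_apply]
  obtain ⟨l, hl0, hl, hd⟩ := exists_arc (σ := Fin c.n) c.u.eval z hz (by
    refine MvPolynomial.ringHom_ext (fun r ↦ ?_) fun i ↦ ?_
    · rw [hC, Lift.eval_constSection hp]
      simp
    · rw [hX, ← h0]
      simp)
  have key (t : ℝ) : ∃ a : CPoint π c.U, (l t).comp (algebraMap (MvPolynomial (Fin c.n) ℂ)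
      Γ(c.U.left, ⊤)) = MvPolynomial.eval (z t) → a.lift.eval = l t := by
    by_cases h : (l t).comp (algebraMap (MvPolynomial (Fin c.n) ℂ)
      Γ(c.U.left, ⊤)) = MvPolynomial.eval (z t)
    · obtain ⟨a, ha⟩ := CPoint.exists_eval_eq (l t) (fun r ↦ by
        rw [← hC, h]
        simp)
      exact ⟨a, fun _ ↦ ha⟩
    · exact ⟨⟨p, hp, c.u⟩, fun h' ↦ absurd h' h⟩
  choose a ha using key
  have hev : ∀ᶠ t in 𝓝 0, (a t).lift.eval = l t := hl.mono fun t ht ↦ ha t ht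
  refine ⟨a, fun f ↦ ?_, fun f ↦ ?_, ?_⟩
  · rw [hev.self_of_nhds, hl0]
  · refine (hd f).congr_of_eventuallyEq ?_
    filter_upwards [hev] with t ht
    rw [ht]
  · filter_upwards [hev, hl] with t ht ht' i
    rw [ht, ← hX, ht']
    simp

theorem Chart.exists_isArc {p : Spec (.of ℂ) ⟶ Y} (c : Chart π D p) (hp : p ≫ π = 𝟙 _)
    {z : ℝ → Fin c.n → ℂ} (hz : ∀ i, ContDiff ℝ 1 fun t ↦ z t i)
    (h0 : ∀ i, z 0 i = c.u.eval (c.z i)) {W : Y.Etale} (hW : IsAffine W.left) (w : Lift p W)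
    (j : W ⟶ c.U) (hj : w.map j = c.u) : ∃ a : ℝ → CPoint π W, c.IsArc z w j a := by
  obtain ⟨a, h1, h2, h3⟩ := (c.pull hW w j).exists_isArc_self hp z hz (fun i ↦ by
    refine (h0 i).trans ?_
    rw [← hj]
    exact (Lift.eval_map j w (c.z i)).symm)
  exact ⟨a, h1, h2, h3⟩

variable (π) in
/-- A differentiable arc through `p` in the étale topology. -/
structure Arc (p : Spec (.of ℂ) ⟶ Y) where
  l {V : Y.Etale} (v : Lift p V) : ℝ → CPoint π V
  map {V W : Y.Etale} (j : V ⟶ W) (v : Lift p V) : ∀ᶠ t in 𝓝 0, (l v t).map j = l (v.map j) t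
  diff {V : Y.Etale} (v : Lift p V) (f : Γ(V.left, ⊤)) :
    DifferentiableAt ℝ (fun t ↦ (l v t).lift.eval f) 0
  zero {V : Y.Etale} (v : Lift p V) (f : Γ(V.left, ⊤)) : (l v 0).lift.eval f = v.eval f

theorem Chart.exists_affine_lift {p : Spec (.of ℂ) ⟶ Y} (c : Chart π D p) {V : Y.Etale}
    (v : Lift p V) : ∃ (W : Y.Etale) (w : Lift p W) (j : W ⟶ c.U) (k : W ⟶ V),
      IsAffine W.left ∧ w.map j = c.u ∧ w.map k = v := by
  obtain ⟨W, w, j, k, hj, hk⟩ := exists_common_lift c.u v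
  obtain ⟨T, i, t, hT, rfl, -, -⟩ := w.exists_affine ⊤ trivial
  exact ⟨T, t, i ≫ j, i ≫ k, hT, by rw [← Lift.map_map, hj], by rw [← Lift.map_map, hk]⟩

/-- The two arcs are compared through a third arc on a common refinement, with uniqueness applied on
`W` and on `T`. This makes arcs compatible across different étale neighbourhoods. -/
theorem Chart.IsArc.map_eventuallyEq {p : Spec (.of ℂ) ⟶ Y} {c : Chart π D p} (hp : p ≫ π = 𝟙 _)
    {z : ℝ → Fin c.n → ℂ} (hz : ∀ i, ContDiff ℝ 1 fun t ↦ z t i)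
    (h0 : ∀ i, z 0 i = c.u.eval (c.z i)) {V W T : Y.Etale} (hW : IsAffine W.left)
    (hT : IsAffine T.left) {w : Lift p W} {t : Lift p T} {j : W ⟶ c.U} {k : T ⟶ c.U}
    (hj : w.map j = c.u) (hk : t.map k = c.u) {a : ℝ → CPoint π W} {b : ℝ → CPoint π T}
    (ha : c.IsArc z w j a) (hb : c.IsArc z t k b) (j' : W ⟶ V) (k' : T ⟶ V)
    (h : w.map j' = t.map k') : ∀ᶠ s in 𝓝 0, (a s).map j' = (b s).map k' := by
  obtain ⟨X, x, i, i', rfl, rfl, hi⟩ := exists_common_lift_over w t j' k' h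
  -- The two maps from `X` to the chart are only known to agree at the lift of `p`, so a further
  -- refinement equalises them.
  obtain ⟨X', x', e, rfl, he⟩ := exists_equalizing_lift x (i ≫ j) (i' ≫ k) (by
    rw [← Lift.map_map, ← Lift.map_map, hj, hk])
  obtain ⟨X'', e', x'', hX, rfl, -, -⟩ := x'.exists_affine ⊤ trivial
  simp only [Lift.map_map] at ha hb hj hk
  obtain ⟨d, hd⟩ := c.exists_isArc hp hz h0 hX x'' (((e' ≫ e) ≫ i) ≫ j) hj
  have h1 := ha.eventuallyEq hW (hd.map ((e' ≫ e) ≫ i) j rfl)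
  have h2 := hb.eventuallyEq hT (hd.map ((e' ≫ e) ≫ i') k (by simp only [Category.assoc, he]))
  filter_upwards [h1, h2] with s h1 h2
  rw [h1, h2, CPoint.map_map, CPoint.map_map]
  simp only [Category.assoc, hi]

/-- Arcs with prescribed coordinates exist. -/
theorem Chart.exists_arc {p : Spec (.of ℂ) ⟶ Y} (c : Chart π D p) (hp : p ≫ π = 𝟙 _)
    (z : ℝ → Fin c.n → ℂ) (hz : ∀ i, ContDiff ℝ 1 fun t ↦ z t i)
    (h0 : ∀ i, z 0 i = c.u.eval (c.z i)) :
    ∃ A : Arc π p, ∀ᶠ t in 𝓝 0, ∀ i, (A.l c.u t).lift.eval (c.z i) = z t i := by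
  -- For each neighbourhood the arc is built on an affine `W` mapping to both the chart and `V`, and
  -- then pushed forward to `V`; the germ at `0` is independent of `W`.
  have key {V : Y.Etale} (v : Lift p V) : ∃ (W : Y.Etale) (w : Lift p W) (j : W ⟶ c.U) (k : W ⟶ V)
      (a : ℝ → CPoint π W), IsAffine W.left ∧ w.map j = c.u ∧ w.map k = v ∧ c.IsArc z w j a := by
    obtain ⟨W, w, j, k, hW, hj, hk⟩ := c.exists_affine_lift v
    obtain ⟨a, ha⟩ := c.exists_isArc hp hz h0 hW w j hj
    exact ⟨W, w, j, k, a, hW, hj, hk, ha⟩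
  choose W w j k a hW hj hk ha using @key
  refine ⟨⟨fun v t ↦ (a v t).map (k v), fun i v ↦ ?_, fun v f ↦ ?_, fun v f ↦ ?_⟩, ?_⟩
  · simp only [CPoint.map_map]
    exact (ha v).map_eventuallyEq hp hz h0 (hW v) (hW _) (hj v) (hj _) (ha _) (k v ≫ i) (k _) (by
      rw [← Lift.map_map, hk, hk])
  · simp only [CPoint.eval_map]
    exact (ha v).diff _
  · rw [CPoint.eval_map, (ha v).zero, Lift.eval_map, hk]
  · have hid : c.u.map (𝟙 c.U) = c.u := congr($((Scheme.pointSmallEtale p).fiber.map_id c.U) c.u)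
    obtain ⟨b, hb⟩ := c.exists_isArc hp hz h0 c.affine c.u (𝟙 c.U) hid
    have h1 := (ha c.u).map_eventuallyEq hp hz h0 (hW _) c.affine (hj _) hid hb (k c.u) (𝟙 c.U) (by
      rw [hk, hid])
    filter_upwards [h1, hb.coord] with t h1 h2 i
    rw [h1, CPoint.eval_map]
    exact h2 i

/-- The germs given by a family of homomorphisms. -/
def germHom {α R : Type*} [CommRing R] (l : Filter α) (L : α → R →+* ℂ) : R →+* l.Germ ℂ where
  toFun f := ((fun t ↦ L t f : α → ℂ) : l.Germ ℂ)
  map_one' := congrArg _ (funext fun t ↦ map_one (L t))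
  map_zero' := congrArg _ (funext fun t ↦ map_zero (L t))
  map_mul' f g := congrArg _ (funext fun t ↦ map_mul (L t) f g)
  map_add' f g := congrArg _ (funext fun t ↦ map_add (L t) f g)

theorem Arc.germHom_map {p : Spec (.of ℂ) ⟶ Y} (A : Arc π p) {U V : Y.Etale} (j : U ⟶ V)
    (u : Lift p U) (f : Γ(V.left, ⊤)) :
    germHom (𝓝 0) (fun t ↦ (A.l u t).lift.eval) (j.left.appTop f) =
      germHom (𝓝 0) (fun t ↦ (A.l (u.map j) t).lift.eval) f := by
  refine Filter.Germ.coe_eq.2 ?_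
  filter_upwards [A.map j u] with t ht
  exact (CPoint.eval_map j (A.l u t) f).symm.trans (by rw [ht])

/-- The germ of a regular function along an arc. -/
def Arc.germ {p : Spec (.of ℂ) ⟶ Y} (A : Arc π p) : stalk p →+* (𝓝 (0 : ℝ)).Germ ℂ :=
  ((Scheme.pointSmallEtale p).presheafFiberDesc (P := etaleO Y) (T := .of ((𝓝 (0 : ℝ)).Germ ℂ))
    (fun U u ↦ CommRingCat.ofHom (germHom (𝓝 0) fun t ↦ (A.l (V := U) u t).lift.eval))
    (fun U V j u ↦ by
      ext f
      exact A.germHom_map j u f)).hom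

theorem Arc.germ_germ {p : Spec (.of ℂ) ⟶ Y} (A : Arc π p) {U : Y.Etale} (u : Lift p U)
    (f : Γ(U.left, ⊤)) : A.germ (u.germ f) = (fun t ↦ (A.l u t).lift.eval f : ℝ → ℂ) :=
  congr($((Scheme.pointSmallEtale p).toPresheafFiber_presheafFiberDesc (P := etaleO Y)
    (T := .of ((𝓝 (0 : ℝ)).Germ ℂ))
    (fun U u ↦ CommRingCat.ofHom (germHom (𝓝 0) fun t ↦ (A.l (V := U) u t).lift.eval))
    (fun U V j u ↦ by
      ext f
      exact A.germHom_map j u f) U u).hom f)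

end Arcs

/-! ### Primality of coordinates and vanishing of derivations in étale algebras -/

section Algebra

open TensorProduct

/-- The fibre `P' ⊗[P] B` is étale over the normal domain `P'`, so `exists_mul_eq_zero_of_etale`
applies to it. Here `P'` plays the role of `P / (y)`. -/
theorem exists_dvd_of_etale {P P' B k : Type} [CommRing P] [CommRing P'] [CommRing B] [Field k]
    [Algebra P P'] [Algebra P B] [Algebra.Etale P B] [IsDomain P'] [IsIntegrallyClosed P']
    (hs : Function.Surjective (algebraMap P P')) {y : P} (hy : algebraMap P P' y = 0)
    (ψ : P' →+* B ⧸ Ideal.span {algebraMap P B y})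
    (hψ : ψ.comp (algebraMap P P') = (Ideal.Quotient.mk _).comp (algebraMap P B))
    (e : B →+* k) (e' : P' →+* k) (he : e'.comp (algebraMap P P') = e.comp (algebraMap P B))
    {f g : B} (hfg : algebraMap P B y ∣ f * g) :
    ∃ a, e a ≠ 0 ∧ (algebraMap P B y ∣ a * f ∨ algebraMap P B y ∣ a * g) := by
  let ι : B →ₐ[P] P' ⊗[P] B := Algebra.TensorProduct.includeRight
  have hι : Function.Surjective ι := Algebra.TensorProduct.includeRight_surjective B hs
  let Ψ : P' →ₐ[P] B ⧸ Ideal.span {algebraMap P B y} := { ψ with commutes' := fun r ↦ congr($hψ r) }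
  -- The map `ψ` gives a retraction onto `B / (y)`, which shows that elements of `B` vanishing in
  -- the fibre are multiples of `y`.
  let ρ : P' ⊗[P] B →ₐ[P] B ⧸ Ideal.span {algebraMap P B y} :=
    Algebra.TensorProduct.lift Ψ (Ideal.Quotient.mkₐ P _) fun _ _ ↦ Commute.all _ _
  have hρ (b : B) : ρ (ι b) = Ideal.Quotient.mk _ b := by
    simp [ρ, ι]
  have hker (b : B) (hb : ι b = 0) : algebraMap P B y ∣ b := by
    rw [← Ideal.mem_span_singleton, ← Ideal.Quotient.eq_zero_iff_mem, ← hρ, hb, map_zero]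
  have hzero : ι (algebraMap P B y) = 0 := by
    rw [AlgHom.commutes, IsScalarTower.algebraMap_apply P P' (P' ⊗[P] B), hy, map_zero]
  algebraize [e.comp (algebraMap P B)]
  let E : B →ₐ[P] k := { e with commutes' := fun _ ↦ rfl }
  let E' : P' →ₐ[P] k := { e' with commutes' := fun r ↦ congr($he r) }
  let w : P' ⊗[P] B →ₐ[P] k := Algebra.TensorProduct.lift E' E fun _ _ ↦ Commute.all _ _
  have hw (b : B) : w (ι b) = e b := by
    simp [w, ι, E]
  obtain ⟨c, hc⟩ := hfg
  have h0 : ι f * ι g = 0 := by rw [← map_mul, hc, map_mul, hzero, zero_mul]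
  obtain ⟨a, ha, h⟩ := exists_mul_eq_zero_of_etale (R := P') (w : P' ⊗[P] B →+* k) h0
  obtain ⟨a, rfl⟩ := hι a
  refine ⟨a, ?_, ?_⟩
  · rw [← hw]
    exact ha
  · rcases h with h | h
    · exact .inl (hker _ (by rw [map_mul, h]))
    · exact .inr (hker _ (by rw [map_mul, h]))

/-- The hyperplane `X_i = 0` has the polynomial ring in the remaining variables as coordinate ring,
and that is a normal domain. -/
theorem exists_dvd_of_etale_mvPolynomial {σ B : Type} [CommRing B]
    [Algebra (MvPolynomial σ ℂ) B] [Algebra.Etale (MvPolynomial σ ℂ) B] (i : σ)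
    (e : B →+* ℂ) (he : e (algebraMap (MvPolynomial σ ℂ) B (.X i)) = 0)
    {f g : B} (hfg : algebraMap (MvPolynomial σ ℂ) B (.X i) ∣ f * g) :
    ∃ a, e a ≠ 0 ∧ (algebraMap (MvPolynomial σ ℂ) B (.X i) ∣ a * f ∨
      algebraMap (MvPolynomial σ ℂ) B (.X i) ∣ a * g) := by
  classical
  let P' := MvPolynomial {j : σ // j ≠ i} ℂ
  let φ : MvPolynomial σ ℂ →+* P' :=
    MvPolynomial.eval₂Hom MvPolynomial.C fun j ↦ if h : j ≠ i then .X ⟨j, h⟩ else 0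
  have hφC (r : ℂ) : φ (.C r) = .C r := by simp [φ]
  have hφX (j : {j : σ // j ≠ i}) : φ (.X j) = .X j := by simp [φ, j.2]
  have hφi : φ (.X i) = 0 := by simp [φ]
  let ψ : P' →+* B ⧸ Ideal.span {algebraMap (MvPolynomial σ ℂ) B (.X i)} :=
    MvPolynomial.eval₂Hom ((Ideal.Quotient.mk _).comp
      ((algebraMap (MvPolynomial σ ℂ) B).comp MvPolynomial.C)) fun j ↦
        Ideal.Quotient.mk _ (algebraMap (MvPolynomial σ ℂ) B (.X j))
  let e' : P' →+* ℂ := MvPolynomial.eval₂Hom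
      (e.comp ((algebraMap (MvPolynomial σ ℂ) B).comp MvPolynomial.C)) fun j ↦
        e (algebraMap (MvPolynomial σ ℂ) B (.X j))
  have hψC (r : ℂ) : ψ (.C r) = Ideal.Quotient.mk _ (algebraMap (MvPolynomial σ ℂ) B (.C r)) :=
    MvPolynomial.eval₂Hom_C ..
  have hψX (j : {j : σ // j ≠ i}) :
      ψ (.X j) = Ideal.Quotient.mk _ (algebraMap (MvPolynomial σ ℂ) B (.X j)) :=
    MvPolynomial.eval₂Hom_X' ..
  have heC (r : ℂ) : e' (.C r) = e (algebraMap (MvPolynomial σ ℂ) B (.C r)) :=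
    MvPolynomial.eval₂Hom_C ..
  have heX (j : {j : σ // j ≠ i}) : e' (.X j) = e (algebraMap (MvPolynomial σ ℂ) B (.X j)) :=
    MvPolynomial.eval₂Hom_X' ..
  have hs : Function.Surjective φ := by
    intro q
    induction q using MvPolynomial.induction_on with
    | C r => exact ⟨_, hφC r⟩
    | add p q hp hq =>
      obtain ⟨a, rfl⟩ := hp
      obtain ⟨b, rfl⟩ := hq
      exact ⟨a + b, map_add _ _ _⟩
    | mul_X p j hp =>
      obtain ⟨a, rfl⟩ := hp
      exact ⟨a * .X j, by rw [map_mul, hφX]⟩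
  algebraize [φ]
  refine exists_dvd_of_etale (P' := P') hs (y := .X i) hφi ψ ?_ e e' ?_ hfg
  · refine MvPolynomial.ringHom_ext (fun r ↦ ?_) fun j ↦ ?_
    · change ψ (φ _) = _
      rw [hφC, hψC]
      rfl
    · change ψ (φ _) = _
      by_cases hj : j = i
      · subst hj
        rw [hφi, map_zero]
        exact (Ideal.Quotient.eq_zero_iff_mem.2 (Ideal.mem_span_singleton_self _)).symm
      · rw [hφX ⟨j, hj⟩, hψX]
        rfl
  · refine MvPolynomial.ringHom_ext (fun r ↦ ?_) fun j ↦ ?_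
    · change e' (φ _) = _
      rw [hφC, heC]
      rfl
    · change e' (φ _) = _
      by_cases hj : j = i
      · subst hj
        rw [hφi, map_zero]
        exact he.symm
      · rw [hφX ⟨j, hj⟩, heX]
        rfl

/-- With `ℂ` viewed as a `B`-module through `e`, `d` is a `P`-derivation and so factors through the
Kähler differentials of `B` over `P`, which vanish. -/
theorem derivation_eq_zero {P B : Type} [CommRing P] [CommRing B] [Algebra P B]
    [Algebra.FormallyUnramified P B] (e : B →+* ℂ) (d : B → ℂ)
    (hadd : ∀ f g, d (f + g) = d f + d g) (hmul : ∀ f g, d (f * g) = e f * d g + e g * d f)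
    (hP : ∀ r, d (algebraMap P B r) = 0) (b : B) : d b = 0 := by
  let := Module.compHom ℂ e
  let := Module.compHom ℂ (e.comp (algebraMap P B))
  have hsB (b : B) (z : ℂ) : b • z = e b * z := rfl
  have hsP (r : P) (z : ℂ) : r • z = e (algebraMap P B r) * z := rfl
  have : IsScalarTower P B ℂ := ⟨fun r b z ↦ by
    rw [hsB, hsP, hsB, Algebra.smul_def, map_mul, mul_assoc]⟩
  let δ : Derivation P B ℂ := Derivation.mk'
    { toFun := d
      map_add' := hadd
      map_smul' := fun r f ↦ by
        rw [Algebra.smul_def, hmul, hP, mul_zero, add_zero]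
        rfl }
    fun f g ↦ hmul f g
  have h := δ.liftKaehlerDifferential_comp_D b
  rw [Subsingleton.elim (KaehlerDifferential.D P B b) 0, map_zero] at h
  exact h.symm

end Algebra

/-! ### The étale stalk is a domain with prime coordinates -/

section LocalRing

variable {Y : Scheme.{0}} {π : Y ⟶ Spec (.of ℂ)} {D : Y.IdealSheafData}
  {p : Spec (.of ℂ) ⟶ Y}

/-- On the locus where `f` is invertible `g` is a unit, and that locus is the localisation at `f`.
This turns statements about the complement of `D` into divisibility. -/
theorem isPow_dvd_of_basicOpen_le {X : Scheme.{0}} [IsAffine X] {f g : Γ(X, ⊤)}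
    (h : X.basicOpen f ≤ X.basicOpen g) : ∃ N : ℕ, g ∣ f ^ N := by
  have h1 : IsUnit (algebraMap Γ(X, ⊤) Γ(X, X.basicOpen f) g) :=
    X.toRingedSpace.isUnit_of_isUnit_germ _ _ fun x hx ↦ by
      have h2 := (Scheme.mem_basicOpen_top X g x).1 (h hx)
      rwa [← X.presheaf.germ_res_apply (homOfLE (le_top : X.basicOpen f ≤ ⊤)) x hx] at h2
  have := (isAffineOpen_top X).isLocalization_basicOpen f
  obtain ⟨N, hN⟩ := (IsLocalization.Away.algebraMap_isUnit_iff (S := Γ(X, X.basicOpen f)) f).1 h1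
  exact ⟨N, hN⟩

/-- The germ at `p` of a coordinate. -/
def Chart.g (c : Chart π D p) (i : Fin c.n) : stalk p := c.u.germ (c.z i)

theorem Chart.eval_g (c : Chart π D p) (i : Fin c.n) :
    stalkEval p (c.g i) = c.u.eval (c.z i) := stalkEval_germ _ _

/-- The indices of the branches of the divisor through `p`. -/
def Chart.S₀ (c : Chart π D p) : Finset (Fin c.n) := {i ∈ c.S | stalkEval p (c.g i) = 0}

theorem Chart.mem_S₀ (c : Chart π D p) {i : Fin c.n} :
    i ∈ c.S₀ ↔ i ∈ c.S ∧ stalkEval p (c.g i) = 0 := Finset.mem_filter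

theorem Chart.exists_affine_germ (c : Chart π D p) {V : Y.Etale} (v : Lift p V) :
    ∃ (W : Y.Etale) (w : Lift p W) (j : W ⟶ c.U) (k : W ⟶ V), IsAffine W.left ∧
      w.map j = c.u ∧ w.map k = v ∧ ∀ i, w.germ (j.left.appTop (c.z i)) = c.g i := by
  obtain ⟨W, w, j, k, hW, hj, hk⟩ := c.exists_affine_lift v
  refine ⟨W, w, j, k, hW, hj, hk, fun i ↦ ?_⟩
  rw [Lift.germ_map, hj]
  rfl

theorem Chart.exists_affine_germ_eq (c : Chart π D p) (s : stalk p) :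
    ∃ (W : Y.Etale) (w : Lift p W) (j : W ⟶ c.U) (f : Γ(W.left, ⊤)), IsAffine W.left ∧
      w.map j = c.u ∧ w.germ f = s ∧ ∀ i, w.germ (j.left.appTop (c.z i)) = c.g i := by
  obtain ⟨V, v, f, rfl⟩ := Lift.germ_surjective s
  obtain ⟨W, w, j, k, hW, hj, rfl, h⟩ := c.exists_affine_germ v
  exact ⟨W, w, j, k.left.appTop f, hW, hj, Lift.germ_map _ _ _, h⟩

theorem Chart.exists_affine_germ_eq₂ (c : Chart π D p) (s t : stalk p) :
    ∃ (W : Y.Etale) (w : Lift p W) (j : W ⟶ c.U) (f g : Γ(W.left, ⊤)), IsAffine W.left ∧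
      w.map j = c.u ∧ w.germ f = s ∧ w.germ g = t ∧
      ∀ i, w.germ (j.left.appTop (c.z i)) = c.g i := by
  obtain ⟨V, v, f, rfl⟩ := Lift.germ_surjective s
  obtain ⟨V', v', f', rfl⟩ := Lift.germ_surjective t
  obtain ⟨X, x, a, b, rfl, rfl⟩ := exists_common_lift v v'
  obtain ⟨W, w, j, k, hW, hj, rfl, h⟩ := c.exists_affine_germ x
  refine ⟨W, w, j, k.left.appTop (a.left.appTop f), k.left.appTop (b.left.appTop f'), hW, hj, ?_,
    ?_, h⟩
  · rw [Lift.germ_map, Lift.germ_map]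
  · rw [Lift.germ_map, Lift.germ_map]

theorem Chart.exists_affine_germ_eq_zero {U : Y.Etale} {u : Lift p U} {f : Γ(U.left, ⊤)}
    (h : u.germ f = 0) : ∃ (W : Y.Etale) (i : W ⟶ U) (w : Lift p W), IsAffine W.left ∧
      w.map i = u ∧ i.left.appTop f = 0 := by
  obtain ⟨W, i, w, rfl, h'⟩ := (u.germ_eq_iff_self f 0).1 (h.trans (map_zero _).symm)
  obtain ⟨T, j, t, hT, rfl, -, -⟩ := w.exists_affine ⊤ trivial
  refine ⟨T, j ≫ i, t, hT, (Lift.map_map _ _ _).symm, ?_⟩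
  change (j.left ≫ i.left).appTop f = 0
  rw [Scheme.Hom.comp_appTop]
  change j.left.appTop (i.left.appTop f) = 0
  refine (congrArg j.left.appTop h').trans ?_
  exact (congrArg j.left.appTop (map_zero i.left.appTop.hom)).trans (map_zero j.left.appTop.hom)

theorem Lift.isUnit_germ {U : Y.Etale} {u : Lift p U} {f : Γ(U.left, ⊤)} (h : u.eval f ≠ 0) :
    IsUnit (u.germ f) := by
  rw [isUnit_stalk_iff, stalkEval_germ]
  exact h

instance : Nontrivial (stalk p) := (stalkEval p).domain_nontrivial

/-- A relation `s t = 0` holds on some affine neighbourhood étale over a polynomial ring. The factor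
supplied by `exists_mul_eq_zero_of_etale` is nonzero at `p`, hence a unit in the stalk. -/
theorem Chart.isDomain_stalk (c : Chart π D p) : IsDomain (stalk p) := by
  have : NoZeroDivisors (stalk p) := ⟨fun {s t} hst ↦ by
    obtain ⟨W, w, j, f, g, -, hj, rfl, rfl, -⟩ := c.exists_affine_germ_eq₂ s t
    rw [← map_mul] at hst
    obtain ⟨T, i, t, hT, rfl, h⟩ := Chart.exists_affine_germ_eq_zero hst
    let φ : MvPolynomial (Fin c.n) ℂ →+* Γ(T.left, ⊤) :=
      coordHom π T fun e ↦ (i ≫ j).left.appTop (c.z e)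
    have het : φ.Etale := (c.pull hT t (i ≫ j)).etale
    algebraize [φ]
    have h0 : i.left.appTop f * i.left.appTop g = 0 := (map_mul i.left.appTop.hom f g).symm.trans h
    obtain ⟨a, ha, h⟩ := exists_mul_eq_zero_of_etale (R := MvPolynomial (Fin c.n) ℂ) t.eval h0
    rw [← Lift.germ_map, ← Lift.germ_map]
    have hu := Lift.isUnit_germ ha
    refine h.imp (fun h ↦ ?_) fun h ↦ ?_
    · rw [← hu.mul_right_eq_zero, ← map_mul, h, map_zero]
    · rw [← hu.mul_right_eq_zero, ← map_mul, h, map_zero]⟩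
  exact NoZeroDivisors.to_isDomain _

/-- As for the domain property: the divisibility is spread out to one affine neighbourhood, and the
extra factor is a unit in the stalk. -/
theorem Chart.prime_or (c : Chart π D p) {i : Fin c.n} (hi : stalkEval p (c.g i) = 0)
    {s t : stalk p} (hst : c.g i ∣ s * t) : c.g i ∣ s ∨ c.g i ∣ t := by
  obtain ⟨r, hr⟩ := hst
  obtain ⟨X, x, a, f, g, -, ha, rfl, rfl, -⟩ := c.exists_affine_germ_eq₂ s t
  obtain ⟨X', x', a', h, -, ha', rfl, hg⟩ := c.exists_affine_germ_eq r
  obtain ⟨Z, z, b, b', rfl, rfl⟩ := exists_common_lift x x'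
  have hz : z.germ (b.left.appTop (f * g) - b'.left.appTop (a'.left.appTop (c.z i) * h)) = 0 := by
    rw [map_sub, Lift.germ_map, Lift.germ_map, map_mul, map_mul, hg, hr, sub_self]
  obtain ⟨T, e, t, hT, rfl, h0⟩ := Chart.exists_affine_germ_eq_zero hz
  let φ : MvPolynomial (Fin c.n) ℂ →+* Γ(T.left, ⊤) :=
    coordHom π T fun l ↦ ((e ≫ b') ≫ a').left.appTop (c.z l)
  have het : φ.Etale := (c.pull hT t ((e ≫ b') ≫ a')).etale
  have hφ : φ (.X i) = e.left.appTop (b'.left.appTop (a'.left.appTop (c.z i))) := by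
    simp only [φ, coordHom, MvPolynomial.coe_eval₂Hom, MvPolynomial.eval₂_X]
    rfl
  have hφg : t.germ (φ (.X i)) = c.g i := by
    rw [hφ, Lift.germ_map, Lift.germ_map, hg]
  algebraize [φ]
  obtain ⟨d, hd, h⟩ := exists_dvd_of_etale_mvPolynomial i t.eval (by
      rw [← stalkEval_germ, ← hi]
      exact congrArg _ hφg) (f := e.left.appTop (b.left.appTop f))
      (g := e.left.appTop (b.left.appTop g)) ⟨e.left.appTop (b'.left.appTop h), by
        change _ = φ _ * _
        rw [hφ]
        simpa only [map_sub, map_mul, sub_eq_zero] using h0⟩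
  have hu := Lift.isUnit_germ hd
  have key (y : Γ(X.left, ⊤)) (hy : φ (.X i) ∣ d * e.left.appTop (b.left.appTop y)) :
      c.g i ∣ (((t.map e).map b).germ y) := by
    have := map_dvd t.germ hy
    rwa [hφg, map_mul, hu.dvd_mul_left, Lift.germ_map, Lift.germ_map] at this
  exact h.imp (key f) (key g)

end LocalRing

/-! ### Algebraic tangent vectors as velocities of arcs -/

section Tangent

variable {Y : Scheme.{0}} {π : Y ⟶ Spec (.of ℂ)} {D : Y.IdealSheafData}
  {p : Spec (.of ℂ) ⟶ Y}

/-- The representative along an arc of a germ of regular functions. -/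
theorem Arc.exists_germ_eq (A : Arc π p) (s : stalk p) :
    ∃ h : ℝ → ℂ, A.germ s = h ∧ DifferentiableAt ℝ h 0 ∧ h 0 = stalkEval p s := by
  obtain ⟨U, u, f, rfl⟩ := Lift.germ_surjective s
  exact ⟨_, A.germ_germ u f, A.diff u f, by rw [A.zero, stalkEval_germ]⟩

theorem Arc.differentiableAt (A : Arc π p) {s : stalk p} {h : ℝ → ℂ} (hs : A.germ s = h) :
    DifferentiableAt ℝ h 0 ∧ h 0 = stalkEval p s := by
  obtain ⟨k, hk, hd, h0⟩ := A.exists_germ_eq s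
  have hkh : h =ᶠ[𝓝 0] k := Filter.Germ.coe_eq.1 (hs.symm.trans hk)
  exact ⟨hd.congr_of_eventuallyEq hkh, hkh.self_of_nhds.trans h0⟩

theorem Arc.germ_constSection (A : Arc π p) {U : Y.Etale} (u : Lift p U) (c : ℂ) :
    A.germ (u.germ (constSection π U c)) = (fun _ ↦ c : ℝ → ℂ) := by
  rw [A.germ_germ]
  congr 1
  funext t
  exact Lift.eval_constSection (A.l u t).pt_str _ _

/-- A function of the parameter with germ `A.germ s`. -/
def Arc.rep (A : Arc π p) (s : stalk p) : ℝ → ℂ := (A.exists_germ_eq s).choose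

theorem Arc.germ_eq_rep (A : Arc π p) (s : stalk p) : A.germ s = A.rep s :=
  (A.exists_germ_eq s).choose_spec.1

theorem Arc.deriv_rep (A : Arc π p) {s : stalk p} {h : ℝ → ℂ} (hs : A.germ s = h) :
    deriv (A.rep s) 0 = deriv h 0 :=
  (Filter.Germ.coe_eq.1 ((A.germ_eq_rep s).symm.trans hs)).deriv_eq

/-- The velocity of an arc. -/
def Arc.velocity (A : Arc π p) : algTangent π p where
  val s := deriv (A.rep s) 0
  property := by
    have key (s : stalk p) := A.differentiableAt (A.germ_eq_rep s)
    refine ⟨fun f g ↦ ?_, fun U u c ↦ ?_, fun f g ↦ ?_⟩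
    · refine (A.deriv_rep (h := A.rep f + A.rep g) ?_).trans (deriv_add (key f).1 (key g).1)
      rw [map_add, A.germ_eq_rep f, A.germ_eq_rep g]
      rfl
    · exact (A.deriv_rep (A.germ_constSection u c)).trans (deriv_const _ _)
    · refine (A.deriv_rep (h := A.rep f * A.rep g) ?_).trans ?_
      · rw [map_mul, A.germ_eq_rep f, A.germ_eq_rep g]
        rfl
      · rw [deriv_mul (key f).1 (key g).1, (key f).2, (key g).2]
        ring

theorem Arc.velocity_eq (A : Arc π p) {s : stalk p} {h : ℝ → ℂ} (hs : A.germ s = h) :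
    A.velocity.1 s = deriv h 0 :=
  A.deriv_rep hs

theorem Chart.exists_arc_germ (c : Chart π D p) (hp : p ≫ π = 𝟙 _) (z : ℝ → Fin c.n → ℂ)
    (hz : ∀ i, ContDiff ℝ 1 fun t ↦ z t i) (h0 : ∀ i, z 0 i = stalkEval p (c.g i)) :
    ∃ A : Arc π p, ∀ i, A.germ (c.g i) = (fun t ↦ z t i : ℝ → ℂ) := by
  obtain ⟨A, hA⟩ := c.exists_arc hp z hz fun i ↦ (h0 i).trans (c.eval_g i)
  refine ⟨A, fun i ↦ (A.germ_germ _ _).trans (Filter.Germ.coe_eq.2 ?_)⟩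
  filter_upwards [hA] with t ht using ht i

/-- The vector is the velocity of the arc whose coordinates are the straight line through the
coordinates of `p` with direction `ζ`. -/
theorem Chart.exists_tangent (c : Chart π D p) (hp : p ≫ π = 𝟙 _) (ζ : Fin c.n → ℂ) :
    ∃ v : algTangent π p, ∀ i, v.1 (c.g i) = ζ i := by
  obtain ⟨A, hA⟩ := c.exists_arc_germ hp (fun t i ↦ stalkEval p (c.g i) + t * ζ i)
    (fun i ↦ contDiff_const.add (Complex.ofRealCLM.contDiff.mul contDiff_const))
    (fun i ↦ by simp)
  refine ⟨A.velocity, fun i ↦ (A.velocity_eq (hA i)).trans ?_⟩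
  have h : HasDerivAt (fun t : ℝ ↦ stalkEval p (c.g i) + (t : ℂ) * ζ i) (1 * ζ i) 0 :=
    ((Complex.ofRealCLM.hasDerivAt (x := 0)).mul_const (ζ i)).const_add _
  rw [h.deriv, one_mul]

theorem algTangent_zero (v : algTangent π p) : v.1 0 = 0 := by
  have := v.2.1 0 0
  simpa using this

/-- On an affine neighbourhood the derivation kills the polynomials in the coordinates, over which
the ring of functions is unramified. -/
theorem Chart.tangent_eq_zero (c : Chart π D p) (v : algTangent π p)
    (hv : ∀ i, v.1 (c.g i) = 0) : v = 0 := by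
  refine Subtype.ext (funext fun s ↦ ?_)
  obtain ⟨W, w, j, f, hW, hj, rfl, hg⟩ := c.exists_affine_germ_eq s
  let φ : MvPolynomial (Fin c.n) ℂ →+* Γ(W.left, ⊤) :=
    coordHom π W fun e ↦ j.left.appTop (c.z e)
  have het : φ.Etale := (c.pull hW w j).etale
  have hmul (a b : Γ(W.left, ⊤)) : v.1 (w.germ (a * b)) =
      w.eval a * v.1 (w.germ b) + w.eval b * v.1 (w.germ a) := by
    rw [map_mul, v.2.2.2, stalkEval_germ, stalkEval_germ]
  have hadd (a b : Γ(W.left, ⊤)) : v.1 (w.germ (a + b)) = v.1 (w.germ a) + v.1 (w.germ b) := by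
    rw [map_add, v.2.1]
  have hφ (q : MvPolynomial (Fin c.n) ℂ) : v.1 (w.germ (φ q)) = 0 := by
    induction q using MvPolynomial.induction_on with
    | C r =>
      have : φ (.C r) = constSection π W r := by simp [φ, coordHom, constHom_apply]
      rw [this, v.2.2.1]
    | add a b ha hb => rw [map_add, hadd, ha, hb, add_zero]
    | mul_X a i ha =>
      have : φ (.X i) = j.left.appTop (c.z i) := by simp [φ, coordHom]
      rw [map_mul, hmul, ha, this, hg, hv, mul_zero, mul_zero, add_zero]
  algebraize [φ]
  exact derivation_eq_zero (P := MvPolynomial (Fin c.n) ℂ) w.eval (fun f ↦ v.1 (w.germ f)) hadd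
    hmul hφ f

/-- A tangent vector with `dz_j = 1` and `dz_i = 0` kills every multiple of `g_i`, because `g_i`
also vanishes at `p`. -/
theorem Chart.not_dvd (c : Chart π D p) (hp : p ≫ π = 𝟙 _) {i j : Fin c.n}
    (hi : stalkEval p (c.g i) = 0) (hij : i ≠ j) : ¬ c.g i ∣ c.g j := by
  rintro ⟨s, hs⟩
  obtain ⟨v, hv⟩ := c.exists_tangent hp (Pi.single j 1)
  have h := v.2.2.2 (c.g i) s
  rw [← hs, hv, hv, hi] at h
  simp [hij] at h

theorem Chart.g_ne_zero (c : Chart π D p) (hp : p ≫ π = 𝟙 _) (i : Fin c.n) : c.g i ≠ 0 := by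
  intro h0
  obtain ⟨v, hv⟩ := c.exists_tangent hp 1
  have := hv i
  rw [h0, algTangent_zero] at this
  simp at this

theorem Chart.prime (c : Chart π D p) (hp : p ≫ π = 𝟙 _) {i : Fin c.n}
    (hi : stalkEval p (c.g i) = 0) : Prime (c.g i) :=
  ⟨c.g_ne_zero hp i, fun h ↦ isUnit_stalk_iff.1 h hi, fun _ _ h ↦ c.prime_or hi h⟩

end Tangent

/-! ### The stalk of the log structure and the branches of the divisor -/

section Monoid

variable {Y : Scheme.{0}} {π : Y ⟶ Spec (.of ℂ)} {D : Y.IdealSheafData}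
  {p : Spec (.of ℂ) ⟶ Y}

theorem mem_stalkM_of_isUnit {s : stalk p} (h : IsUnit s) : s ∈ stalkM D p := by
  obtain ⟨U, u, f, rfl⟩ := Lift.germ_surjective s
  rw [isUnit_stalk_iff, stalkEval_germ] at h
  obtain ⟨W, j, w, -, rfl, hu⟩ := u.exists_affine_isUnit f h
  refine ⟨W, w, ⟨j.left.appTop f, ?_⟩, Lift.germ_map _ _ _⟩
  change _ ≤ W.left.basicOpen (j.left.appTop f)
  rw [Scheme.basicOpen_of_isUnit _ hu]
  exact le_top

theorem Chart.z_mem (c : Chart π D p) {i : Fin c.n} (hi : i ∈ c.S) :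
    c.z i ∈ logSections Y (divisorCompl D) c.U := by
  change c.U.hom ⁻¹ᵁ divisorCompl D ≤ _
  rw [c.compl, ← Finset.mul_prod_erase _ _ hi, Scheme.basicOpen_mul]
  exact inf_le_left

theorem Chart.g_mem (c : Chart π D p) {i : Fin c.n} (hi : i ∈ c.S₀) : c.g i ∈ stalkM D p :=
  ⟨c.U, c.u, ⟨c.z i, c.z_mem (c.mem_S₀.1 hi).1⟩, rfl⟩

/-- A branch equation, as a section of the log structure. -/
def Chart.m (c : Chart π D p) (i : c.S₀) : stalkM D p := ⟨c.g i, c.g_mem i.2⟩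

theorem Chart.eval_m (c : Chart π D p) (i : c.S₀) : stalkEval p (c.m i : stalk p) = 0 :=
  (c.mem_S₀.1 i.2).2

/-- The product of the local equations of the branches. -/
theorem Chart.exists_prod_eq (c : Chart π D p) :
    ∃ b : stalk p, IsUnit b ∧ c.u.germ (∏ i ∈ c.S, c.z i) = b * ∏ i ∈ c.S₀, c.g i := by
  refine ⟨∏ i ∈ c.S with ¬ stalkEval p (c.g i) = 0, c.g i, ?_, ?_⟩
  · rw [IsUnit.prod_iff]
    intro i hi
    exact isUnit_stalk_iff.2 (Finset.mem_filter.1 hi).2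
  · rw [map_prod, mul_comm]
    exact (Finset.prod_filter_mul_prod_filter_not _ _ _).symm

/-- A divisor of a unit times a power of a product of primes is again a unit times a monomial; no
unique factorisation in the ambient ring is assumed. -/
theorem exists_eq_mul_prod_pow {ι R : Type*} [CommMonoidWithZero R] [IsCancelMulZero R] [DecidableEq ι]
    (s : Finset ι) {q : ι → R} (hq : ∀ i ∈ s, Prime (q i)) {x y b : R} (hb : IsUnit b) {N : ℕ}
    (h : x * y = b * (∏ i ∈ s, q i) ^ N) :
    ∃ (e : R) (a : ι → ℕ), IsUnit e ∧ x = e * ∏ i ∈ s, q i ^ a i := by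
  -- The power is written as a product over `s × {0, …, N - 1}`, so that a divisor corresponds to a
  -- subset `t` and exponents are fibre cardinalities.
  have h1 : (∏ i ∈ s, q i) ^ N = ∏ k ∈ s ×ˢ Finset.range N, q k.1 := by
    rw [Finset.prod_product, ← Finset.prod_pow]
    simp
  rw [h1] at h
  obtain ⟨t, u, e, e', htu, -, rfl, rfl, -⟩ := mul_eq_mul_prime_prod
    (fun k hk ↦ hq k.1 (Finset.mem_product.1 hk).1) h
  refine ⟨e, fun i ↦ (t.filter fun k ↦ k.1 = i).card, isUnit_of_mul_isUnit_left hb, ?_⟩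
  congr 1
  have hts : ∀ k ∈ t, k.1 ∈ s := fun k hk ↦
    (Finset.mem_product.1 (htu ▸ Finset.mem_union_left u hk)).1
  rw [← Finset.prod_fiberwise_of_maps_to hts]
  refine Finset.prod_congr rfl fun i _ ↦ ?_
  rw [Finset.prod_congr rfl (g := fun _ ↦ q i) fun k hk ↦ by rw [(Finset.mem_filter.1 hk).2],
    Finset.prod_const]

/-- Sections of the log structure are monomials in the branch equations times units. -/
theorem Chart.exists_monomial (c : Chart π D p) (hp : p ≫ π = 𝟙 _) (m : stalkM D p) :
    ∃ (b : stalk p) (a : Fin c.n → ℕ), IsUnit b ∧ (m : stalk p) = b * ∏ i ∈ c.S₀, c.g i ^ a i := by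
  obtain ⟨V, v, m, rfl⟩ := exists_germM_eq m
  obtain ⟨W, w, j, k, hW, hj, rfl, -⟩ := c.exists_affine_germ v
  have hm := logSections_map _ k m.2
  have h1 : W.left.basicOpen (j.left.appTop (∏ i ∈ c.S, c.z i)) ≤
      W.left.basicOpen (k.left.appTop m.1) := by
    rw [← Scheme.preimage_basicOpen_top]
    have : W.hom ⁻¹ᵁ divisorCompl D = j.left ⁻¹ᵁ c.U.left.basicOpen (∏ i ∈ c.S, c.z i) := by
      rw [hom_preimage j, c.compl]
    exact this.ge.trans hm
  -- A section invertible off `D` divides a power of the equation of `D`.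
  obtain ⟨N, h, hN⟩ := isPow_dvd_of_basicOpen_le h1
  have h2 := congrArg w.germ hN
  rw [map_pow, map_mul, Lift.germ_map, Lift.germ_map, hj] at h2
  obtain ⟨b, hb, hprod⟩ := c.exists_prod_eq
  rw [hprod, mul_pow] at h2
  have := c.isDomain_stalk
  obtain ⟨e, a, he, h3⟩ := exists_eq_mul_prod_pow c.S₀
    (fun i hi ↦ c.prime hp (c.mem_S₀.1 hi).2) (hb.pow N) h2.symm
  exact ⟨e, a, he, h3⟩

theorem Chart.prod_mem_divisorIdeal (c : Chart π D p) : ∏ i ∈ c.S₀, c.g i ∈ divisorIdeal D p := by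
  obtain ⟨b, hb, hprod⟩ := c.exists_prod_eq
  have h : c.u.germ (∏ i ∈ c.S, c.z i) ∈ divisorIdeal D p :=
    Ideal.subset_span ⟨c.U, c.u, _, c.compl.ge, rfl⟩
  rwa [hprod, Ideal.unit_mul_mem_iff_mem _ hb] at h

/-- A function `f` invertible only off `D` has a power divisible by the equation of `D`, hence by
the prime `g_i`. -/
theorem Chart.divisorIdeal_le (c : Chart π D p) (hp : p ≫ π = 𝟙 _) {i : Fin c.n}
    (hi : i ∈ c.S₀) : divisorIdeal D p ≤ Ideal.span {c.g i} := by
  refine Ideal.span_le.2 ?_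
  rintro _ ⟨V, v, f, hf, rfl⟩
  obtain ⟨W, w, j, k, hW, hj, rfl, -⟩ := c.exists_affine_germ v
  have h1 : W.left.basicOpen (k.left.appTop f) ≤
      W.left.basicOpen (j.left.appTop (∏ i ∈ c.S, c.z i)) := by
    rw [← Scheme.preimage_basicOpen_top, ← Scheme.preimage_basicOpen_top]
    have h1 : W.hom ⁻¹ᵁ divisorCompl D = j.left ⁻¹ᵁ c.U.left.basicOpen (∏ i ∈ c.S, c.z i) := by
      rw [hom_preimage j, c.compl]
    have h2 : W.hom ⁻¹ᵁ divisorCompl D = k.left ⁻¹ᵁ V.hom ⁻¹ᵁ divisorCompl D := hom_preimage k _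
    refine le_trans ?_ (h2.symm.trans h1).le
    exact fun x hx ↦ hf hx
  obtain ⟨N, hN⟩ := isPow_dvd_of_basicOpen_le h1
  have h2 := map_dvd w.germ hN
  rw [map_pow, Lift.germ_map, Lift.germ_map, hj] at h2
  have h3 : c.g i ∣ c.u.germ (∏ i ∈ c.S, c.z i) := by
    rw [map_prod]
    exact Finset.dvd_prod_of_mem (fun i ↦ c.u.germ (c.z i)) (c.mem_S₀.1 hi).1
  exact Ideal.mem_span_singleton.2 ((c.prime hp (c.mem_S₀.1 hi).2).dvd_of_dvd_pow (h3.trans h2))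

/-- A prime containing the ideal of `D` contains some `g_j`, since it contains their product. If it
also lies below `(g_i)`, then `g_i` divides `g_j` and `i = j`. -/
theorem Chart.span_mem_minimalPrimes (c : Chart π D p) (hp : p ≫ π = 𝟙 _) {i : Fin c.n}
    (hi : i ∈ c.S₀) : Ideal.span {c.g i} ∈ (divisorIdeal D p).minimalPrimes := by
  have hprime := c.prime hp (c.mem_S₀.1 hi).2
  refine ⟨⟨(Ideal.span_singleton_prime hprime.1).2 hprime, c.divisorIdeal_le hp hi⟩, ?_⟩
  rintro q ⟨hq, hDq⟩ hle
  obtain ⟨j, hj, hjq⟩ := (hq.prod_mem_iff).1 (hDq c.prod_mem_divisorIdeal)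
  have hij : i = j := by
    by_contra h
    exact c.not_dvd hp (c.mem_S₀.1 hi).2 h (Ideal.mem_span_singleton.1 (hle hjq))
  subst hij
  exact (Ideal.span_singleton_le_iff_mem _).2 hjq

theorem Chart.exists_eq_span (c : Chart π D p) (hp : p ≫ π = 𝟙 _) (q : Branch D p) :
    ∃ i ∈ c.S₀, q.1 = Ideal.span {c.g i} := by
  obtain ⟨q, ⟨hq, hDq⟩, hmin⟩ := q
  obtain ⟨i, hi, hiq⟩ := (hq.prod_mem_iff).1 (hDq c.prod_mem_divisorIdeal)
  have h := (Ideal.span_singleton_le_iff_mem _).2 hiq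
  refine ⟨i, hi, le_antisymm (hmin ?_ h) h⟩
  exact (c.span_mem_minimalPrimes hp hi).1

/-- The branch with equation `c.g i`. -/
def Chart.branch (c : Chart π D p) (hp : p ≫ π = 𝟙 _) (i : c.S₀) : Branch D p :=
  ⟨_, c.span_mem_minimalPrimes hp i.2⟩

theorem Chart.branch_bijective (c : Chart π D p) (hp : p ≫ π = 𝟙 _) :
    Function.Bijective (c.branch hp) := by
  refine ⟨fun i j h ↦ ?_, fun q ↦ ?_⟩
  · by_contra hij
    have h1 : Ideal.span {c.g i} = Ideal.span {c.g j} := congrArg Subtype.val h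
    refine c.not_dvd hp (c.mem_S₀.1 i.2).2 (fun h ↦ hij (Subtype.ext h))
      (Ideal.mem_span_singleton.1 (h1.ge (Ideal.mem_span_singleton_self _)))
  · obtain ⟨i, hi, h⟩ := c.exists_eq_span hp q
    exact ⟨⟨i, hi⟩, Subtype.ext h.symm⟩

/-- By the Leibniz rule a derivation sends `s r` to `r(p)` times its value on `s`. So a normal
vector to the branch `s = 0` is determined by one complex number. -/
theorem mem_branchTangent_span {s : stalk p} (hs : stalkEval p s = 0) {v : algTangent π p} :
    v ∈ branchTangent π p (Ideal.span {s}) ↔ v.1 s = 0 := by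
  refine ⟨fun h ↦ h s (Ideal.mem_span_singleton_self _), fun h f hf ↦ ?_⟩
  obtain ⟨r, rfl⟩ := Ideal.mem_span_singleton.1 hf
  rw [v.2.2.2, hs, h, zero_mul, mul_zero, add_zero]

theorem mkQ_branch_eq {s : stalk p} (hs : stalkEval p s = 0) {v w : algTangent π p} :
    (branchTangent π p (Ideal.span {s})).mkQ v = (branchTangent π p (Ideal.span {s})).mkQ w ↔
      v.1 s = w.1 s := by
  rw [Submodule.mkQ_apply, Submodule.mkQ_apply, Submodule.Quotient.eq, mem_branchTangent_span hs]
  exact sub_eq_zero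

end Monoid

/-! ### Smooth germs and tangent vectors of the Kato–Nakayama space -/

section SmoothGerms

variable {Y : Scheme.{0}} {π : Y ⟶ Spec (.of ℂ)} {D : Y.IdealSheafData}

theorem evalGerm_eq_iff {x : KNPoint π D} {U : Y.Etale} {u : Lift x.pt U} {f : Γ(U.left, ⊤)}
    {c : KNPoint π D → ℂ} : evalGerm x (u.germ f) = c ↔
      ∀ᶠ y in 𝓝 (⟨x, u⟩ : KNOver π D U), c y.pt = y.lift.eval f := by
  rw [evalGerm_germ, descend_eq_iff]

theorem argGerm_eq_iff {x : KNPoint π D} {U : Y.Etale} {u : Lift x.pt U}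
    {m : logSections Y (divisorCompl D) U} {c : KNPoint π D → ℂ} : argGerm x (u.germM D m) = c ↔
      ∀ᶠ y in 𝓝 (⟨x, u⟩ : KNOver π D U), c y.pt = y.pt.arg (y.lift.germM D m) := by
  rw [argGerm_germM, descend_eq_iff]

theorem KNSmoothAt.eventually {g : KNPoint π D → ℝ} {x : KNPoint π D} (hg : KNSmoothAt g x) :
    ∀ᶠ y in 𝓝 x, KNSmoothAt g y := by
  obtain ⟨U, u, ι, _, e, F, he, hF, H⟩ := hg
  rw [← KNOver.eventually_pt u]
  filter_upwards [H.eventually_nhds] with y hy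
  exact ⟨U, y.lift, ι, _, e, F, he, hF, hy⟩

theorem KNMonomialAt.eventually {g : KNPoint π D → ℝ} {x : KNPoint π D} (hg : KNMonomialAt g x) :
    ∀ᶠ y in 𝓝 x, KNMonomialAt g y := by
  obtain ⟨k, hk, hpos, U, u, m, H⟩ := hg
  filter_upwards [hk.eventually, hpos.eventually_nhds,
    (KNOver.eventually_pt u (P := fun y ↦ ∃ v : Lift y.pt U,
      ∀ᶠ y in 𝓝 (⟨y, v⟩ : KNOver π D U), g y.pt = k y.pt * ‖y.lift.eval m.1‖)).1
      (H.eventually_nhds.mono fun y hy ↦ ⟨y.lift, hy⟩)] with y h1 h2 ⟨v, hv⟩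
  exact ⟨k, h1, h2, U, v, m, hv⟩

/-- Smoothness at `x` persists nearby, which provides the open set required for a germ. Tangent
vectors can then be handled as functionals on functions smooth at `x`. -/
theorem mem_smoothGerms_iff {x : KNPoint π D} {g : KNPoint π D → ℝ} :
    KNGerm (π := π) (D := D) x g ∈ (KN π D).smoothGerms x ↔ KNSmoothAt g x := by
  constructor
  · rintro ⟨W, g', hx, hg', h⟩
    have h1 : KNSmoothAt (zeroExtend (fun y : W ↦ g' y)) x := hg' ⟨x, hx⟩
    have h2 : g =ᶠ[𝓝 x] g' := Filter.Germ.coe_eq.1 h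
    refine h1.congr ?_
    filter_upwards [W.isOpen.mem_nhds hx, h2] with y hy h3
    rw [h3]
    exact zeroExtend_apply (fun y : W ↦ g' y) ⟨y, hy⟩
  · intro h
    obtain ⟨W, hW, hWo, hx⟩ := eventually_nhds_iff.1 h.eventually
    refine ⟨⟨W, hWo⟩, g, hx, fun y ↦ (hW y.1 y.2).congr ?_, rfl⟩
    filter_upwards [hWo.mem_nhds y.2] with z hz
    exact (zeroExtend_apply (X := (KN π D).space) (W := ⟨W, hWo⟩) (fun y ↦ g y.1) ⟨z, hz⟩).symm

/-- The functions whose germs at `x` are basic functions. -/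
inductive IsLocalCoord (x : KNPoint π D) : (KNPoint π D → ℝ) → Prop
  | re (s : stalk x.pt) (c : KNPoint π D → ℂ) : evalGerm x s = c →
      IsLocalCoord x fun y ↦ (c y).re
  | im (s : stalk x.pt) (c : KNPoint π D → ℂ) : evalGerm x s = c →
      IsLocalCoord x fun y ↦ (c y).im
  | abs (m : stalkM D x.pt) (c : KNPoint π D → ℂ) : evalGerm x m = c →
      IsLocalCoord x fun y ↦ ‖c y‖
  | cos (m : stalkM D x.pt) (c : KNPoint π D → ℂ) : argGerm x m = c →
      IsLocalCoord x fun y ↦ (c y).re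
  | sin (m : stalkM D x.pt) (c : KNPoint π D → ℂ) : argGerm x m = c →
      IsLocalCoord x fun y ↦ (c y).im

theorem IsCoordinate.exists_isLocalCoord {x : KNPoint π D} {U : Y.Etale} (u : Lift x.pt U)
    {e : KNOver π D U → ℝ} (he : IsCoordinate U e) :
    ∃ c, IsLocalCoord x c ∧ ∀ᶠ y in 𝓝 (⟨x, u⟩ : KNOver π D U), c y.pt = e y := by
  cases he with
  | re f =>
    obtain ⟨c, hc⟩ := KNOver.exists_descend u fun y ↦ y.lift.eval f
    exact ⟨_, .re (u.germ f) c (evalGerm_eq_iff.2 hc), hc.mono fun y hy ↦ by rw [hy]⟩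
  | im f =>
    obtain ⟨c, hc⟩ := KNOver.exists_descend u fun y ↦ y.lift.eval f
    exact ⟨_, .im (u.germ f) c (evalGerm_eq_iff.2 hc), hc.mono fun y hy ↦ by rw [hy]⟩
  | abs m =>
    obtain ⟨c, hc⟩ := KNOver.exists_descend u fun y ↦ y.lift.eval m.1
    exact ⟨_, .abs (u.germM D m) c (evalGerm_eq_iff.2 hc), hc.mono fun y hy ↦ by rw [hy]⟩
  | cos m =>
    obtain ⟨c, hc⟩ := KNOver.exists_descend u fun y ↦ (y.pt.arg (y.lift.germM D m) : ℂ)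
    exact ⟨_, .cos (u.germM D m) c (argGerm_eq_iff.2 hc), hc.mono fun y hy ↦ by rw [hy]⟩
  | sin m =>
    obtain ⟨c, hc⟩ := KNOver.exists_descend u fun y ↦ (y.pt.arg (y.lift.germM D m) : ℂ)
    exact ⟨_, .sin (u.germM D m) c (argGerm_eq_iff.2 hc), hc.mono fun y hy ↦ by rw [hy]⟩

theorem IsCoordinate.smoothAt {x : KNPoint π D} {U : Y.Etale} {u : Lift x.pt U}
    {e : KNOver π D U → ℝ} (he : IsCoordinate U e) {c : KNPoint π D → ℝ}
    (hc : ∀ᶠ y in 𝓝 (⟨x, u⟩ : KNOver π D U), c y.pt = e y) : KNSmoothAt c x :=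
  ⟨U, u, Unit, inferInstance, fun _ ↦ e, fun z ↦ z (), fun _ ↦ he, contDiff_apply ℝ ℝ (), hc⟩

theorem IsLocalCoord.smoothAt {x : KNPoint π D} {c : KNPoint π D → ℝ} (hc : IsLocalCoord x c) :
    KNSmoothAt c x := by
  cases hc with
  | re s c hc =>
    obtain ⟨U, u, f, rfl⟩ := Lift.germ_surjective s
    exact (IsCoordinate.re f).smoothAt ((evalGerm_eq_iff.1 hc).mono fun y hy ↦ by rw [hy])
  | im s c hc =>
    obtain ⟨U, u, f, rfl⟩ := Lift.germ_surjective s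
    exact (IsCoordinate.im f).smoothAt ((evalGerm_eq_iff.1 hc).mono fun y hy ↦ by rw [hy])
  | abs m c hc =>
    obtain ⟨U, u, m, rfl⟩ := exists_germM_eq m
    exact (IsCoordinate.abs m).smoothAt ((evalGerm_eq_iff (u := u) (f := m.1)).1 hc |>.mono
      fun y hy ↦ by rw [hy])
  | cos m c hc =>
    obtain ⟨U, u, m, rfl⟩ := exists_germM_eq m
    exact (IsCoordinate.cos m).smoothAt ((argGerm_eq_iff.1 hc).mono fun y hy ↦ by rw [hy])
  | sin m c hc =>
    obtain ⟨U, u, m, rfl⟩ := exists_germM_eq m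
    exact (IsCoordinate.sin m).smoothAt ((argGerm_eq_iff.1 hc).mono fun y hy ↦ by rw [hy])

/-- Smooth functions are smooth functions of local coordinates. -/
theorem KNSmoothAt.exists_eq {g : KNPoint π D → ℝ} {x : KNPoint π D} (hg : KNSmoothAt g x) :
    ∃ (ι : Type) (_ : Fintype ι) (c : ι → KNPoint π D → ℝ) (F : (ι → ℝ) → ℝ),
      (∀ i, IsLocalCoord x (c i)) ∧ ContDiff ℝ ∞ F ∧ g =ᶠ[𝓝 x] (fun y ↦ F fun i ↦ c i y) ∧
      ∀ G : (ι → ℝ) → ℝ, ContDiff ℝ ∞ G → KNSmoothAt (fun y ↦ G fun i ↦ c i y) x := by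
  obtain ⟨U, u, ι, _, e, F, he, hF, H⟩ := hg
  choose c hc hce using fun i ↦ (he i).exists_isLocalCoord u
  have hall := Filter.eventually_all.2 hce
  refine ⟨ι, inferInstance, c, F, hc, hF, ?_, fun G hG ↦ ⟨U, u, ι, inferInstance, e, G, he, hG, ?_⟩⟩
  · refine (KNOver.eventually_pt u).1 ?_
    filter_upwards [H, hall] with y h1 h2
    rw [h1]
    simp only [h2]
  · filter_upwards [hall] with y h2
    simp only [h2]

variable (π D) in
abbrev KNTangent (x : KNPoint π D) : Type := (KN π D).tangentSpace x

open Classical in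
/-- The derivative of a function along a tangent vector, zero if the function is not smooth. -/
def KNTangent.d {x : KNPoint π D} (v : KNTangent π D x) (g : KNPoint π D → ℝ) : ℝ :=
  if h : KNSmoothAt g x then v.1 ⟨KNGerm x g, mem_smoothGerms_iff.2 h⟩ else 0

theorem KNTangent.d_eq {x : KNPoint π D} (v : KNTangent π D x) {g : KNPoint π D → ℝ}
    (hg : KNGerm (π := π) (D := D) x g ∈ (KN π D).smoothGerms x) : v.d g = v.1 ⟨KNGerm x g, hg⟩ :=
  dif_pos (mem_smoothGerms_iff.1 hg)

theorem KNTangent.exists_eq_d {x : KNPoint π D} (γ : (KN π D).smoothGerms x) :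
    ∃ g : KNPoint π D → ℝ, KNSmoothAt g x ∧ γ.1 = KNGerm x g ∧
      ∀ v : KNTangent π D x, v.1 γ = v.d g := by
  obtain ⟨γ, W, g, hx, hg, rfl⟩ := γ
  have h : KNSmoothAt g x := mem_smoothGerms_iff.1 ⟨W, g, hx, hg, rfl⟩
  exact ⟨g, h, rfl, fun v ↦ (v.d_eq (mem_smoothGerms_iff.2 h)).symm⟩

theorem KNTangent.ext_d {x : KNPoint π D} {v w : KNTangent π D x}
    (h : ∀ g, KNSmoothAt g x → v.d g = w.d g) : v = w := by
  refine Subtype.ext (funext fun γ ↦ ?_)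
  obtain ⟨g, hg, -, hv⟩ := KNTangent.exists_eq_d γ
  rw [hv, hv, h g hg]

theorem KNTangent.d_congr {x : KNPoint π D} (v : KNTangent π D x) {g h : KNPoint π D → ℝ}
    (hgh : g =ᶠ[𝓝 x] h) : v.d g = v.d h := by
  by_cases hg : KNSmoothAt g x
  · rw [v.d_eq (mem_smoothGerms_iff.2 hg), v.d_eq (mem_smoothGerms_iff.2 (hg.congr hgh))]
    exact congrArg v.1 (Subtype.ext (Filter.Germ.coe_eq.2 hgh))
  · rw [KNTangent.d, KNTangent.d, dif_neg hg, dif_neg fun hh ↦ hg (hh.congr hgh.symm)]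

theorem KNTangent.d_add {x : KNPoint π D} (v : KNTangent π D x) {g h : KNPoint π D → ℝ}
    (hg : KNSmoothAt g x) (hh : KNSmoothAt h x) : v.d (g + h) = v.d g + v.d h := by
  rw [v.d_eq (mem_smoothGerms_iff.2 (hg.add hh)), v.d_eq (mem_smoothGerms_iff.2 hg),
    v.d_eq (mem_smoothGerms_iff.2 hh)]
  exact v.2.1 ⟨_, mem_smoothGerms_iff.2 hg⟩ ⟨_, mem_smoothGerms_iff.2 hh⟩

theorem KNTangent.d_mul {x : KNPoint π D} (v : KNTangent π D x) {g h : KNPoint π D → ℝ}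
    (hg : KNSmoothAt g x) (hh : KNSmoothAt h x) : v.d (g * h) = g x * v.d h + h x * v.d g := by
  rw [v.d_eq (mem_smoothGerms_iff.2 (hg.mul hh)), v.d_eq (mem_smoothGerms_iff.2 hg),
    v.d_eq (mem_smoothGerms_iff.2 hh)]
  exact v.2.2.2 ⟨_, mem_smoothGerms_iff.2 hg⟩ ⟨_, mem_smoothGerms_iff.2 hh⟩

theorem KNTangent.d_const {x : KNPoint π D} (v : KNTangent π D x) (c : ℝ) :
    v.d (fun _ ↦ c) = 0 := by
  rw [v.d_eq (mem_smoothGerms_iff.2 (KNSmoothAt.const c x))]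
  exact v.2.2.1 c

theorem KNTangent.d_vadd {x : KNPoint π D} (v w : KNTangent π D x) (g : KNPoint π D → ℝ) :
    (v + w).d g = v.d g + w.d g := by
  by_cases hg : KNSmoothAt g x
  · simp only [KNTangent.d, dif_pos hg]
    rfl
  · simp only [KNTangent.d, dif_neg hg, add_zero]

theorem KNTangent.d_smul {x : KNPoint π D} (a : ℝ) (v : KNTangent π D x) (g : KNPoint π D → ℝ) :
    (a • v).d g = a * v.d g := by
  by_cases hg : KNSmoothAt g x
  · simp only [KNTangent.d, dif_pos hg]
    rfl
  · simp only [KNTangent.d, dif_neg hg, mul_zero]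

theorem KNTangent.d_zero {x : KNPoint π D} (g : KNPoint π D → ℝ) : (0 : KNTangent π D x).d g = 0 := by
  by_cases hg : KNSmoothAt g x
  · simp only [KNTangent.d, dif_pos hg]
    rfl
  · simp only [KNTangent.d, dif_neg hg]

theorem KNSmoothAt.sum {ι : Type*} (s : Finset ι) {f : ι → KNPoint π D → ℝ} {x : KNPoint π D}
    (h : ∀ i ∈ s, KNSmoothAt (f i) x) : KNSmoothAt (∑ i ∈ s, f i) x := by
  classical
  induction s using Finset.induction_on with
  | empty => exact KNSmoothAt.const 0 x
  | insert i s hi ih =>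
    rw [Finset.sum_insert hi]
    exact (h i (Finset.mem_insert_self i s)).add
      (ih fun j hj ↦ h j (Finset.mem_insert_of_mem hj))

theorem KNTangent.d_sum {ι : Type*} (s : Finset ι) {f : ι → KNPoint π D → ℝ} {x : KNPoint π D}
    (v : KNTangent π D x) (h : ∀ i ∈ s, KNSmoothAt (f i) x) :
    v.d (∑ i ∈ s, f i) = ∑ i ∈ s, v.d (f i) := by
  classical
  induction s using Finset.induction_on with
  | empty => exact v.d_const 0
  | insert i s hi ih =>
    have hs : ∀ j ∈ s, KNSmoothAt (f j) x := fun j hj ↦ h j (Finset.mem_insert_of_mem hj)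
    rw [Finset.sum_insert hi, Finset.sum_insert hi,
      v.d_add (h i (Finset.mem_insert_self i s)) (KNSmoothAt.sum s hs), ih hs]

/-- A tangent vector is determined by the derivatives of the local coordinates. -/
theorem KNTangent.eq_zero {x : KNPoint π D} {v : KNTangent π D x}
    (h : ∀ c, IsLocalCoord x c → v.d c = 0) : v = 0 := by
  refine KNTangent.ext_d fun g hg ↦ ?_
  rw [KNTangent.d_zero]
  obtain ⟨ι, _, c, F, hc, hF, hgF, hG⟩ := hg.exists_eq
  -- Hadamard's lemma at the coordinates of `x` writes `g` as a constant plus terms `(c_i - c_i(x))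
  -- G_i`, whose derivatives are multiples of those of the `c_i`.
  obtain ⟨G, hGd, hFG⟩ := exists_contDiff_eq_add_sum hF fun i ↦ c i x
  have hci (i) : KNSmoothAt (c i + fun _ ↦ -c i x) x := (hc i).smoothAt.add (.const _ x)
  have h1 : g =ᶠ[𝓝 x] (fun _ ↦ F fun i ↦ c i x) +
      ∑ i, (c i + fun _ ↦ -c i x) * fun y ↦ G i fun j ↦ c j y := by
    filter_upwards [hgF] with y hy
    rw [hy, hFG]
    simp [sub_eq_add_neg]
  rw [v.d_congr h1, v.d_add (.const _ x) (KNSmoothAt.sum _ fun i _ ↦ (hci i).mul (hG _ (hGd i))),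
    v.d_const, zero_add, v.d_sum _ fun i _ ↦ (hci i).mul (hG _ (hGd i))]
  refine Finset.sum_eq_zero fun i _ ↦ ?_
  rw [v.d_mul (hci i) (hG _ (hGd i)), v.d_add (hc i).smoothAt (.const _ x), h _ (hc i), v.d_const]
  simp

end SmoothGerms

/-! ### Absolute values, arguments, and the projection of tangent vectors to `Y` -/

section TangentVectors

variable {Y : Scheme.{0}} {π : Y ⟶ Spec (.of ℂ)} {D : Y.IdealSheafData}

theorem KNPoint.arg_mul_norm (x : KNPoint π D) (m : stalkM D x.pt) :
    (x.arg m : ℂ) * ‖stalkEval x.pt m‖ = stalkEval x.pt m := by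
  by_cases h : stalkEval x.pt m = 0
  · rw [h, norm_zero, Complex.ofReal_zero, mul_zero]
  · exact x.arg_unit m (isUnit_stalk_iff.2 h)

/-- A function with germ `evalGerm x s`. -/
def evalRep (x : KNPoint π D) (s : stalk x.pt) : KNPoint π D → ℂ :=
  (Quotient.exists_rep (evalGerm x s)).choose

theorem evalGerm_eq_rep (x : KNPoint π D) (s : stalk x.pt) : evalGerm x s = evalRep x s :=
  (Quotient.exists_rep (evalGerm x s)).choose_spec.symm

theorem evalRep_eventuallyEq {x : KNPoint π D} {s : stalk x.pt} {c : KNPoint π D → ℂ}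
    (h : evalGerm x s = c) : evalRep x s =ᶠ[𝓝 x] c :=
  Filter.Germ.coe_eq.1 ((evalGerm_eq_rep x s).symm.trans h)

/-- A function with germ `argGerm x m`. -/
def argRep (x : KNPoint π D) (m : stalkM D x.pt) : KNPoint π D → ℂ :=
  (Quotient.exists_rep (argGerm x m)).choose

theorem argGerm_eq_rep (x : KNPoint π D) (m : stalkM D x.pt) : argGerm x m = argRep x m :=
  (Quotient.exists_rep (argGerm x m)).choose_spec.symm

theorem argRep_eventuallyEq {x : KNPoint π D} {m : stalkM D x.pt} {c : KNPoint π D → ℂ}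
    (h : argGerm x m = c) : argRep x m =ᶠ[𝓝 x] c :=
  Filter.Germ.coe_eq.1 ((argGerm_eq_rep x m).symm.trans h)

theorem evalRep_germ (x : KNPoint π D) {U : Y.Etale} (u : Lift x.pt U) (f : Γ(U.left, ⊤)) :
    ∀ᶠ y in 𝓝 (⟨x, u⟩ : KNOver π D U), evalRep x (u.germ f) y.pt = y.lift.eval f :=
  evalGerm_eq_iff.1 (evalGerm_eq_rep x (u.germ f))

theorem argRep_germM (x : KNPoint π D) {U : Y.Etale} (u : Lift x.pt U)
    (m : logSections Y (divisorCompl D) U) : ∀ᶠ y in 𝓝 (⟨x, u⟩ : KNOver π D U),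
      argRep x (u.germM D m) y.pt = y.pt.arg (y.lift.germM D m) :=
  argGerm_eq_iff.1 (argGerm_eq_rep x (u.germM D m))

theorem evalRep_self (x : KNPoint π D) (s : stalk x.pt) : evalRep x s x = stalkEval x.pt s := by
  obtain ⟨U, u, f, rfl⟩ := Lift.germ_surjective s
  rw [stalkEval_germ]
  exact (evalRep_germ x u f).self_of_nhds

theorem argRep_self (x : KNPoint π D) (m : stalkM D x.pt) : argRep x m x = x.arg m := by
  obtain ⟨U, u, m, rfl⟩ := exists_germM_eq m
  exact (argRep_germM x u m).self_of_nhds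

theorem evalRep_mul (x : KNPoint π D) (s t : stalk x.pt) :
    evalRep x (s * t) =ᶠ[𝓝 x] evalRep x s * evalRep x t :=
  evalRep_eventuallyEq (by rw [map_mul, evalGerm_eq_rep, evalGerm_eq_rep]; rfl)

theorem evalRep_add (x : KNPoint π D) (s t : stalk x.pt) :
    evalRep x (s + t) =ᶠ[𝓝 x] evalRep x s + evalRep x t :=
  evalRep_eventuallyEq (by rw [map_add, evalGerm_eq_rep, evalGerm_eq_rep]; rfl)

theorem argRep_mul (x : KNPoint π D) (m n : stalkM D x.pt) :
    argRep x (m * n) =ᶠ[𝓝 x] argRep x m * argRep x n :=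
  argRep_eventuallyEq (by rw [argGerm_mul, argGerm_eq_rep, argGerm_eq_rep]; rfl)

theorem argRep_props (x : KNPoint π D) (m : stalkM D x.pt) :
    ∀ᶠ y in 𝓝 x, ‖argRep x m y‖ = 1 ∧ argRep x m y * ‖evalRep x m y‖ = evalRep x m y := by
  obtain ⟨U, u, m, rfl⟩ := exists_germM_eq m
  rw [← KNOver.eventually_pt u]
  filter_upwards [evalRep_germ x u m.1, argRep_germM x u m] with y h1 h2
  have h3 : evalRep x (u.germM D m : stalkM D x.pt) y.pt = y.lift.eval m.1 := h1
  rw [h2, h3]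
  refine ⟨Circle.norm_coe _, ?_⟩
  have := y.pt.arg_mul_norm (y.lift.germM D m)
  have h4 : stalkEval y.pt.pt (y.lift.germM D m : stalkM D y.pt.pt) = y.lift.eval m.1 :=
    stalkEval_germ _ _
  rwa [h4] at this

theorem evalRep_constSection (x : KNPoint π D) {U : Y.Etale} (u : Lift x.pt U) (c : ℂ) :
    evalRep x (u.germ (constSection π U c)) =ᶠ[𝓝 x] fun _ ↦ c :=
  evalRep_eventuallyEq (evalGerm_eq_iff.2 (.of_forall fun y ↦
    (Lift.eval_constSection y.pt.pt_str y.lift c).symm))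

theorem smoothAt_evalRep_re (x : KNPoint π D) (s : stalk x.pt) :
    KNSmoothAt (fun y ↦ (evalRep x s y).re) x :=
  (IsLocalCoord.re s _ (evalGerm_eq_rep x s)).smoothAt

theorem smoothAt_evalRep_im (x : KNPoint π D) (s : stalk x.pt) :
    KNSmoothAt (fun y ↦ (evalRep x s y).im) x :=
  (IsLocalCoord.im s _ (evalGerm_eq_rep x s)).smoothAt

/-- The absolute value of a section of the log structure, near `x`. -/
def absRep (x : KNPoint π D) (m : stalkM D x.pt) : KNPoint π D → ℝ := fun y ↦ ‖evalRep x m y‖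

theorem smoothAt_absRep (x : KNPoint π D) (m : stalkM D x.pt) : KNSmoothAt (absRep x m) x :=
  (IsLocalCoord.abs m _ (evalGerm_eq_rep x m)).smoothAt

theorem absRep_self (x : KNPoint π D) (m : stalkM D x.pt) :
    absRep x m x = ‖stalkEval x.pt m‖ := by rw [absRep, evalRep_self]

theorem absRep_mul (x : KNPoint π D) (m n : stalkM D x.pt) :
    absRep x (m * n) =ᶠ[𝓝 x] absRep x m * absRep x n := by
  filter_upwards [evalRep_mul x m n] with y hy
  exact (congrArg norm hy).trans (norm_mul _ _)

theorem smoothAt_argRep_re (x : KNPoint π D) (m : stalkM D x.pt) :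
    KNSmoothAt (fun y ↦ (argRep x m y).re) x :=
  (IsLocalCoord.cos m _ (argGerm_eq_rep x m)).smoothAt

theorem smoothAt_argRep_im (x : KNPoint π D) (m : stalkM D x.pt) :
    KNSmoothAt (fun y ↦ (argRep x m y).im) x :=
  (IsLocalCoord.sin m _ (argGerm_eq_rep x m)).smoothAt

/-- A complex function is smooth at `x`. -/
def KNSmoothAtC (c : KNPoint π D → ℂ) (x : KNPoint π D) : Prop :=
  KNSmoothAt (fun y ↦ (c y).re) x ∧ KNSmoothAt (fun y ↦ (c y).im) x

theorem smoothAt_evalRep (x : KNPoint π D) (s : stalk x.pt) : KNSmoothAtC (evalRep x s) x :=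
  ⟨smoothAt_evalRep_re x s, smoothAt_evalRep_im x s⟩

theorem smoothAt_argRep (x : KNPoint π D) (m : stalkM D x.pt) : KNSmoothAtC (argRep x m) x :=
  ⟨smoothAt_argRep_re x m, smoothAt_argRep_im x m⟩

theorem KNSmoothAt.ofReal {g : KNPoint π D → ℝ} {x : KNPoint π D} (h : KNSmoothAt g x) :
    KNSmoothAtC (fun y ↦ (g y : ℂ)) x := ⟨h, KNSmoothAt.const 0 x⟩

namespace KNTangent

variable {x : KNPoint π D} (v : KNTangent π D x)

/-- The derivative of a complex function along a tangent vector. -/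
def dC (c : KNPoint π D → ℂ) : ℂ := v.d (fun y ↦ (c y).re) + v.d (fun y ↦ (c y).im) * Complex.I

theorem dC_re (c : KNPoint π D → ℂ) : (v.dC c).re = v.d fun y ↦ (c y).re := by simp [dC]

theorem dC_im (c : KNPoint π D → ℂ) : (v.dC c).im = v.d fun y ↦ (c y).im := by simp [dC]

theorem dC_congr {c c' : KNPoint π D → ℂ} (h : c =ᶠ[𝓝 x] c') : v.dC c = v.dC c' := by
  have h1 : v.d (fun y ↦ (c y).re) = v.d fun y ↦ (c' y).re := v.d_congr (h.fun_comp Complex.re)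
  have h2 : v.d (fun y ↦ (c y).im) = v.d fun y ↦ (c' y).im := v.d_congr (h.fun_comp Complex.im)
  rw [dC, dC, h1, h2]

theorem dC_const (c : ℂ) : v.dC (fun _ ↦ c) = 0 := by simp [dC, v.d_const]

theorem dC_ofReal (g : KNPoint π D → ℝ) : v.dC (fun y ↦ (g y : ℂ)) = v.d g := by
  have h : v.d (fun y ↦ ((g y : ℂ)).im) = 0 := v.d_const 0
  rw [dC, h]
  simp

theorem dC_add {c c' : KNPoint π D → ℂ} (hc : KNSmoothAtC c x) (hc' : KNSmoothAtC c' x) :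
    v.dC (c + c') = v.dC c + v.dC c' := by
  have h1 : v.d (fun y ↦ ((c + c') y).re) = _ := v.d_add hc.1 hc'.1
  have h2 : v.d (fun y ↦ ((c + c') y).im) = _ := v.d_add hc.2 hc'.2
  rw [dC, h1, h2, dC, dC]
  push_cast
  ring

theorem neg_smoothAt {g : KNPoint π D → ℝ} (h : KNSmoothAt g x) :
    KNSmoothAt ((fun _ ↦ -1) * g) x := (KNSmoothAt.const (-1) x).mul h

theorem d_neg {g : KNPoint π D → ℝ} (h : KNSmoothAt g x) : v.d ((fun _ ↦ -1) * g) = -v.d g := by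
  rw [v.d_mul (.const _ x) h, v.d_const]
  simp

theorem dC_mul {c c' : KNPoint π D → ℂ} (hc : KNSmoothAtC c x) (hc' : KNSmoothAtC c' x) :
    v.dC (c * c') = c x * v.dC c' + c' x * v.dC c := by
  have h1 : v.d (fun y ↦ ((c * c') y).re) =
      ((c x).re * v.d (fun y ↦ (c' y).re) + (c' x).re * v.d fun y ↦ (c y).re) -
        ((c x).im * v.d (fun y ↦ (c' y).im) + (c' x).im * v.d fun y ↦ (c y).im) := by
    rw [← v.d_mul hc.1 hc'.1, ← v.d_mul hc.2 hc'.2, sub_eq_add_neg,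
      ← v.d_neg (hc.2.mul hc'.2), ← v.d_add (hc.1.mul hc'.1) (neg_smoothAt (hc.2.mul hc'.2))]
    congr 1
    funext y
    simp [sub_eq_add_neg]
  have h2 : v.d (fun y ↦ ((c * c') y).im) =
      ((c x).re * v.d (fun y ↦ (c' y).im) + (c' x).im * v.d fun y ↦ (c y).re) +
        ((c x).im * v.d (fun y ↦ (c' y).re) + (c' x).re * v.d fun y ↦ (c y).im) := by
    rw [← v.d_mul hc.1 hc'.2, ← v.d_mul hc.2 hc'.1, ← v.d_add (hc.1.mul hc'.2) (hc.2.mul hc'.1)]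
    rfl
  apply Complex.ext
  · rw [dC_re, h1]
    simp only [Complex.add_re, Complex.mul_re, dC_re, dC_im]
    ring
  · rw [dC_im, h2]
    simp only [Complex.add_im, Complex.mul_im, dC_re, dC_im]
    ring

/-- The image of a tangent vector under the projection to `Y`. -/
def proj : algTangent π x.pt where
  val s := v.dC (evalRep x s)
  property := by
    refine ⟨fun f g ↦ ?_, fun U u c ↦ ?_, fun f g ↦ ?_⟩
    · exact (v.dC_congr (evalRep_add x f g)).trans
        (v.dC_add (smoothAt_evalRep x f) (smoothAt_evalRep x g))
    · exact (v.dC_congr (evalRep_constSection x u c)).trans (v.dC_const c)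
    · refine (v.dC_congr (evalRep_mul x f g)).trans ?_
      rw [v.dC_mul (smoothAt_evalRep x f) (smoothAt_evalRep x g), evalRep_self, evalRep_self]

theorem proj_apply (s : stalk x.pt) : v.proj.1 s = v.dC (evalRep x s) := rfl

/-- The auxiliary function `c` in the relation is determined as a germ by `f`, so the relation is
the graph of `proj`. -/
theorem isDifferential_iff {t : algTangent π x.pt} : IsDifferential x v t ↔ t = v.proj := by
  have key (s : stalk x.pt) (c : KNPoint π D → ℂ) (hc : evalGerm x s = c)
      (hre : KNGerm (π := π) (D := D) x (fun y ↦ (c y).re) ∈ (KN π D).smoothGerms x)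
      (him : KNGerm (π := π) (D := D) x (fun y ↦ (c y).im) ∈ (KN π D).smoothGerms x) :
      v.proj.1 s = (v.1 ⟨_, hre⟩ : ℂ) + (v.1 ⟨_, him⟩ : ℂ) * Complex.I := by
    rw [← v.d_eq hre, ← v.d_eq him, proj_apply, v.dC_congr (evalRep_eventuallyEq hc)]
    rfl
  constructor
  · intro h
    refine Subtype.ext (funext fun s ↦ ?_)
    obtain ⟨U, u, f, rfl⟩ := Lift.germ_surjective s
    obtain ⟨c, hc, hre, him, h⟩ := h U u f
    rw [h, key _ c (evalGerm_eq_iff.2 hc) hre him]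
  · rintro rfl U u f
    exact ⟨_, evalRep_germ x u f, mem_smoothGerms_iff.2 (smoothAt_evalRep_re x _),
      mem_smoothGerms_iff.2 (smoothAt_evalRep_im x _), key _ _ (evalGerm_eq_rep x _) _ _⟩

theorem d_absRep_mul (m n : stalkM D x.pt) : v.d (absRep x (m * n)) =
    ‖stalkEval x.pt m‖ * v.d (absRep x n) + ‖stalkEval x.pt n‖ * v.d (absRep x m) := by
  rw [v.d_congr (absRep_mul x m n), v.d_mul (smoothAt_absRep x m) (smoothAt_absRep x n),
    absRep_self, absRep_self]

theorem dC_argRep_mul (m n : stalkM D x.pt) : v.dC (argRep x (m * n)) =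
    x.arg m * v.dC (argRep x n) + x.arg n * v.dC (argRep x m) := by
  rw [v.dC_congr (argRep_mul x m n), v.dC_mul (smoothAt_argRep x m) (smoothAt_argRep x n),
    argRep_self, argRep_self]

/-- Leibniz rule for `m = arg m · |m|`. Where `m` vanishes only the first term remains; this is the
correspondence of `∂_r` with `arg · ∂_z`. -/
theorem proj_eq (m : stalkM D x.pt) : v.proj.1 m =
    x.arg m * v.d (absRep x m) + ‖stalkEval x.pt m‖ * v.dC (argRep x m) := by
  have h : evalRep x m =ᶠ[𝓝 x] argRep x m * fun y ↦ (absRep x m y : ℂ) := by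
    filter_upwards [argRep_props x m] with y hy
    exact hy.2.symm
  rw [proj_apply, v.dC_congr h, v.dC_mul (smoothAt_argRep x m) (smoothAt_absRep x m).ofReal,
    v.dC_ofReal, argRep_self, absRep_self]

/-- The derivative of `|arg m|² = 1`. -/
theorem re_conj_mul_dC_argRep (m : stalkM D x.pt) :
    (starRingEnd ℂ (x.arg m) * v.dC (argRep x m)).re = 0 := by
  have h : (fun y ↦ (argRep x m y).re) * (fun y ↦ (argRep x m y).re) +
      (fun y ↦ (argRep x m y).im) * (fun y ↦ (argRep x m y).im) =ᶠ[𝓝 x] fun _ ↦ 1 := by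
    filter_upwards [argRep_props x m] with y hy
    have := Complex.normSq_eq_norm_sq (argRep x m y)
    rw [hy.1, Complex.normSq_apply] at this
    simpa using this
  have h1 := v.d_congr h
  have hr := smoothAt_argRep_re x m
  have hi := smoothAt_argRep_im x m
  rw [v.d_add (hr.mul hr) (hi.mul hi), v.d_mul hr hr, v.d_mul hi hi, v.d_const, argRep_self] at h1
  simp only [Complex.mul_re, Complex.conj_re, Complex.conj_im, dC_re, dC_im]
  linarith

/-- The derivatives at a unit are determined by the projection. -/
theorem d_unit_eq_zero {m : stalkM D x.pt} (hm : stalkEval x.pt m ≠ 0) (h : v.proj.1 m = 0) :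
    v.d (absRep x m) = 0 ∧ v.dC (argRep x m) = 0 := by
  have h1 := v.proj_eq m
  have h2 := v.re_conj_mul_dC_argRep m
  have h3 : starRingEnd ℂ (x.arg m) * (x.arg m : ℂ) = 1 := by
    rw [mul_comm, Complex.mul_conj, Circle.normSq_coe, Complex.ofReal_one]
  -- After multiplication by the conjugate of `arg m` the radial term is real and the angular term
  -- is purely imaginary, so the real part isolates the radial derivative.
  have h4 : (v.d (absRep x m) : ℂ) +
      ‖stalkEval x.pt m‖ * (starRingEnd ℂ (x.arg m) * v.dC (argRep x m)) = 0 := by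
    calc _ = starRingEnd ℂ (x.arg m) * (x.arg m * v.d (absRep x m) +
          ‖stalkEval x.pt m‖ * v.dC (argRep x m)) := by
          linear_combination (-(v.d (absRep x m) : ℂ)) * h3
      _ = 0 := by rw [← h1, h, mul_zero]
  have h5 : v.d (absRep x m) = 0 := by
    have := congrArg Complex.re h4
    rw [Complex.add_re, Complex.re_ofReal_mul, h2] at this
    simpa using this
  refine ⟨h5, ?_⟩
  rw [h, h5, Complex.ofReal_zero, mul_zero, zero_add] at h1
  exact (mul_eq_zero.1 h1.symm).resolve_left (by simpa using hm)

end KNTangent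

/-- Induction on sections of the log structure. -/
theorem Chart.stalkM_induction {p : Spec (.of ℂ) ⟶ Y} (c : Chart π D p) (hp : p ≫ π = 𝟙 _)
    {P : stalkM D p → Prop} (hunit : ∀ m : stalkM D p, IsUnit (m : stalk p) → P m)
    (hgen : ∀ i, P (c.m i)) (hmul : ∀ m n, P m → P n → P (m * n)) (m : stalkM D p) : P m := by
  obtain ⟨b, a, hb, hm⟩ := c.exists_monomial hp m
  let b' : stalkM D p := ⟨b, mem_stalkM_of_isUnit hb⟩
  have h1 : P 1 := hunit 1 isUnit_one
  have hm' : m = b' * ∏ i : c.S₀, c.m i ^ a i := by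
    refine Subtype.ext ?_
    rw [hm, Submonoid.coe_mul, Submonoid.coe_finsetProd, ← Finset.prod_coe_sort]
    rfl
  rw [hm']
  refine hmul _ _ (hunit b' hb) (Finset.prod_induction _ P hmul h1 fun i _ ↦ ?_)
  generalize a i = k
  induction k with
  | zero => rw [pow_zero]; exact h1
  | succ k ih => rw [pow_succ]; exact hmul _ _ ih (hgen i)

/-- The derivatives of `r_i`, `arg g_i` and the remaining coordinates determine the projection to
`Y`, hence the derivatives at units; multiplicativity extends this to all sections, and the basic
functions determine the vector. -/
theorem Chart.knTangent_eq_zero {x : KNPoint π D} (c : Chart π D x.pt) (v : KNTangent π D x)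
    (habs : ∀ i, v.d (absRep x (c.m i)) = 0) (harg : ∀ i, v.dC (argRep x (c.m i)) = 0)
    (hg : ∀ i ∉ c.S₀, v.proj.1 (c.g i) = 0) : v = 0 := by
  have hproj : v.proj = 0 := by
    refine c.tangent_eq_zero _ fun i ↦ ?_
    by_cases hi : i ∈ c.S₀
    · have := v.proj_eq (c.m ⟨i, hi⟩)
      rwa [habs, harg, Complex.ofReal_zero, mul_zero, mul_zero, add_zero] at this
    · exact hg i hi
  have hproj (s : stalk x.pt) : v.dC (evalRep x s) = 0 := by
    rw [← v.proj_apply, hproj]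
    rfl
  have hM (m : stalkM D x.pt) : v.d (absRep x m) = 0 ∧ v.dC (argRep x m) = 0 := by
    refine c.stalkM_induction x.pt_str
      (P := fun m ↦ v.d (absRep x m) = 0 ∧ v.dC (argRep x m) = 0) (fun m hm ↦ ?_)
      (fun i ↦ ⟨habs i, harg i⟩) (fun m n hm hn ↦ ?_) m
    · exact v.d_unit_eq_zero (isUnit_stalk_iff.1 hm) (hproj m)
    · rw [v.d_absRep_mul, v.dC_argRep_mul, hm.1, hm.2, hn.1, hn.2]
      simp
  refine KNTangent.eq_zero fun c hc ↦ ?_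
  cases hc with
  | re s c hc => rw [← v.dC_re, ← v.dC_congr (evalRep_eventuallyEq hc), hproj, Complex.zero_re]
  | im s c hc => rw [← v.dC_im, ← v.dC_congr (evalRep_eventuallyEq hc), hproj, Complex.zero_im]
  | abs m c hc =>
    rw [← (hM m).1]
    exact (v.d_congr ((evalRep_eventuallyEq hc).fun_comp norm)).symm
  | cos m c hc =>
    rw [← v.dC_re, ← v.dC_congr (argRep_eventuallyEq hc), (hM m).2, Complex.zero_re]
  | sin m c hc =>
    rw [← v.dC_im, ← v.dC_congr (argRep_eventuallyEq hc), (hM m).2, Complex.zero_im]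

end TangentVectors

/-! ### One-sided arcs in the Kato–Nakayama space -/

section KNArcs

variable {Y : Scheme.{0}} {π : Y ⟶ Spec (.of ℂ)} {D : Y.IdealSheafData}

/-- Arcs into a space with corners are controlled only for `t > 0`; the right-hand side of `0`
already determines the derivative of a differentiable extension. -/
theorem deriv_eq_of_eventuallyEq_Ioi {E : Type*} [NormedAddCommGroup E] [NormedSpace ℝ E]
    {k k' : ℝ → E} (hk : DifferentiableAt ℝ k 0) (hk' : DifferentiableAt ℝ k' 0)
    (h : k =ᶠ[𝓝[>] 0] k') (h0 : k 0 = k' 0) : deriv k 0 = deriv k' 0 :=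
  (uniqueDiffWithinAt_Ioi (0 : ℝ)).eq_deriv _ hk.hasDerivAt.hasDerivWithinAt
    (hk'.hasDerivAt.hasDerivWithinAt.congr_of_eventuallyEq h h0)

/-- A one-sided differentiable arc in the Kato--Nakayama space. -/
structure KNArc (x : KNPoint π D) where
  γ : ℝ → KNPoint π D
  tendsto : Filter.Tendsto γ (𝓝[>] 0) (𝓝 x)
  diff (g : KNPoint π D → ℝ) : KNSmoothAt g x → ∃ k : ℝ → ℝ, DifferentiableAt ℝ k 0 ∧ k 0 = g x ∧
    ∀ᶠ t in 𝓝[>] 0, g (γ t) = k t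

namespace KNArc

variable {x : KNPoint π D} (A : KNArc x)

theorem exists_rep (γ : (KN π D).smoothGerms x) : ∃ (g : KNPoint π D → ℝ) (k : ℝ → ℝ),
    KNSmoothAt g x ∧ γ.1 = KNGerm x g ∧ DifferentiableAt ℝ k 0 ∧ k 0 = g x ∧
      ∀ᶠ t in 𝓝[>] 0, g (A.γ t) = k t := by
  obtain ⟨g, hg, hγ, -⟩ := KNTangent.exists_eq_d γ
  obtain ⟨k, h⟩ := A.diff g hg
  exact ⟨g, k, hg, hγ, h⟩

/-- The derivative of a smooth germ along an arc. -/
def der (γ : (KN π D).smoothGerms x) : ℝ := deriv (A.exists_rep γ).choose_spec.choose 0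

theorem der_eq {γ : (KN π D).smoothGerms x} {g : KNPoint π D → ℝ} {k : ℝ → ℝ}
    (hγ : γ.1 = KNGerm x g) (hk : DifferentiableAt ℝ k 0) (h0 : k 0 = g x)
    (h : ∀ᶠ t in 𝓝[>] 0, g (A.γ t) = k t) : A.der γ = deriv k 0 := by
  obtain ⟨-, h1, h2, h3, h4⟩ := (A.exists_rep γ).choose_spec.choose_spec
  have hg : (A.exists_rep γ).choose =ᶠ[𝓝 x] g := Filter.Germ.coe_eq.1 (h1.symm.trans hγ)
  refine deriv_eq_of_eventuallyEq_Ioi h2 hk ?_ ?_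
  · filter_upwards [h4, h, A.tendsto.eventually hg] with t h5 h6 h7
    rw [← h5, ← h6, h7]
  · rw [h3, h0]
    exact hg.self_of_nhds

/-- The velocity of an arc. -/
def velocity : KNTangent π D x where
  val := A.der
  property := by
    refine ⟨fun f g ↦ ?_, fun c ↦ ?_, fun f g ↦ ?_⟩
    · obtain ⟨a, k, -, hf, hk, hk0, h⟩ := A.exists_rep f
      obtain ⟨a', k', -, hg, hk', hk0', h'⟩ := A.exists_rep g
      rw [A.der_eq hf hk hk0 h, A.der_eq hg hk' hk0' h', ← deriv_add hk hk']
      refine A.der_eq (g := a + a') ?_ (hk.add hk') (congrArg₂ (· + ·) hk0 hk0') ?_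
      · exact congrArg₂ (· + ·) hf hg
      · filter_upwards [h, h'] with t h1 h2 using congrArg₂ (· + ·) h1 h2
    · rw [A.der_eq (g := fun _ ↦ c) (k := fun _ ↦ c) rfl (differentiableAt_const _) rfl
        (.of_forall fun _ ↦ rfl), deriv_const]
    · obtain ⟨a, k, -, hf, hk, hk0, h⟩ := A.exists_rep f
      obtain ⟨a', k', -, hg, hk', hk0', h'⟩ := A.exists_rep g
      have hfv : f.1.value = k 0 := by rw [hf, hk0]; rfl
      have hgv : g.1.value = k' 0 := by rw [hg, hk0']; rfl
      rw [A.der_eq hf hk hk0 h, A.der_eq hg hk' hk0' h', hfv, hgv,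
        A.der_eq (g := a * a') ?_ (hk.mul hk') (congrArg₂ (· * ·) hk0 hk0') ?_, deriv_mul hk hk']
      · ring
      · exact congrArg₂ (· * ·) hf hg
      · filter_upwards [h, h'] with t h1 h2 using congrArg₂ (· * ·) h1 h2

theorem velocity_d {g : KNPoint π D → ℝ} {k : ℝ → ℝ} (hg : KNSmoothAt g x)
    (hk : DifferentiableAt ℝ k 0) (h0 : k 0 = g x) (h : ∀ᶠ t in 𝓝[>] 0, g (A.γ t) = k t) :
    A.velocity.d g = deriv k 0 :=
  (A.velocity.d_eq (mem_smoothGerms_iff.2 hg)).trans (A.der_eq rfl hk h0 h)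

theorem velocity_dC {c : KNPoint π D → ℂ} {k : ℝ → ℂ} (hc : KNSmoothAtC c x)
    (hk : DifferentiableAt ℝ k 0) (h0 : k 0 = c x) (h : ∀ᶠ t in 𝓝[>] 0, c (A.γ t) = k t) :
    A.velocity.dC c = deriv k 0 := by
  have hre : HasDerivAt (fun t ↦ (k t).re) (deriv k 0).re 0 :=
    Complex.reCLM.hasFDerivAt.comp_hasDerivAt (0 : ℝ) hk.hasDerivAt
  have him : HasDerivAt (fun t ↦ (k t).im) (deriv k 0).im 0 :=
    Complex.imCLM.hasFDerivAt.comp_hasDerivAt (0 : ℝ) hk.hasDerivAt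
  rw [KNTangent.dC, A.velocity_d hc.1 hre.differentiableAt (by rw [h0])
    (h.mono fun t ht ↦ by rw [ht]), A.velocity_d hc.2 him.differentiableAt (by rw [h0])
    (h.mono fun t ht ↦ by rw [ht]), hre.deriv, him.deriv, Complex.re_add_im]

/-- A nonnegative function vanishing at `x` has nonnegative slopes along the arc for `t > 0`. -/
theorem velocity_nonneg : A.velocity ∈ (KN π D).nonnegTangent x := by
  intro γ hγ h0
  obtain ⟨g, k, -, hg, hk, hk0, h⟩ := A.exists_rep γ
  change 0 ≤ A.der γ
  rw [A.der_eq hg hk hk0 h]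
  have hg0 : ∀ᶠ y in 𝓝 x, 0 ≤ g y := by
    rw [hg] at hγ
    exact Filter.Germ.coe_le.1 hγ
  have hkz : k 0 = 0 := by
    rw [hk0, ← h0, hg]
    rfl
  have h1 : Filter.Tendsto (slope k 0) (𝓝[>] 0) (𝓝 (deriv k 0)) :=
    (hasDerivWithinAt_iff_tendsto_slope' (s := Set.Ioi 0) (by simp)).1
      hk.hasDerivAt.hasDerivWithinAt
  refine ge_of_tendsto h1 ?_
  filter_upwards [h, A.tendsto.eventually hg0, self_mem_nhdsWithin] with t h2 h3 h4
  rw [slope_def_field, hkz, sub_zero, sub_zero, ← h2]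
  exact div_nonneg h3 (le_of_lt h4)

end KNArc

theorem stalkEval_ne_zero {q : Spec (.of ℂ) ⟶ Y} (h : q default ∈ divisorCompl D)
    (m : stalkM D q) : stalkEval q m ≠ 0 := by
  obtain ⟨U, u, m, rfl⟩ := exists_germM_eq m
  have h1 : u.point ∈ U.hom ⁻¹ᵁ divisorCompl D := by
    change U.hom u.point ∈ divisorCompl D
    rwa [u.hom_point]
  have h2 := (u.point_mem_basicOpen m.1).1 (m.2 h1)
  rwa [← stalkEval_germ] at h2

/-- The direction of a nonzero complex number. -/
def direction (z : ℂ) (hz : z ≠ 0) : Circle :=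
  ⟨z / ‖z‖, mem_sphere_zero_iff_norm.2 (by
    rw [norm_div, Complex.norm_real, norm_norm, div_self (norm_ne_zero_iff.2 hz)])⟩

theorem direction_mul_norm (z : ℂ) (hz : z ≠ 0) : (direction z hz : ℂ) * ‖z‖ = z :=
  div_mul_cancel₀ z (by simpa using hz)

theorem Circle.eq_of_mul_norm {a b : Circle} {z : ℂ} (hz : z ≠ 0) (ha : (a : ℂ) * ‖z‖ = z)
    (hb : (b : ℂ) * ‖z‖ = z) : a = b :=
  Circle.ext (mul_right_cancel₀ (by simpa using hz) (ha.trans hb.symm))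

/-- The point of the Kato--Nakayama space over a point outside the divisor. -/
def KNPoint.ofCompl (q : Spec (.of ℂ) ⟶ Y) (hq : q ≫ π = 𝟙 _) (h : q default ∈ divisorCompl D) :
    KNPoint π D where
  pt := q
  pt_str := hq
  arg :=
    { toFun := fun m ↦ direction (stalkEval q m) (stalkEval_ne_zero h m)
      map_one' := by
        refine Circle.eq_of_mul_norm (stalkEval_ne_zero h 1) (direction_mul_norm _ _) ?_
        simp
      map_mul' := fun m n ↦ by
        refine Circle.eq_of_mul_norm (stalkEval_ne_zero h (m * n)) (direction_mul_norm _ _) ?_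
        rw [Submonoid.coe_mul, map_mul, norm_mul, Circle.coe_mul]
        have h1 := direction_mul_norm (stalkEval q m) (stalkEval_ne_zero h m)
        have h2 := direction_mul_norm (stalkEval q n) (stalkEval_ne_zero h n)
        push_cast
        calc _ = ((direction (stalkEval q m) (stalkEval_ne_zero h m) : ℂ) * ‖stalkEval q m‖) *
            ((direction (stalkEval q n) (stalkEval_ne_zero h n) : ℂ) * ‖stalkEval q n‖) := by ring
          _ = _ := by rw [h1, h2] }
  arg_unit m _ := direction_mul_norm _ (stalkEval_ne_zero h m)

open Classical in
/-- The point over `a` if `a` lies outside the divisor, otherwise `y`. -/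
def CPoint.toKN {V : Y.Etale} (a : CPoint π V) (y : KNOver π D V) : KNOver π D V :=
  if h : a.pt default ∈ divisorCompl D then ⟨KNPoint.ofCompl a.pt a.pt_str h, a.lift⟩ else y

theorem CPoint.toKN_map {V W : Y.Etale} (j : V ⟶ W) (a : CPoint π V) (y : KNOver π D V) :
    (a.toKN y).map j = (a.map j).toKN (y.map j) := by
  by_cases h : a.pt default ∈ divisorCompl D
  · have h' : (a.map j).pt default ∈ divisorCompl D := h
    rw [CPoint.toKN, CPoint.toKN, dif_pos h, dif_pos h']
    rfl
  · have h' : (a.map j).pt default ∉ divisorCompl D := h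
    rw [CPoint.toKN, CPoint.toKN, dif_neg h, dif_neg h']

theorem CPoint.toKN_eval {V : Y.Etale} {a : CPoint π V} (h : a.pt default ∈ divisorCompl D)
    (y : KNOver π D V) (f : Γ(V.left, ⊤)) : (a.toKN y).lift.eval f = a.lift.eval f := by
  rw [CPoint.toKN, dif_pos h]
  rfl

theorem CPoint.toKN_arg {V : Y.Etale} {a : CPoint π V} (h : a.pt default ∈ divisorCompl D)
    (y : KNOver π D V) (m : logSections Y (divisorCompl D) V) : a.lift.eval m.1 ≠ 0 ∧
      ((a.toKN y).pt.arg ((a.toKN y).lift.germM D m) : ℂ) * ‖a.lift.eval m.1‖ =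
        a.lift.eval m.1 := by
  rw [CPoint.toKN, dif_pos h]
  have h1 : stalkEval a.pt (a.lift.germM D m : stalkM D a.pt) = a.lift.eval m.1 :=
    stalkEval_germ _ _
  rw [← h1]
  exact ⟨stalkEval_ne_zero h _, direction_mul_norm _ (stalkEval_ne_zero h _)⟩

/-- The arc `A` leaves the divisor in such a way that absolute values and arguments of sections of
the log structure are differentiable along it, with the prescribed argument at `x`. -/
structure Arc.IsRegular (x : KNPoint π D) (A : Arc π x.pt) : Prop where
  off : ∀ᶠ t in 𝓝[>] 0, (A.l (Lift.self x.pt) t).pt default ∈ divisorCompl D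
  polar (m : stalkM D x.pt) : ∃ (a : ℝ → ℝ) (b : ℝ → ℂ), DifferentiableAt ℝ a 0 ∧
    DifferentiableAt ℝ b 0 ∧ a 0 = ‖stalkEval x.pt m‖ ∧ b 0 = x.arg m ∧
      ∀ᶠ t in 𝓝[>] 0, a t = ‖A.rep m t‖ ∧ b t * a t = A.rep m t

theorem Arc.eventually_pt_eq {p : Spec (.of ℂ) ⟶ Y} (A : Arc π p) {V : Y.Etale} (v : Lift p V) :
    ∀ᶠ t in 𝓝 0, (A.l v t).pt = (A.l (Lift.self p) t).pt := by
  let j : V ⟶ Scheme.Etale.mk (𝟙 Y) :=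
    MorphismProperty.Over.homMk V.hom (Category.comp_id _) (by trivial)
  have hj : v.map j = Lift.self p := Lift.ext_toHom v.toHom_comp
  filter_upwards [A.map j v] with t ht
  rw [hj] at ht
  rw [← ht]
  rfl

theorem Arc.rep_eventuallyEq {p : Spec (.of ℂ) ⟶ Y} (A : Arc π p) {s : stalk p} {h : ℝ → ℂ}
    (hs : A.germ s = h) : A.rep s =ᶠ[𝓝 0] h :=
  Filter.Germ.coe_eq.1 ((A.germ_eq_rep s).symm.trans hs)

namespace Arc.IsRegular

variable {x : KNPoint π D} {A : Arc π x.pt}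

theorem eventually_mem (hA : A.IsRegular x) {V : Y.Etale} (v : Lift x.pt V) :
    ∀ᶠ t in 𝓝[>] 0, (A.l v t).pt default ∈ divisorCompl D := by
  filter_upwards [hA.off, (A.eventually_pt_eq v).filter_mono nhdsWithin_le_nhds] with t h1 h2
  rwa [h2]

theorem eventually_arg (hA : A.IsRegular x) {V : Y.Etale} (v : Lift x.pt V) (m : logSections Y (divisorCompl D) V)
    {a : ℝ → ℝ} {b : ℝ → ℂ}
    (h : ∀ᶠ t in 𝓝[>] 0, a t = ‖A.rep (v.germM D m : stalkM D x.pt) t‖ ∧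
      b t * a t = A.rep (v.germM D m : stalkM D x.pt) t) :
    ∀ᶠ t in 𝓝[>] 0, ‖((A.l v t).toKN ⟨x, v⟩).lift.eval m.1‖ = a t ∧
      (((A.l v t).toKN ⟨x, v⟩).pt.arg (((A.l v t).toKN ⟨x, v⟩).lift.germM D m) : ℂ) = b t := by
  have h0 : A.germ (v.germM D m : stalkM D x.pt) = (fun t ↦ (A.l v t).lift.eval m.1 : ℝ → ℂ) :=
    A.germ_germ v m.1
  filter_upwards [h, hA.eventually_mem v,
    (A.rep_eventuallyEq h0).filter_mono nhdsWithin_le_nhds] with t ⟨h1, h2⟩ h3 h4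
  rw [h4] at h1 h2
  obtain ⟨h5, h6⟩ := CPoint.toKN_arg h3 ⟨x, v⟩ m
  refine ⟨by rw [CPoint.toKN_eval h3, h1], ?_⟩
  rw [h1] at h2
  exact mul_right_cancel₀ (by simpa using h5) (h6.trans h2.symm)

/-- Regular functions converge by continuity of the arc, and arguments converge to those of `x`
because polar decompositions extend continuously to `t = 0`. -/
theorem tendsto_coord (hA : A.IsRegular x) {V : Y.Etale} (v : Lift x.pt V) :
    Filter.Tendsto (fun t ↦ (A.l v t).toKN (D := D) ⟨x, v⟩) (𝓝[>] 0)
      (@nhds _ (coordTopology V) ⟨x, v⟩) := by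
  have heval (f : Γ(V.left, ⊤)) : Filter.Tendsto
      (fun t ↦ ((A.l v t).toKN (D := D) ⟨x, v⟩).lift.eval f) (𝓝[>] 0) (𝓝 (v.eval f)) := by
    have h1 : Filter.Tendsto (fun t ↦ (A.l v t).lift.eval f) (𝓝[>] 0) (𝓝 (v.eval f)) := by
      rw [← A.zero v f]
      exact (A.diff v f).continuousAt.tendsto.mono_left nhdsWithin_le_nhds
    refine h1.congr' ?_
    filter_upwards [hA.eventually_mem v] with t ht
    exact (CPoint.toKN_eval ht _ f).symm
  have harg (m : logSections Y (divisorCompl D) V) : Filter.Tendsto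
      (fun t ↦ (((A.l v t).toKN (D := D) ⟨x, v⟩).pt.arg
        (((A.l v t).toKN ⟨x, v⟩).lift.germM D m) : ℂ)) (𝓝[>] 0) (𝓝 (x.arg (v.germM D m))) := by
    obtain ⟨a, b, -, hb, -, hb0, h⟩ := hA.polar (v.germM D m)
    rw [← hb0]
    refine (hb.continuousAt.tendsto.mono_left nhdsWithin_le_nhds).congr' ?_
    filter_upwards [hA.eventually_arg v m h] with t ht using ht.2.symm
  rw [nhds_iInf, Filter.tendsto_iInf]
  rintro ⟨e, he⟩
  rw [nhds_induced, Filter.tendsto_comap_iff]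
  cases he with
  | re f => exact (Complex.continuous_re.tendsto _).comp (heval f)
  | im f => exact (Complex.continuous_im.tendsto _).comp (heval f)
  | abs m => exact (heval m.1).norm
  | cos m => exact (Complex.continuous_re.tendsto _).comp (harg m)
  | sin m => exact (Complex.continuous_im.tendsto _).comp (harg m)

/-- A basic neighbourhood is the image of a coordinate-open set on some étale `W`. The arc has a
compatible lift to `W`, so convergence in the coordinate topology of every `W` suffices. -/
theorem tendsto (hA : A.IsRegular x) {V : Y.Etale} (v : Lift x.pt V) :
    Filter.Tendsto (fun t ↦ (A.l v t).toKN (D := D) ⟨x, v⟩) (𝓝[>] 0) (𝓝 ⟨x, v⟩) := by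
  intro N hN
  obtain ⟨W, j, w, B, rfl, hB, hw, hP⟩ := KNOver.eventually_nhds_iff.1 hN
  have h1 := hA.tendsto_coord w (@IsOpen.mem_nhds _ (coordTopology W) _ B hB hw)
  change ∀ᶠ t in 𝓝[>] 0, (A.l (w.map j) t).toKN ⟨x, w.map j⟩ ∈ N
  filter_upwards [h1, (A.map j w).filter_mono nhdsWithin_le_nhds] with t h2 h3
  have h4 := hP _ h2
  rw [CPoint.toKN_map, h3] at h4
  exact h4

end Arc.IsRegular

/-- The arc in the Kato--Nakayama space over an arc. -/
def Arc.γ (x : KNPoint π D) (A : Arc π x.pt) (t : ℝ) : KNPoint π D :=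
  ((A.l (Lift.self x.pt) t).toKN ⟨x, Lift.self x.pt⟩).pt

namespace Arc.IsRegular

variable {x : KNPoint π D} {A : Arc π x.pt}

/-- Off the divisor a point of the Kato–Nakayama space is determined by its image in `Y`, so the
lifts to different `V` lie over the same arc. -/
theorem eventually_γ (hA : A.IsRegular x) {V : Y.Etale} (v : Lift x.pt V) :
    ∀ᶠ t in 𝓝[>] 0, ((A.l v t).toKN (D := D) ⟨x, v⟩).pt = A.γ x t := by
  filter_upwards [hA.eventually_mem v, hA.off,
    (A.eventually_pt_eq v).filter_mono nhdsWithin_le_nhds] with t h1 h2 h3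
  rw [Arc.γ, CPoint.toKN, CPoint.toKN, dif_pos h1, dif_pos h2]
  simp only [h3]

theorem tendsto_γ (hA : A.IsRegular x) : Filter.Tendsto (A.γ x) (𝓝[>] 0) (𝓝 x) :=
  ((KNOver.continuous_fst _).tendsto _).comp (hA.tendsto (Lift.self x.pt))

theorem eventually_evalRep (hA : A.IsRegular x) (s : stalk x.pt) :
    ∀ᶠ t in 𝓝[>] 0, evalRep x s (A.γ x t) = A.rep s t := by
  obtain ⟨V, v, f, rfl⟩ := Lift.germ_surjective s
  filter_upwards [(hA.tendsto v).eventually (evalRep_germ x v f), hA.eventually_γ v,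
    hA.eventually_mem v,
    (A.rep_eventuallyEq (A.germ_germ v f)).filter_mono nhdsWithin_le_nhds] with t h1 h2 h3 h4
  rw [← h2, h1, h4, CPoint.toKN_eval h3]

theorem eventually_polar (hA : A.IsRegular x) (m : stalkM D x.pt) {a : ℝ → ℝ} {b : ℝ → ℂ}
    (h : ∀ᶠ t in 𝓝[>] 0, a t = ‖A.rep m t‖ ∧ b t * a t = A.rep m t) :
    ∀ᶠ t in 𝓝[>] 0, absRep x m (A.γ x t) = a t ∧ argRep x m (A.γ x t) = b t := by
  obtain ⟨V, v, m, rfl⟩ := exists_germM_eq m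
  filter_upwards [(hA.tendsto v).eventually (argRep_germM x v m), hA.eventually_γ v,
    hA.eventually_arg v m h, hA.eventually_evalRep (v.germM D m : stalkM D x.pt),
    h] with t h1 h2 h3 h4 h5
  rw [absRep, h4, h5.1, ← h2, h1, h3.2]
  exact ⟨rfl, rfl⟩

theorem exists_coord (hA : A.IsRegular x) {c : KNPoint π D → ℝ} (hc : IsLocalCoord x c) : ∃ k : ℝ → ℝ,
    DifferentiableAt ℝ k 0 ∧ k 0 = c x ∧ ∀ᶠ t in 𝓝[>] 0, c (A.γ x t) = k t := by
  have hre {k : ℝ → ℂ} (hk : DifferentiableAt ℝ k 0) : DifferentiableAt ℝ (fun t ↦ (k t).re) 0 :=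
    Complex.reCLM.differentiableAt.comp (0 : ℝ) hk
  have him {k : ℝ → ℂ} (hk : DifferentiableAt ℝ k 0) : DifferentiableAt ℝ (fun t ↦ (k t).im) 0 :=
    Complex.imCLM.differentiableAt.comp (0 : ℝ) hk
  cases hc with
  | re s c hc =>
    obtain ⟨h1, h2⟩ := A.differentiableAt (A.germ_eq_rep s)
    have h3 := evalRep_eventuallyEq hc
    refine ⟨_, hre h1, by simp only [h2, ← h3.self_of_nhds, evalRep_self], ?_⟩
    filter_upwards [hA.eventually_evalRep s, hA.tendsto_γ.eventually h3] with t h4 h5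
    rw [← h5, h4]
  | im s c hc =>
    obtain ⟨h1, h2⟩ := A.differentiableAt (A.germ_eq_rep s)
    have h3 := evalRep_eventuallyEq hc
    refine ⟨_, him h1, by simp only [h2, ← h3.self_of_nhds, evalRep_self], ?_⟩
    filter_upwards [hA.eventually_evalRep s, hA.tendsto_γ.eventually h3] with t h4 h5
    rw [← h5, h4]
  | abs m c hc =>
    obtain ⟨a, b, ha, hb, ha0, hb0, h⟩ := hA.polar m
    have h3 := evalRep_eventuallyEq hc
    refine ⟨a, ha, by simp only [ha0, ← h3.self_of_nhds, evalRep_self], ?_⟩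
    filter_upwards [hA.eventually_polar m h, hA.tendsto_γ.eventually h3] with t h4 h5
    rw [← h5]
    exact h4.1
  | cos m c hc =>
    obtain ⟨a, b, ha, hb, ha0, hb0, h⟩ := hA.polar m
    have h3 := argRep_eventuallyEq hc
    refine ⟨_, hre hb, by simp only [hb0, ← h3.self_of_nhds, argRep_self], ?_⟩
    filter_upwards [hA.eventually_polar m h, hA.tendsto_γ.eventually h3] with t h4 h5
    rw [← h5, h4.2]
  | sin m c hc =>
    obtain ⟨a, b, ha, hb, ha0, hb0, h⟩ := hA.polar m
    have h3 := argRep_eventuallyEq hc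
    refine ⟨_, him hb, by simp only [hb0, ← h3.self_of_nhds, argRep_self], ?_⟩
    filter_upwards [hA.eventually_polar m h, hA.tendsto_γ.eventually h3] with t h4 h5
    rw [← h5, h4.2]

/-- A smooth function is a smooth function of finitely many basic functions, each of which is
differentiable along a regular arc. -/
theorem exists_smooth (hA : A.IsRegular x) {g : KNPoint π D → ℝ} (hg : KNSmoothAt g x) : ∃ k : ℝ → ℝ,
    DifferentiableAt ℝ k 0 ∧ k 0 = g x ∧ ∀ᶠ t in 𝓝[>] 0, g (A.γ x t) = k t := by
  obtain ⟨ι, _, c, F, hc, hF, hgF, -⟩ := hg.exists_eq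
  choose k hk hk0 hck using fun i ↦ hA.exists_coord (hc i)
  refine ⟨fun t ↦ F fun i ↦ k i t, ?_, ?_, ?_⟩
  · exact ((hF.differentiable (by simp)).differentiableAt).comp (0 : ℝ)
      (differentiableAt_pi.2 hk)
  · simp only [hk0, hgF.self_of_nhds]
  · filter_upwards [hA.tendsto_γ.eventually hgF, Filter.eventually_all.2 hck] with t h1 h2
    rw [h1]
    simp only [h2]

end Arc.IsRegular

/-- The one-sided arc in the Kato--Nakayama space over a regular arc. -/
def Arc.IsRegular.knArc {x : KNPoint π D} {A : Arc π x.pt} (hA : A.IsRegular x) : KNArc x :=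
  ⟨A.γ x, hA.tendsto_γ, fun _ hg ↦ hA.exists_smooth hg⟩

end KNArcs

/-! ### Leading coefficients along arcs and homomorphisms on the monoid -/

section LeadingCoefficients

/-- The function `h` is `a * t ^ d` to first order at `0+` for some `d`. -/
def HasLead (h : ℝ → ℂ) (a : ℂ) : Prop :=
  ∃ d : ℕ, Filter.Tendsto (fun t : ℝ ↦ h t / (t : ℂ) ^ d) (𝓝[>] 0) (𝓝 a)

theorem HasLead.congr {h h' : ℝ → ℂ} {a : ℂ} (H : HasLead h a) (hh : h =ᶠ[𝓝[>] 0] h') :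
    HasLead h' a := by
  obtain ⟨d, hd⟩ := H
  exact ⟨d, hd.congr' (by filter_upwards [hh] with t ht; rw [ht])⟩

theorem HasLead.mul {h h' : ℝ → ℂ} {a a' : ℂ} (H : HasLead h a) (H' : HasLead h' a') :
    HasLead (h * h') (a * a') := by
  obtain ⟨d, hd⟩ := H
  obtain ⟨d', hd'⟩ := H'
  refine ⟨d + d', (hd.mul hd').congr fun t ↦ ?_⟩
  rw [div_mul_div_comm, pow_add]
  rfl

theorem HasLead.norm {h : ℝ → ℂ} {a : ℂ} (H : HasLead h a) :
    HasLead (fun t ↦ (‖h t‖ : ℂ)) ‖a‖ := by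
  obtain ⟨d, hd⟩ := H
  refine ⟨d, ((Complex.continuous_ofReal.tendsto _).comp hd.norm).congr' ?_⟩
  filter_upwards [self_mem_nhdsWithin] with t ht
  simp [abs_of_pos (show 0 < t from ht)]

theorem HasLead.of_tendsto {h : ℝ → ℂ} {a : ℂ} (H : Filter.Tendsto h (𝓝[>] 0) (𝓝 a)) :
    HasLead h a := ⟨0, by simpa using H⟩

theorem HasLead.unique_aux {h : ℝ → ℂ} {a a' : ℂ} {d e : ℕ} (ha : a ≠ 0)
    (H : Filter.Tendsto (fun t : ℝ ↦ h t / (t : ℂ) ^ d) (𝓝[>] 0) (𝓝 a))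
    (H' : Filter.Tendsto (fun t : ℝ ↦ h t / (t : ℂ) ^ (d + e)) (𝓝[>] 0) (𝓝 a')) : e = 0 := by
  by_contra he
  have h1 : Filter.Tendsto (fun t : ℝ ↦ (t : ℂ) ^ e) (𝓝[>] 0) (𝓝 0) := by
    have : Filter.Tendsto (fun t : ℝ ↦ (t : ℂ) ^ e) (𝓝 0) (𝓝 (((0 : ℝ) : ℂ) ^ e)) :=
      (Complex.continuous_ofReal.tendsto 0).pow e
    rw [Complex.ofReal_zero, zero_pow he] at this
    exact this.mono_left nhdsWithin_le_nhds
  have h2 := H'.mul h1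
  rw [mul_zero] at h2
  refine ha (tendsto_nhds_unique H (h2.congr' ?_))
  filter_upwards [self_mem_nhdsWithin] with t ht
  have ht0 : (t : ℂ) ≠ 0 := by simpa using (ne_of_gt (show 0 < t from ht))
  rw [pow_add]
  field_simp

/-- A nonzero leading coefficient fixes the exponent, so the exponent need not be recorded. -/
theorem HasLead.unique {h : ℝ → ℂ} {a a' : ℂ} (ha : a ≠ 0) (ha' : a' ≠ 0) (H : HasLead h a)
    (H' : HasLead h a') : a = a' := by
  obtain ⟨d, hd⟩ := H
  obtain ⟨d', hd'⟩ := H'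
  have key : d = d' := by
    rcases le_total d d' with h | h
    · obtain ⟨e, rfl⟩ := Nat.exists_eq_add_of_le h
      rw [HasLead.unique_aux ha hd hd', add_zero]
    · obtain ⟨e, rfl⟩ := Nat.exists_eq_add_of_le h
      rw [HasLead.unique_aux ha' hd' hd, add_zero]
  subst key
  exact tendsto_nhds_unique hd hd'

variable {Y : Scheme.{0}} {π : Y ⟶ Spec (.of ℂ)} {D : Y.IdealSheafData}

theorem Arc.rep_mul {p : Spec (.of ℂ) ⟶ Y} (A : Arc π p) (s t : stalk p) :
    A.rep (s * t) =ᶠ[𝓝 0] A.rep s * A.rep t :=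
  A.rep_eventuallyEq (by rw [map_mul, A.germ_eq_rep s, A.germ_eq_rep t]; rfl)

theorem Arc.hasLead_unit {p : Spec (.of ℂ) ⟶ Y} (A : Arc π p) (s : stalk p) :
    HasLead (A.rep s) (stalkEval p s) := by
  obtain ⟨h1, h2⟩ := A.differentiableAt (A.germ_eq_rep s)
  rw [← h2]
  exact .of_tendsto (h1.continuousAt.tendsto.mono_left nhdsWithin_le_nhds)

/-- Being defined by a limit along the arc, the leading coefficient does not depend on a
factorisation into a unit and a monomial. It is multiplicative by uniqueness of limits. -/
theorem Arc.exists_lead {p : Spec (.of ℂ) ⟶ Y} (A : Arc π p) (c : Chart π D p)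
    (hp : p ≫ π = 𝟙 _) {a : c.S₀ → ℂ} (ha : ∀ i, a i ≠ 0)
    (hlead : ∀ i : c.S₀, HasLead (A.rep (c.g i)) (a i)) :
    ∃ φ : stalkM D p →* ℂ, (∀ m, φ m ≠ 0) ∧ (∀ m : stalkM D p, HasLead (A.rep m) (φ m)) ∧
      (∀ m : stalkM D p, IsUnit (m : stalk p) → φ m = stalkEval p m) ∧ ∀ i, φ (c.m i) = a i := by
  have key (m : stalkM D p) : ∃ b, b ≠ 0 ∧ HasLead (A.rep m) b := by
    refine c.stalkM_induction hp (P := fun m ↦ ∃ b, b ≠ 0 ∧ HasLead (A.rep m) b) (fun m hm ↦ ?_)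
      (fun i ↦ ⟨_, ha i, hlead i⟩) (fun m n ⟨b, hb, hb'⟩ ⟨e, he, he'⟩ ↦ ?_) m
    · exact ⟨_, isUnit_stalk_iff.1 hm, A.hasLead_unit _⟩
    · exact ⟨b * e, mul_ne_zero hb he, (hb'.mul he').congr
        ((A.rep_mul m n).symm.filter_mono nhdsWithin_le_nhds)⟩
  choose φ hφ hφl using key
  have huniq {m : stalkM D p} {b : ℂ} (hb : b ≠ 0) (hb' : HasLead (A.rep m) b) : φ m = b :=
    (hφl m).unique (hφ m) hb hb'
  refine ⟨⟨⟨φ, ?_⟩, fun m n ↦ ?_⟩, hφ, hφl, fun m hm ↦ ?_, fun i ↦ ?_⟩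
  · refine (huniq (m := 1) ?_ (A.hasLead_unit _)).trans (map_one _)
    simp
  · exact huniq (mul_ne_zero (hφ m) (hφ n)) (((hφl m).mul (hφl n)).congr
      ((A.rep_mul m n).symm.filter_mono nhdsWithin_le_nhds))
  · exact huniq (isUnit_stalk_iff.1 hm) (A.hasLead_unit _)
  · exact huniq (ha i) (hlead i)

theorem hasLead_of_eventuallyEq {h k : ℝ → ℂ} (hk : ContinuousAt k 0)
    (hh : h =ᶠ[𝓝 0] fun t ↦ t * k t) : HasLead h (k 0) := by
  refine ⟨1, (hk.tendsto.mono_left nhdsWithin_le_nhds).congr' ?_⟩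
  filter_upwards [hh.filter_mono nhdsWithin_le_nhds, self_mem_nhdsWithin] with t ht ht'
  have ht0 : (t : ℂ) ≠ 0 := by simpa using (ne_of_gt (show 0 < t from ht'))
  rw [ht, pow_one, mul_div_cancel_left₀ _ ht0]

/-- Homomorphisms on the stalk of the log structure with prescribed values exist. -/
theorem Chart.exists_hom {p : Spec (.of ℂ) ⟶ Y} (c : Chart π D p) (hp : p ≫ π = 𝟙 _)
    {a : c.S₀ → ℂ} (ha : ∀ i, a i ≠ 0) :
    ∃ φ : stalkM D p →* ℂ, (∀ m, φ m ≠ 0) ∧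
      (∀ m : stalkM D p, IsUnit (m : stalk p) → φ m = stalkEval p m) ∧ ∀ i, φ (c.m i) = a i := by
  classical
  -- Along this arc `g_i = t a_i` on the branches, so the leading coefficients there are the
  -- prescribed `a_i`; the other coordinates stay constant.
  obtain ⟨A, hA⟩ := c.exists_arc_germ hp
    (fun t i ↦ stalkEval p (c.g i) + t * if h : i ∈ c.S₀ then a ⟨i, h⟩ else 0)
    (fun i ↦ contDiff_const.add (Complex.ofRealCLM.contDiff.mul contDiff_const))
    (fun i ↦ by simp)
  obtain ⟨φ, h1, -, h2, h3⟩ := A.exists_lead c hp ha fun i ↦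
    hasLead_of_eventuallyEq (k := fun _ ↦ a i) continuousAt_const (by
      refine (A.rep_eventuallyEq (hA i)).trans (.of_eq (funext fun t ↦ ?_))
      rw [dif_pos i.2, (c.mem_S₀.1 i.2).2, zero_add])
  exact ⟨φ, h1, h2, h3⟩

theorem Chart.hom_ext {p : Spec (.of ℂ) ⟶ Y} (c : Chart π D p) (hp : p ≫ π = 𝟙 _)
    {φ ψ : stalkM D p →* ℂ} (hu : ∀ m : stalkM D p, IsUnit (m : stalk p) → φ m = ψ m)
    (hg : ∀ i, φ (c.m i) = ψ (c.m i)) : φ = ψ :=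
  MonoidHom.ext (c.stalkM_induction hp (P := fun m ↦ φ m = ψ m) hu hg fun m n hm hn ↦ by
    rw [map_mul, map_mul, hm, hn])

end LeadingCoefficients

/-! ### Arcs leaving the divisor with prescribed polar velocity -/

section RegularArcs

variable {Y : Scheme.{0}} {π : Y ⟶ Spec (.of ℂ)} {D : Y.IdealSheafData}

theorem Chart.eventually_polar {x : KNPoint π D} {A : Arc π x.pt} {m : stalkM D x.pt} {ρ η : ℝ}
    (hρ : 0 < ρ) (hA : A.germ m = (fun t : ℝ ↦
      (t : ℂ) * (ρ * (x.arg m * Complex.exp (η * t * Complex.I))) : ℝ → ℂ)) :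
    ∀ᶠ t in 𝓝[>] 0, t * ρ = ‖A.rep m t‖ ∧
      (x.arg m * Complex.exp (η * t * Complex.I)) * ((t * ρ : ℝ) : ℂ) = A.rep m t := by
  filter_upwards [(A.rep_eventuallyEq hA).filter_mono nhdsWithin_le_nhds,
    self_mem_nhdsWithin] with t ht ht'
  have h1 : ‖Complex.exp (η * t * Complex.I)‖ = 1 := by
    rw [← Complex.ofReal_mul]
    exact Complex.norm_exp_ofReal_mul_I _
  rw [ht]
  constructor
  · rw [norm_mul, norm_mul, norm_mul, h1, Circle.norm_coe, Complex.norm_real,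
      Complex.norm_real, Real.norm_of_nonneg hρ.le, Real.norm_of_nonneg (le_of_lt ht')]
    ring
  · push_cast
    ring

/-- For small `t > 0` no coordinate indexed by `S` vanishes: those through `p` by the formula with
`ρ > 0`, the others by continuity. Polar decompositions exist for units and for the `g_i`, and they
multiply. -/
theorem Chart.isRegular {x : KNPoint π D} (c : Chart π D x.pt) {A : Arc π x.pt}
    {ρ η : c.S₀ → ℝ} (hρ : ∀ i, 0 < ρ i)
    (hA : ∀ i : c.S₀, A.germ (c.g i) = (fun t : ℝ ↦
      (t : ℂ) * (ρ i * (x.arg (c.m i) * Complex.exp (η i * t * Complex.I))) : ℝ → ℂ)) :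
    A.IsRegular x where
  off := by
    have h1 : ∀ᶠ t in 𝓝[>] 0, ∀ i ∈ c.S, A.rep (c.g i) t ≠ 0 := by
      refine (Filter.eventually_all_finset c.S).2 fun i hi ↦ ?_
      by_cases h : i ∈ c.S₀
      · filter_upwards [(A.rep_eventuallyEq (hA ⟨i, h⟩)).filter_mono nhdsWithin_le_nhds,
          self_mem_nhdsWithin] with t ht ht'
        rw [ht]
        exact mul_ne_zero (by simpa using (ne_of_gt (show 0 < t from ht')))
          (mul_ne_zero (by simpa using (hρ ⟨i, h⟩).ne') (mul_ne_zero (Circle.coe_ne_zero _)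
            (Complex.exp_ne_zero _)))
      · have hne : stalkEval x.pt (c.g i) ≠ 0 := fun h0 ↦ h (c.mem_S₀.2 ⟨hi, h0⟩)
        obtain ⟨h2, h3⟩ := A.differentiableAt (A.germ_eq_rep (c.g i))
        exact (h2.continuousAt.eventually_ne (h3.trans_ne hne)).filter_mono nhdsWithin_le_nhds
    have h2 : ∀ᶠ t in 𝓝[>] 0, ∀ i ∈ c.S, A.rep (c.g i) t = (A.l c.u t).lift.eval (c.z i) :=
      (Filter.eventually_all_finset c.S).2 fun i _ ↦
        (A.rep_eventuallyEq (A.germ_germ c.u (c.z i))).filter_mono nhdsWithin_le_nhds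
    filter_upwards [h1, h2, (A.eventually_pt_eq c.u).filter_mono nhdsWithin_le_nhds]
      with t h1 h2 h3
    have h4 : (A.l c.u t).lift.point ∈ c.U.hom ⁻¹ᵁ divisorCompl D := by
      rw [c.compl, Lift.point_mem_basicOpen, map_prod]
      exact Finset.prod_ne_zero_iff.2 fun i hi ↦ h2 i hi ▸ h1 i hi
    have h5 : c.U.hom (A.l c.u t).lift.point ∈ divisorCompl D := h4
    rwa [Lift.hom_point, h3] at h5
  polar m := by
    refine c.stalkM_induction x.pt_str (P := fun m ↦ ∃ (a : ℝ → ℝ) (b : ℝ → ℂ),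
      DifferentiableAt ℝ a 0 ∧ DifferentiableAt ℝ b 0 ∧ a 0 = ‖stalkEval x.pt m‖ ∧
      b 0 = x.arg m ∧ ∀ᶠ t in 𝓝[>] 0, a t = ‖A.rep m t‖ ∧ b t * a t = A.rep m t)
      (fun m hm ↦ ?_) (fun i ↦ ?_) ?_ m
    · obtain ⟨h1, h2⟩ := A.differentiableAt (A.germ_eq_rep m)
      have h3 : A.rep m 0 ≠ 0 := by
        rw [h2]
        exact isUnit_stalk_iff.1 hm
      have h4 : DifferentiableAt ℝ (fun t ↦ ‖A.rep m t‖) 0 := h1.norm ℝ h3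
      have h5 : (‖A.rep m 0‖ : ℂ) ≠ 0 := by simpa using h3
      refine ⟨fun t ↦ ‖A.rep m t‖, fun t ↦ A.rep m t / ‖A.rep m t‖, h4,
        h1.div (Complex.ofRealCLM.differentiableAt.comp (0 : ℝ) h4) h5, by simp only [h2], ?_, ?_⟩
      · simp only [h2]
        rw [h2] at h5
        exact (div_eq_iff h5).2 (x.arg_mul_norm m).symm
      · filter_upwards [(h1.continuousAt.eventually_ne h3).filter_mono nhdsWithin_le_nhds]
          with t ht
        exact ⟨rfl, div_mul_cancel₀ _ (by simpa using ht)⟩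
    · refine ⟨fun t ↦ t * ρ i, fun t ↦ x.arg (c.m i) * Complex.exp (η i * t * Complex.I),
        by fun_prop, ?_, ?_, by simp, ?_⟩
      · have : DifferentiableAt ℝ (fun t : ℝ ↦ (t : ℂ)) 0 := Complex.ofRealCLM.differentiableAt
        fun_prop
      · rw [c.eval_m]
        simp
      · exact Chart.eventually_polar (hρ i) (hA i)
    · rintro m n ⟨a, b, ha, hb, ha0, hb0, h⟩ ⟨a', b', ha', hb', ha0', hb0', h'⟩
      refine ⟨a * a', b * b', ha.mul ha', hb.mul hb', ?_, ?_, ?_⟩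
      · rw [Pi.mul_apply, ha0, ha0', Submonoid.coe_mul, map_mul, norm_mul]
      · rw [Pi.mul_apply, hb0, hb0', map_mul, Circle.coe_mul]
      · filter_upwards [h, h', (A.rep_mul m n).filter_mono nhdsWithin_le_nhds]
          with t ⟨h1, h2⟩ ⟨h3, h4⟩ h5
        have h5 : A.rep ((m * n : stalkM D x.pt) : stalk x.pt) t =
          A.rep (m : stalk x.pt) t * A.rep (n : stalk x.pt) t := h5
        rw [h5, norm_mul, Pi.mul_apply, Pi.mul_apply]
        refine ⟨by rw [h1, h3], ?_⟩
        rw [← h2, ← h4]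
        push_cast
        ring

/-- Regular arcs with prescribed velocity exist. -/
theorem Chart.exists_regular {x : KNPoint π D} (c : Chart π D x.pt) {ρ : c.S₀ → ℝ}
    (hρ : ∀ i, 0 < ρ i) (η : c.S₀ → ℝ) (ζ : Fin c.n → ℂ) :
    ∃ (A : Arc π x.pt) (hA : A.IsRegular x),
      (∀ i : c.S₀, HasLead (A.rep (c.g i)) (ρ i * x.arg (c.m i))) ∧
      (∀ i, hA.knArc.velocity.d (absRep x (c.m i)) = ρ i) ∧
      (∀ i, hA.knArc.velocity.dC (argRep x (c.m i)) = η i * Complex.I * x.arg (c.m i)) ∧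
      ∀ i ∉ c.S₀, hA.knArc.velocity.proj.1 (c.g i) = ζ i := by
  classical
  have hofReal : ContDiff ℝ 1 fun t : ℝ ↦ (t : ℂ) := Complex.ofRealCLM.contDiff
  -- Here `|g_i| = t ρ_i` has derivative `ρ_i`, and the factor `exp(i η_i t)` turns the argument
  -- with speed `η_i` from its value at `x`.
  obtain ⟨A, hA⟩ := c.exists_arc_germ x.pt_str
    (fun t i ↦ if h : i ∈ c.S₀ then
      (t : ℂ) * (ρ ⟨i, h⟩ * (x.arg (c.m ⟨i, h⟩) * Complex.exp (η ⟨i, h⟩ * t * Complex.I)))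
      else stalkEval x.pt (c.g i) + t * ζ i)
    (fun i ↦ by
      by_cases h : i ∈ c.S₀
      · simp only [dif_pos h]
        fun_prop
      · simp only [dif_neg h]
        fun_prop)
    (fun i ↦ by
      by_cases h : i ∈ c.S₀
      · simp only [dif_pos h]
        rw [(c.mem_S₀.1 h).2]
        simp
      · simp [dif_neg h])
  have hA₀ (i : c.S₀) : A.germ (c.g i) = (fun t : ℝ ↦
      (t : ℂ) * (ρ i * (x.arg (c.m i) * Complex.exp (η i * t * Complex.I))) : ℝ → ℂ) := by
    rw [hA]
    congr 1
    funext t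
    rw [dif_pos i.2]
  have hR := c.isRegular hρ hA₀
  refine ⟨A, hR, fun i ↦ ?_, fun i ↦ ?_, fun i ↦ ?_, fun i hi ↦ ?_⟩
  · have hc : ContinuousAt (fun t : ℝ ↦
        (ρ i * (x.arg (c.m i) * Complex.exp (η i * t * Complex.I)) : ℂ)) 0 := by fun_prop
    simpa using hasLead_of_eventuallyEq hc (A.rep_eventuallyEq (hA₀ i))
  · rw [hR.knArc.velocity_d (k := fun t ↦ t * ρ i) (smoothAt_absRep x _) (by fun_prop) ?_
      ((hR.eventually_polar (c.m i) (Chart.eventually_polar (hρ i) (hA₀ i))).mono fun t ht ↦ ht.1)]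
    · simp
    · simp [absRep_self, c.eval_m]
  · have h1 : HasDerivAt (fun t : ℝ ↦ (η i * t * Complex.I : ℂ)) (η i * 1 * Complex.I) 0 :=
      (Complex.ofRealCLM.hasDerivAt.const_mul _).mul_const _
    have h2 := h1.cexp.const_mul (x.arg (c.m i) : ℂ)
    rw [hR.knArc.velocity_dC (smoothAt_argRep x _) h2.differentiableAt ?_
      ((hR.eventually_polar (c.m i) (Chart.eventually_polar (hρ i) (hA₀ i))).mono fun t ht ↦ ht.2),
      h2.deriv]
    · simp
      ring
    · simp [argRep_self]
  · have h1 := hA i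
    simp only [dif_neg hi] at h1
    have h2 : HasDerivAt (fun t : ℝ ↦ stalkEval x.pt (c.g i) + t * ζ i) (1 * ζ i) 0 :=
      (Complex.ofRealCLM.hasDerivAt.mul_const _).const_add _
    rw [KNTangent.proj_apply, hR.knArc.velocity_dC (smoothAt_evalRep x _) h2.differentiableAt
      (by simp [evalRep_self]) ?_, h2.deriv, one_mul]
    filter_upwards [hR.eventually_evalRep (c.g i),
      (A.rep_eventuallyEq h1).filter_mono nhdsWithin_le_nhds] with t h3 h4
    exact h3.trans h4

end RegularArcs

/-! ### Positive evaluations of monomial functions -/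

section Evaluations

variable {Y : Scheme.{0}} {π : Y ⟶ Spec (.of ℂ)} {D : Y.IdealSheafData}

theorem knMonomialAt_iff {h : KNPoint π D → ℝ} {x : KNPoint π D} : KNMonomialAt h x ↔
    ∃ (g : KNPoint π D → ℝ) (m : stalkM D x.pt), KNSmoothAt g x ∧ (∀ᶠ y in 𝓝 x, 0 < g y) ∧
      h =ᶠ[𝓝 x] g * absRep x m := by
  constructor
  · rintro ⟨g, hg, hpos, U, u, m, H⟩
    refine ⟨g, u.germM D m, hg, hpos, (KNOver.eventually_pt u).1 ?_⟩
    filter_upwards [H, evalRep_germ x u m.1] with y h1 h2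
    rw [h1, ← h2]
    rfl
  · rintro ⟨g, m, hg, hpos, H⟩
    obtain ⟨U, u, m, rfl⟩ := exists_germM_eq m
    refine ⟨g, hg, hpos, U, u, m, ?_⟩
    filter_upwards [(KNOver.eventually_pt u).2 H, evalRep_germ x u m.1] with y h1 h2
    rw [h1, ← h2]
    rfl

theorem knMonomialAt_absRep (x : KNPoint π D) (m : stalkM D x.pt) :
    KNMonomialAt (absRep x m) x :=
  knMonomialAt_iff.2 ⟨_, m, KNSmoothAt.const 1 x, .of_forall fun _ ↦ one_pos,
    .of_eq (one_mul _).symm⟩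

/-- A multiplicative extension of evaluation at `x` from the positive smooth functions to the
monomial functions, with positive values. -/
structure IsPosEval (x : KNPoint π D) (σ : (KNPoint π D → ℝ) → ℝ) : Prop where
  pos {h : KNPoint π D → ℝ} : KNMonomialAt h x → 0 < σ h
  mul {g h : KNPoint π D → ℝ} : KNMonomialAt g x → KNMonomialAt h x → σ (g * h) = σ g * σ h
  congr {g h : KNPoint π D → ℝ} : KNMonomialAt g x → g =ᶠ[𝓝 x] h → σ g = σ h
  smooth {g : KNPoint π D → ℝ} : KNSmoothAt g x → (∀ᶠ y in 𝓝 x, 0 < g y) → σ g = g x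

theorem IsPosEval.eq {x : KNPoint π D} {σ : (KNPoint π D → ℝ) → ℝ} (hσ : IsPosEval x σ)
    {g h : KNPoint π D → ℝ} {m : stalkM D x.pt} (hg : KNSmoothAt g x)
    (hpos : ∀ᶠ y in 𝓝 x, 0 < g y) (H : h =ᶠ[𝓝 x] g * absRep x m) :
    σ h = g x * σ (absRep x m) := by
  rw [hσ.congr (knMonomialAt_iff.2 ⟨g, m, hg, hpos, H⟩) H,
    hσ.mul (.of_pos hg hpos) (knMonomialAt_absRep x m), hσ.smooth hg hpos]

theorem IsPosEval.absRep_mul {x : KNPoint π D} {σ : (KNPoint π D → ℝ) → ℝ} (hσ : IsPosEval x σ)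
    (m n : stalkM D x.pt) : σ (absRep x (m * n)) = σ (absRep x m) * σ (absRep x n) := by
  rw [hσ.congr (knMonomialAt_absRep x _) (LogGeom.absRep_mul x m n),
    hσ.mul (knMonomialAt_absRep x m) (knMonomialAt_absRep x n)]

theorem eventually_absRep_pos {x : KNPoint π D} {m : stalkM D x.pt} (hm : IsUnit (m : stalk x.pt)) :
    ∀ᶠ y in 𝓝 x, 0 < absRep x m y := by
  obtain ⟨s, hs⟩ := hm.exists_right_inv
  have h1 := evalRep_eventuallyEq (x := x) (s := m * s) (c := fun _ ↦ 1) (by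
    rw [hs, map_one]
    rfl)
  filter_upwards [h1, evalRep_mul x m s] with y h2 h3
  refine norm_pos_iff.2 fun h4 ↦ ?_
  rw [h3, Pi.mul_apply, h4, zero_mul] at h2
  exact zero_ne_one h2

theorem IsPosEval.unit {x : KNPoint π D} {σ : (KNPoint π D → ℝ) → ℝ} (hσ : IsPosEval x σ)
    {m : stalkM D x.pt} (hm : IsUnit (m : stalk x.pt)) :
    σ (absRep x m) = ‖stalkEval x.pt m‖ := by
  rw [hσ.smooth (smoothAt_absRep x m) (eventually_absRep_pos hm), absRep_self]

open Classical in
/-- The leading coefficient along an arc. -/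
def KNArc.lead {x : KNPoint π D} (A : KNArc x) (h : KNPoint π D → ℝ) : ℝ :=
  if H : ∃ b : ℝ, 0 < b ∧ HasLead (fun t ↦ (h (A.γ t) : ℂ)) b then H.choose else 1

theorem KNArc.lead_eq {x : KNPoint π D} (A : KNArc x) {h : KNPoint π D → ℝ} {b : ℝ} (hb : 0 < b)
    (H : HasLead (fun t ↦ (h (A.γ t) : ℂ)) b) : A.lead h = b := by
  have H' : ∃ b : ℝ, 0 < b ∧ HasLead (fun t ↦ (h (A.γ t) : ℂ)) b := ⟨b, hb, H⟩
  rw [KNArc.lead, dif_pos H']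
  exact Complex.ofReal_injective (H'.choose_spec.2.unique
    (Complex.ofReal_ne_zero.2 H'.choose_spec.1.ne') (Complex.ofReal_ne_zero.2 hb.ne') H)

theorem Arc.IsRegular.hasLead_absRep {x : KNPoint π D} {A : Arc π x.pt} (hA : A.IsRegular x)
    {m : stalkM D x.pt} {b : ℂ} (hb : HasLead (A.rep m) b) :
    HasLead (fun t ↦ (absRep x m (A.γ x t) : ℂ)) (‖b‖ : ℝ) := by
  refine hb.norm.congr ?_
  filter_upwards [hA.eventually_evalRep m] with t ht
  rw [absRep, ht]

/-- A monomial function `g |m|` has leading coefficient `g(x) |φ m|`, which is positive; positive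
smooth functions have their value at `x`. -/
theorem Arc.IsRegular.isPosEval_lead {x : KNPoint π D} {A : Arc π x.pt} (hA : A.IsRegular x)
    {φ : stalkM D x.pt → ℂ} (h0 : ∀ m, φ m ≠ 0)
    (hφ : ∀ m : stalkM D x.pt, HasLead (A.rep m) (φ m)) :
    IsPosEval x hA.knArc.lead := by
  have hsm {g : KNPoint π D → ℝ} (hg : KNSmoothAt g x) :
      HasLead (fun t ↦ (g (A.γ x t) : ℂ)) (g x : ℝ) := by
    obtain ⟨k, hk, hk0, hgk⟩ := hA.exists_smooth hg
    refine HasLead.congr (.of_tendsto (h := fun t ↦ (k t : ℂ)) ?_)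
      (hgk.mono fun t ht ↦ congrArg Complex.ofReal ht.symm)
    rw [← hk0]
    exact ((Complex.continuous_ofReal.tendsto _).comp
      (hk.continuousAt.tendsto.mono_left nhdsWithin_le_nhds))
  have key {h : KNPoint π D → ℝ} (hh : KNMonomialAt h x) :
      ∃ b : ℝ, 0 < b ∧ HasLead (fun t ↦ (h (A.γ x t) : ℂ)) b := by
    obtain ⟨g, m, hg, hpos, H⟩ := knMonomialAt_iff.1 hh
    refine ⟨g x * ‖φ m‖, mul_pos hpos.self_of_nhds (norm_pos_iff.2 (h0 m)), ?_⟩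
    rw [Complex.ofReal_mul]
    refine ((hsm hg).mul (hA.hasLead_absRep (hφ m))).congr ?_
    filter_upwards [hA.tendsto_γ.eventually H] with t ht
    rw [ht]
    simp
  constructor
  · intro h hh
    obtain ⟨b, hb, hl⟩ := key hh
    rwa [hA.knArc.lead_eq hb hl]
  · intro g h hg hh
    obtain ⟨b, hb, hl⟩ := key hg
    obtain ⟨b', hb', hl'⟩ := key hh
    rw [hA.knArc.lead_eq hb hl, hA.knArc.lead_eq hb' hl']
    refine hA.knArc.lead_eq (mul_pos hb hb') ?_
    rw [Complex.ofReal_mul]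
    refine (hl.mul hl').congr (.of_forall fun t ↦ ?_)
    exact (Complex.ofReal_mul _ _).symm
  · intro g h hg hgh
    obtain ⟨b, hb, hl⟩ := key hg
    rw [hA.knArc.lead_eq hb hl]
    refine (hA.knArc.lead_eq hb (hl.congr ?_)).symm
    filter_upwards [hA.tendsto_γ.eventually hgh] with t ht using congrArg Complex.ofReal ht
  · intro g hg hpos
    exact hA.knArc.lead_eq hpos.self_of_nhds (hsm hg)

/-- Leading coefficients along a regular arc with radial speeds `ρ_i`. -/
theorem Chart.exists_isPosEval {x : KNPoint π D} (c : Chart π D x.pt) {ρ : c.S₀ → ℝ}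
    (hρ : ∀ i, 0 < ρ i) :
    ∃ σ, IsPosEval x σ ∧ ∀ i, σ (absRep x (c.m i)) = ρ i := by
  obtain ⟨A, hA, hlead, -⟩ := c.exists_regular hρ (fun _ ↦ 0) (fun _ ↦ 0)
  obtain ⟨φ, h1, h2, -, h4⟩ := A.exists_lead c x.pt_str (a := fun i ↦ ρ i * x.arg (c.m i))
    (fun i ↦ mul_ne_zero (Complex.ofReal_ne_zero.2 (hρ i).ne') (Circle.coe_ne_zero _)) hlead
  refine ⟨_, hA.isPosEval_lead h1 h2, fun i ↦ ?_⟩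
  refine hA.knArc.lead_eq (hρ i) ?_
  have := hA.hasLead_absRep (h2 (c.m i))
  rwa [h4, norm_mul, Circle.norm_coe, mul_one, Complex.norm_real,
    Real.norm_of_nonneg (hρ i).le] at this

/-- A monomial function is a positive smooth function times `|m|`, and `m` is built from units and
the `g_i`; both evaluations are prescribed on the smooth factor and on units. -/
theorem IsPosEval.ext {x : KNPoint π D} {σ τ : (KNPoint π D → ℝ) → ℝ} (hσ : IsPosEval x σ)
    (hτ : IsPosEval x τ) (c : Chart π D x.pt)
    (h : ∀ i, σ (absRep x (c.m i)) = τ (absRep x (c.m i))) {g : KNPoint π D → ℝ}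
    (hg : KNMonomialAt g x) : σ g = τ g := by
  obtain ⟨k, m, hk, hpos, H⟩ := knMonomialAt_iff.1 hg
  rw [hσ.eq hk hpos H, hτ.eq hk hpos H]
  congr 1
  refine c.stalkM_induction x.pt_str (P := fun m ↦ σ (absRep x m) = τ (absRep x m))
    (fun m hm ↦ ?_) h (fun m n hm hn ↦ ?_) m
  · rw [hσ.unit hm, hτ.unit hm]
  · rw [hσ.absRep_mul, hτ.absRep_mul, hm, hn]

end Evaluations

/-! ### Weak points of the Kato–Nakayama space as evaluations -/

section KNWeakPoints

variable {Y : Scheme.{0}} {π : Y ⟶ Spec (.of ℂ)} {D : Y.IdealSheafData}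

/-- The function on `V` of a section of the log structure, extended by zero. -/
def sectionFun {V : Opens (KN π D).space} (r : (KN π D).M.obj (op V)) : KNPoint π D → ℝ :=
  zeroExtend ((KN π D).α V r)

theorem sectionFun_apply {V : Opens (KN π D).space} (r : (KN π D).M.obj (op V))
    {x : KNPoint π D} (hx : x ∈ V) : sectionFun r x = (KN π D).α V r ⟨x, hx⟩ :=
  zeroExtend_apply _ (⟨x, hx⟩ : V)

theorem knMonomialAt_sectionFun {V : Opens (KN π D).space} (r : (KN π D).M.obj (op V))
    {x : KNPoint π D} (hx : x ∈ V) : KNMonomialAt (sectionFun r) x := r.2 ⟨x, hx⟩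

/-- The domain on which a function is monomial. -/
def monomialDomain (h : KNPoint π D → ℝ) : Opens (KN π D).space :=
  ⟨{x | KNMonomialAt h x}, isOpen_iff_eventually.2 fun _ hx ↦ hx.eventually⟩

def monomialSection {h : KNPoint π D → ℝ} {V : Opens (KN π D).space}
    (H : ∀ x ∈ V, KNMonomialAt h x) : (KN π D).M.obj (op V) :=
  ⟨fun y ↦ h y.1, fun x ↦ (H x.1 x.2).congr (by
    filter_upwards [V.isOpen.mem_nhds x.2] with y hy
    exact (zeroExtend_apply (fun y : V ↦ h y.1) ⟨y, hy⟩).symm)⟩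

theorem sectionFun_monomialSection {h : KNPoint π D → ℝ} {V : Opens (KN π D).space}
    (H : ∀ x ∈ V, KNMonomialAt h x) {x : KNPoint π D} (hx : x ∈ V) :
    sectionFun (monomialSection H) =ᶠ[𝓝 x] h := by
  filter_upwards [V.isOpen.mem_nhds hx] with y hy
  exact zeroExtend_apply (fun y : V ↦ h y.1) ⟨y, hy⟩

namespace KNWeakPoint

variable (s : KNWeakPoint π D)

theorem value_map {V W : Opens (KN π D).space} (h : V ≤ W) (hV : s.pt ∈ V)
    (r : (KN π D).M.obj (op W)) :
    s.value hV ((KN π D).M.map (homOfLE h).op r) = s.value (h hV) r := by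
  have h1 := congr($(s.pull.naturality (homOfLE h).op) r)
  exact congrArg (fun q ↦ PositiveLogSpace.point.α ((Opens.map s.map).obj V) q
    ⟨PUnit.unit, hV⟩) h1

/-- Both sections restrict to the same section on a neighbourhood where the functions agree, and the
value is compatible with restriction. -/
theorem value_congr {V W : Opens (KN π D).space} (hV : s.pt ∈ V) (hW : s.pt ∈ W)
    {r : (KN π D).M.obj (op V)} {r' : (KN π D).M.obj (op W)}
    (h : sectionFun r =ᶠ[𝓝 s.pt] sectionFun r') : s.value hV r = s.value hW r' := by
  obtain ⟨N, hN, hNo, hxN⟩ := eventually_nhds_iff.1 h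
  let N' : Opens (KN π D).space := ⟨N, hNo⟩ ⊓ (V ⊓ W)
  have hN' : s.pt ∈ N' := ⟨hxN, hV, hW⟩
  have h1 : N' ≤ V := inf_le_right.trans inf_le_left
  have h2 : N' ≤ W := inf_le_right.trans inf_le_right
  rw [← s.value_map h1 hN' r, ← s.value_map h2 hN' r']
  congr 1
  refine Subtype.ext (funext fun y ↦ ?_)
  have h3 := hN y.1 y.2.1
  rw [sectionFun_apply r (h1 y.2), sectionFun_apply r' (h2 y.2)] at h3
  exact h3

theorem value_pos {V : Opens (KN π D).space} (hV : s.pt ∈ V) (r : (KN π D).M.obj (op V)) :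
    0 < s.value hV r :=
  (s.pull.app (op V) r).2 ⟨PUnit.unit, hV⟩

theorem value_mul {V : Opens (KN π D).space} (hV : s.pt ∈ V) (r r' : (KN π D).M.obj (op V)) :
    s.value hV (r * r') = s.value hV r * s.value hV r' := by
  rw [value, map_mul, map_mul]
  rfl

open Classical in
/-- The values of a weak point on monomial functions. -/
def eval (h : KNPoint π D → ℝ) : ℝ :=
  if H : KNMonomialAt h s.pt then
    s.value (V := monomialDomain h) H (monomialSection fun _ hx ↦ hx)
  else 1

theorem value_eq_eval {V : Opens (KN π D).space} (hV : s.pt ∈ V) (r : (KN π D).M.obj (op V))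
    {h : KNPoint π D → ℝ} (hr : sectionFun r =ᶠ[𝓝 s.pt] h) : s.value hV r = s.eval h := by
  have H : KNMonomialAt h s.pt := (knMonomialAt_sectionFun r hV).congr hr
  rw [eval, dif_pos H]
  exact s.value_congr _ _ (hr.trans
    (sectionFun_monomialSection (V := monomialDomain h) (fun _ hx ↦ hx) H).symm)

theorem isPosEval : IsPosEval s.pt s.eval where
  pos hh := by
    rw [eval, dif_pos hh]
    exact s.value_pos _ _
  congr {g h} hg hgh := by
    rw [← s.value_eq_eval (V := monomialDomain g) hg (monomialSection fun _ hx ↦ hx)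
        (sectionFun_monomialSection _ hg),
      ← s.value_eq_eval (V := monomialDomain g) hg (monomialSection fun _ hx ↦ hx)
        ((sectionFun_monomialSection _ hg).trans hgh)]
  mul {g h} hg hh := by
    let V := monomialDomain g ⊓ monomialDomain h
    have hV : s.pt ∈ V := ⟨hg, hh⟩
    have h1 : ∀ x ∈ V, KNMonomialAt g x := fun x hx ↦ hx.1
    have h2 : ∀ x ∈ V, KNMonomialAt h x := fun x hx ↦ hx.2
    have h3 : ∀ x ∈ V, KNMonomialAt (g * h) x := fun x hx ↦ hx.1.mul hx.2
    rw [← s.value_eq_eval hV (monomialSection h1) (sectionFun_monomialSection _ hV),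
      ← s.value_eq_eval hV (monomialSection h2) (sectionFun_monomialSection _ hV),
      ← s.value_eq_eval hV (monomialSection h3) (sectionFun_monomialSection _ hV)]
    exact s.value_mul hV (monomialSection h1) (monomialSection h2)
  smooth {g} hg hpos := by
    obtain ⟨N, hN, hNo, hxN⟩ := eventually_nhds_iff.1 (hpos.and hg.eventually)
    let V : Opens (KN π D).space := ⟨N, hNo⟩
    have h1 : ∀ x ∈ V, KNMonomialAt g x := fun x hx ↦ .of_pos (hN x hx).2 (by
      filter_upwards [V.isOpen.mem_nhds hx] with y hy using (hN y hy).1)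
    have hV : s.pt ∈ V := hxN
    rw [← s.value_eq_eval hV (monomialSection h1) (sectionFun_monomialSection _ hV)]
    exact s.pull_pos V (monomialSection h1) (fun y ↦ (hN y.1 y.2).1) ⟨PUnit.unit, hV⟩

/-- A section over `*` is a single positive number, so the sheaf morphism is recovered from its
values at the point. -/
theorem ext_eval {s s' : KNWeakPoint π D} (hpt : s.pt = s'.pt)
    (h : ∀ g, KNMonomialAt g s.pt → s.eval g = s'.eval g) : s = s' := by
  have hmap : s.map = s'.map := by
    ext y
    exact hpt
  have hval {V : Opens (KN π D).space} (hV : s.pt ∈ V) (hV' : s'.pt ∈ V)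
      (r : (KN π D).M.obj (op V)) : s.value hV r = s'.value hV' r := by
    rw [s.value_eq_eval hV r .rfl, s'.value_eq_eval hV' r .rfl]
    exact h _ (knMonomialAt_sectionFun r hV)
  obtain ⟨f, h1, q, h2⟩ := s
  obtain ⟨f', h1', q', h2'⟩ := s'
  obtain rfl : f = f' := hmap
  have : q = q' := by
    ext V r
    refine Subtype.ext (funext fun y ↦ ?_)
    exact hval (V := V) y.2 y.2 r
  subst this
  rfl

/-- The weak point given by an evaluation of monomial functions. -/
def ofEval (x : KNPoint π D) (σ : (KNPoint π D → ℝ) → ℝ) (hσ : IsPosEval x σ) :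
    KNWeakPoint π D where
  map := TopCat.ofHom (.const _ x)
  smooth_comp _ _ _ := trivial
  pull :=
    { app V := CommMonCat.ofHom
        { toFun r := ⟨fun _ ↦ σ (sectionFun r), fun y ↦ hσ.pos (knMonomialAt_sectionFun r y.2)⟩
          map_one' := Subtype.ext (funext fun y ↦ by
            have hx : x ∈ V.unop := y.2
            have h1 : sectionFun (1 : (KN π D).M.obj (op V.unop)) =ᶠ[𝓝 x] fun _ ↦ 1 := by
              filter_upwards [V.unop.isOpen.mem_nhds hx] with z hz
              exact sectionFun_apply _ hz
            refine (hσ.congr (knMonomialAt_sectionFun _ hx) h1).trans ?_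
            exact hσ.smooth (.const 1 x) (.of_forall fun _ ↦ one_pos))
          map_mul' r r' := Subtype.ext (funext fun y ↦ by
            have hx : x ∈ V.unop := y.2
            refine Eq.trans ?_ (hσ.mul (knMonomialAt_sectionFun r hx)
              (knMonomialAt_sectionFun r' hx))
            exact congrArg σ (zeroExtend_mul _ _)) }
      naturality V W i := by
        ext r
        refine Subtype.ext (funext fun y ↦ ?_)
        have hx : x ∈ W.unop := y.2
        exact hσ.congr (knMonomialAt_sectionFun _ hx)
          (zeroExtend_restrict_eventuallyEq i.unop.le ((KN π D).α V.unop r) hx) }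
  pull_pos V r hr y := by
    have hx : x ∈ V := y.2
    have hpos : ∀ᶠ z in 𝓝 x, 0 < sectionFun r z := by
      filter_upwards [V.isOpen.mem_nhds hx] with z hz
      rw [sectionFun_apply r hz]
      exact hr ⟨z, hz⟩
    exact (hσ.smooth (knMonomialAt_sectionFun r hx).smoothAt hpos).trans (sectionFun_apply r hx)

theorem ofEval_eval (x : KNPoint π D) (σ : (KNPoint π D → ℝ) → ℝ) (hσ : IsPosEval x σ)
    {h : KNPoint π D → ℝ} (hh : KNMonomialAt h x) : (ofEval x σ hσ).eval h = σ h := by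
  have hr : sectionFun (V := monomialDomain h) (monomialSection fun _ hx ↦ hx) =ᶠ[𝓝 x] h :=
    sectionFun_monomialSection _ hh
  refine ((ofEval x σ hσ).value_eq_eval (V := monomialDomain h) hh _ hr).symm.trans ?_
  exact (hσ.congr hh hr.symm).symm

end KNWeakPoint

end KNWeakPoints

/-! ### Tangent cones in coordinates and the bijection with `C^∞` basepoints -/

section TangentCone

variable {Y : Scheme.{0}} {π : Y ⟶ Spec (.of ℂ)} {D : Y.IdealSheafData}

namespace KNTangent

variable {x : KNPoint π D}

theorem d_neg_vec (v : KNTangent π D x) (g : KNPoint π D → ℝ) : (-v).d g = -v.d g := by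
  rw [← neg_one_smul ℝ v, d_smul, neg_one_mul]

theorem d_sub_vec (v w : KNTangent π D x) (g : KNPoint π D → ℝ) :
    (v - w).d g = v.d g - w.d g := by
  rw [sub_eq_add_neg, d_vadd, d_neg_vec, sub_eq_add_neg]

theorem dC_sub_vec (v w : KNTangent π D x) (g : KNPoint π D → ℂ) :
    (v - w).dC g = v.dC g - w.dC g := by
  rw [dC, dC, dC, d_sub_vec, d_sub_vec]
  push_cast
  ring

/-- The argument of a section of the log structure varies on the circle. -/
theorem exists_dC_argRep (v : KNTangent π D x) (m : stalkM D x.pt) :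
    ∃ η : ℝ, v.dC (argRep x m) = η * Complex.I * x.arg m := by
  have h := v.re_conj_mul_dC_argRep m
  have h3 : (x.arg m : ℂ) * starRingEnd ℂ (x.arg m) = 1 := by
    rw [Complex.mul_conj, Circle.normSq_coe, Complex.ofReal_one]
  refine ⟨(starRingEnd ℂ (x.arg m) * v.dC (argRep x m)).im, ?_⟩
  have h4 := Complex.re_add_im (starRingEnd ℂ (x.arg m) * v.dC (argRep x m))
  rw [h, Complex.ofReal_zero, zero_add] at h4
  rw [h4]
  linear_combination (-v.dC (argRep x m)) * h3

theorem continuous_d (g : KNPoint π D → ℝ) : Continuous fun v : KNTangent π D x ↦ v.d g := by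
  by_cases hg : KNSmoothAt g x
  · simp only [KNTangent.d, dif_pos hg]
    exact (continuous_apply _).comp continuous_subtype_val
  · simp only [KNTangent.d, dif_neg hg]
    exact continuous_const

theorem mem_nonnegTangent_iff {v : KNTangent π D x} : v ∈ (KN π D).nonnegTangent x ↔
    ∀ g, KNSmoothAt g x → (∀ᶠ y in 𝓝 x, 0 ≤ g y) → g x = 0 → 0 ≤ v.d g := by
  constructor
  · intro h g hg hpos h0
    rw [v.d_eq (mem_smoothGerms_iff.2 hg)]
    exact h _ (Filter.Germ.coe_le.2 hpos) h0
  · intro h γ hγ h0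
    obtain ⟨g, hg, hgγ, hv⟩ := KNTangent.exists_eq_d γ
    rw [hgγ] at hγ h0
    rw [hv]
    exact h g hg (Filter.Germ.coe_le.1 hγ) h0

theorem mem_tangentFace_iff {v : KNTangent π D x} : v ∈ (KN π D).tangentFace x ↔
    v ∈ (KN π D).nonnegTangent x ∧ -v ∈ (KN π D).nonnegTangent x := by
  constructor
  · exact fun h ↦ ⟨fun γ h1 h2 ↦ (h γ h1 h2).ge, fun γ h1 h2 ↦ by
      change 0 ≤ -v.1 γ
      rw [h γ h1 h2, neg_zero]⟩
  · rintro ⟨h, h'⟩ γ h1 h2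
    have h3 : 0 ≤ -v.1 γ := h' γ h1 h2
    exact le_antisymm (by linarith) (h γ h1 h2)

end KNTangent

namespace Chart

variable {x : KNPoint π D} (c : Chart π D x.pt)

theorem absRep_eq_zero (i : c.S₀) : absRep x (c.m i) x = 0 := by
  rw [absRep_self, c.eval_m, norm_zero]

theorem exists_knArc {ρ : c.S₀ → ℝ} (hρ : ∀ i, 0 < ρ i) :
    ∃ A : KNArc x, ∀ i, A.velocity.d (absRep x (c.m i)) = ρ i := by
  obtain ⟨A, hA, -, h, -⟩ := c.exists_regular hρ (fun _ ↦ 0) (fun _ ↦ 0)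
  exact ⟨_, h⟩

/-- A regular arc is chosen with the same radial, angular and remaining components as `v`; the
difference vanishes by `Chart.knTangent_eq_zero`. -/
theorem exists_eq_velocity {v : KNTangent π D x} (hv : ∀ i, 0 < v.d (absRep x (c.m i))) :
    ∃ A : KNArc x, A.velocity = v := by
  choose η hη using fun i ↦ v.exists_dC_argRep (c.m i)
  obtain ⟨A, hA, -, h1, h2, h3⟩ := c.exists_regular hv η fun i ↦ v.proj.1 (c.g i)
  refine ⟨hA.knArc, sub_eq_zero.1 (c.knTangent_eq_zero _ (fun i ↦ ?_) (fun i ↦ ?_)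
    fun i hi ↦ ?_)⟩
  · rw [KNTangent.d_sub_vec, h1, sub_self]
  · rw [KNTangent.dC_sub_vec, h2, hη, sub_self]
  · rw [KNTangent.proj_apply, KNTangent.dC_sub_vec, ← KNTangent.proj_apply, h3 i hi,
      ← KNTangent.proj_apply, sub_self]

theorem mem_nonnegTangent_iff {v : KNTangent π D x} : v ∈ (KN π D).nonnegTangent x ↔
    ∀ i, 0 ≤ v.d (absRep x (c.m i)) := by
  constructor
  · exact fun h i ↦ KNTangent.mem_nonnegTangent_iff.1 h _ (smoothAt_absRep x _)
      (.of_forall fun _ ↦ norm_nonneg _) (c.absRep_eq_zero i)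
  · intro h γ hγ h0
    -- A vector with some zero radial components need not come from a regular arc. Adding a small
    -- positive multiple of an inward velocity makes all of them positive; then the multiple tends
    -- to `0`.
    obtain ⟨A, hA⟩ := c.exists_knArc (ρ := fun _ ↦ 1) fun _ ↦ one_pos
    have h1 : Filter.Tendsto (fun t : ℝ ↦ v.1 γ + t * A.velocity.1 γ) (𝓝[>] 0)
        (𝓝 (v.1 γ + 0 * A.velocity.1 γ)) :=
      (Continuous.tendsto (by fun_prop) 0).mono_left nhdsWithin_le_nhds
    rw [zero_mul, add_zero] at h1
    refine ge_of_tendsto h1 ?_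
    filter_upwards [self_mem_nhdsWithin] with t ht
    obtain ⟨B, hB⟩ := c.exists_eq_velocity (v := v + t • A.velocity) fun i ↦ by
      rw [KNTangent.d_vadd, KNTangent.d_smul, hA, mul_one]
      exact add_pos_of_nonneg_of_pos (h i) ht
    have h2 := B.velocity_nonneg γ hγ h0
    rw [hB] at h2
    exact h2

/-- An interior vector stays nonnegative after subtracting a small multiple of an inward vector, so
its radial components are positive. Conversely these are finitely many strict inequalities between
continuous functions. -/
theorem mem_posTangent_iff {v : KNTangent π D x} : v ∈ (KN π D).posTangent x ↔
    ∀ i, 0 < v.d (absRep x (c.m i)) := by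
  constructor
  · intro h i
    obtain ⟨A, hA⟩ := c.exists_knArc (ρ := fun _ ↦ 1) fun _ ↦ one_pos
    have h1 : Filter.Tendsto (fun t : ℝ ↦ v - t • A.velocity) (𝓝 0)
        (𝓝 (v - (0 : ℝ) • A.velocity)) := Continuous.tendsto (by fun_prop) 0
    rw [zero_smul, sub_zero] at h1
    have h2 := h1.eventually (mem_interior_iff_mem_nhds.1 h)
    obtain ⟨t, ht, ht0⟩ := ((h2.filter_mono nhdsWithin_le_nhds).and
      (self_mem_nhdsWithin (s := Set.Ioi 0))).exists
    have h3 := c.mem_nonnegTangent_iff.1 ht i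
    rw [KNTangent.d_sub_vec, KNTangent.d_smul, hA, mul_one] at h3
    exact lt_of_lt_of_le ht0 (sub_nonneg.1 h3)
  · intro h
    have h1 : IsOpen {v : KNTangent π D x | ∀ i, 0 < v.d (absRep x (c.m i))} := by
      simp only [Set.ofPred_forall]
      exact isOpen_iInter_of_finite fun i ↦
        isOpen_lt continuous_const (KNTangent.continuous_d _)
    exact interior_maximal (fun w hw ↦ c.mem_nonnegTangent_iff.2 fun i ↦ (hw i).le) h1 h

theorem mem_tangentFace_iff {v : KNTangent π D x} : v ∈ (KN π D).tangentFace x ↔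
    ∀ i, v.d (absRep x (c.m i)) = 0 := by
  rw [KNTangent.mem_tangentFace_iff, c.mem_nonnegTangent_iff, c.mem_nonnegTangent_iff,
    ← forall_and]
  refine forall_congr' fun i ↦ ?_
  rw [KNTangent.d_neg_vec, neg_nonneg, and_comm, ← le_antisymm_iff]

theorem mkQ_face_eq_iff {v w : KNTangent π D x} :
    ((KN π D).tangentFace x).mkQ v = ((KN π D).tangentFace x).mkQ w ↔
      ∀ i, v.d (absRep x (c.m i)) = w.d (absRep x (c.m i)) := by
  rw [Submodule.mkQ_apply, Submodule.mkQ_apply, Submodule.Quotient.eq, c.mem_tangentFace_iff]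
  refine forall_congr' fun i ↦ ?_
  rw [KNTangent.d_sub_vec, sub_eq_zero]

theorem exists_pos {ρ : c.S₀ → ℝ} (hρ : ∀ i, 0 < ρ i) :
    ∃ v ∈ (KN π D).posTangent x, ∀ i, KNTangent.d v (absRep x (c.m i)) = ρ i := by
  obtain ⟨A, hA⟩ := c.exists_knArc hρ
  refine ⟨A.velocity, c.mem_posTangent_iff.2 fun i ↦ ?_, hA⟩
  rw [hA]
  exact hρ i

/-- A section of the log structure is a unit, or a local equation of a branch, or vanishes to
second order in the boundary coordinates. -/
theorem cases_stalkM (m : stalkM D x.pt) : IsUnit (m : stalk x.pt) ∨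
    (∃ (i : c.S₀) (b : stalkM D x.pt), IsUnit (b : stalk x.pt) ∧ m = b * c.m i) ∨
      (stalkEval x.pt m = 0 ∧ ∀ v : KNTangent π D x, v.d (absRep x m) = 0) := by
  have heval (i : c.S₀) (b : stalkM D x.pt) :
      stalkEval x.pt ((b * c.m i : stalkM D x.pt) : stalk x.pt) = 0 := by
    rw [Submonoid.coe_mul, map_mul, c.eval_m, mul_zero]
  have hzero (m n : stalkM D x.pt) (hm : stalkEval x.pt m = 0) (hn : stalkEval x.pt n = 0) :
      stalkEval x.pt ((m * n : stalkM D x.pt) : stalk x.pt) = 0 ∧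
        ∀ v : KNTangent π D x, v.d (absRep x (m * n)) = 0 := by
    rw [Submonoid.coe_mul, map_mul, hm, zero_mul]
    refine ⟨rfl, fun v ↦ ?_⟩
    rw [v.d_absRep_mul, hm, hn, norm_zero, zero_mul, zero_mul, add_zero]
  have hthird (m n : stalkM D x.pt)
      (hm : stalkEval x.pt m = 0 ∧ ∀ v : KNTangent π D x, v.d (absRep x m) = 0) :
      stalkEval x.pt ((m * n : stalkM D x.pt) : stalk x.pt) = 0 ∧
        ∀ v : KNTangent π D x, v.d (absRep x (m * n)) = 0 := by
    rw [Submonoid.coe_mul, map_mul, hm.1, zero_mul]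
    refine ⟨rfl, fun v ↦ ?_⟩
    rw [v.d_absRep_mul, hm.1, hm.2, norm_zero, zero_mul, mul_zero, add_zero]
  refine c.stalkM_induction x.pt_str (P := fun m ↦ IsUnit (m : stalk x.pt) ∨
    (∃ (i : c.S₀) (b : stalkM D x.pt), IsUnit (b : stalk x.pt) ∧ m = b * c.m i) ∨
      (stalkEval x.pt m = 0 ∧ ∀ v : KNTangent π D x, v.d (absRep x m) = 0))
    (fun m hm ↦ .inl hm) (fun i ↦ .inr (.inl ⟨i, 1, isUnit_one, (one_mul _).symm⟩)) ?_ m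
  intro m n hm hn
  rcases hm with hm | ⟨i, b, hb, rfl⟩ | hm
  · rcases hn with hn | ⟨i, b, hb, rfl⟩ | hn
    · exact .inl (hm.mul hn)
    · exact .inr (.inl ⟨i, m * b, hm.mul hb, (mul_assoc _ _ _).symm⟩)
    · rw [mul_comm m n]
      exact .inr (.inr (hthird n m hn))
  · rcases hn with hn | ⟨j, b', hb', rfl⟩ | hn
    · refine .inr (.inl ⟨i, n * b, hn.mul hb, ?_⟩)
      rw [mul_comm _ n, mul_assoc]
    · exact .inr (.inr (hzero _ _ (heval i b) (heval j b')))
    · rw [mul_comm _ n]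
      exact .inr (.inr (hthird n _ hn))
  · exact .inr (.inr (hthird m n hm))

/-- Writing `h = g |m|`, vanishing at `x` with nonzero differential forces `m` to be a unit times
some `g_i`. Then both sides are the same multiple of the value on `|g_i|`. -/
theorem eval_eq_d {σ : (KNPoint π D → ℝ) → ℝ} (hσ : IsPosEval x σ) {v : KNTangent π D x}
    (hv : ∀ i, v.d (absRep x (c.m i)) = σ (absRep x (c.m i))) {h : KNPoint π D → ℝ}
    (hh : KNMonomialAt h x) (h0 : h x = 0) (hd : ∃ t : KNTangent π D x, t.d h ≠ 0) :
    σ h = v.d h := by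
  obtain ⟨g, m, hg, hpos, H⟩ := knMonomialAt_iff.1 hh
  have hgx : 0 < g x := hpos.self_of_nhds
  have hm : stalkEval x.pt m = 0 := by
    have := H.self_of_nhds
    rw [h0, Pi.mul_apply, absRep_self] at this
    exact norm_eq_zero.1 ((mul_eq_zero.1 this.symm).resolve_left hgx.ne')
  have key (t : KNTangent π D x) : t.d h = g x * t.d (absRep x m) := by
    rw [t.d_congr H, t.d_mul hg (smoothAt_absRep x m), absRep_self, hm, norm_zero, zero_mul,
      add_zero]
  rw [hσ.eq hg hpos H, key]
  congr 1
  rcases c.cases_stalkM m with h1 | ⟨i, b, hb, rfl⟩ | h1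
  · exact absurd hm (isUnit_stalk_iff.1 h1)
  · rw [hσ.absRep_mul, hσ.unit hb, v.d_absRep_mul, hv, c.eval_m, norm_zero, zero_mul, add_zero]
  · obtain ⟨t, ht⟩ := hd
    rw [key, h1.2, mul_zero] at ht
    exact absurd rfl ht

end Chart

theorem germ_sectionFun {V : Opens (KN π D).space} (r : (KN π D).M.obj (op V)) {x : KNPoint π D}
    (hx : x ∈ V) (v : KNTangent π D x) :
    v.1 ((KN π D).germ ((KN π D).α_smooth V r) hx) = v.d (sectionFun r) :=
  (v.d_eq (mem_smoothGerms_iff.2 (knMonomialAt_sectionFun r hx).smoothAt)).symm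

theorem SmoothMatches.of_eval {x : KNPoint π D} (c : Chart π D x.pt) {s : KNWeakPoint π D}
    (hs : s.pt = x) {v : KNTangent π D x} (hpos : v ∈ (KN π D).posTangent x)
    (hv : ∀ i, v.d (absRep x (c.m i)) = s.eval (absRep x (c.m i))) :
    SmoothMatches s ⟨x, ((KN π D).tangentFace x).mkQ v, v, hpos, rfl⟩ := by
  subst hs
  refine ⟨_, ⟨v, hpos, rfl⟩, rfl, fun V hV r h0 ht w hw ↦ ?_⟩
  rw [germ_sectionFun r hV, s.value_eq_eval hV r .rfl]
  refine c.eval_eq_d s.isPosEval (fun i ↦ ?_) (knMonomialAt_sectionFun r hV)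
    ((sectionFun_apply r hV).trans h0) ?_
  · rw [c.mkQ_face_eq_iff.1 hw, hv]
  · obtain ⟨t, ht⟩ := ht
    exact ⟨t, by rwa [germ_sectionFun r hV] at ht⟩

theorem SmoothMatches.pt_eq {s : KNWeakPoint π D} {b : (KN π D).TangentialBasepoint}
    (h : SmoothMatches s b) : s.pt = b.pt := by
  obtain ⟨vec, pos, rfl, -⟩ := h
  rfl

/-- The matching condition is tested on `r = |g_i|`, whose differential is nonzero because a vector
with radial components `1` exists. -/
theorem SmoothMatches.eval_eq {s : KNWeakPoint π D} {b : (KN π D).TangentialBasepoint}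
    (h : SmoothMatches s b) (c : Chart π D (basepointPt b).pt)
    {v : KNTangent π D (basepointPt b)} (hv : ((KN π D).tangentFace b.pt).mkQ v = b.vec)
    (i : c.S₀) : s.eval (absRep (basepointPt b) (c.m i)) = v.d (absRep (basepointPt b) (c.m i)) := by
  obtain ⟨vec, pos, rfl, H⟩ := h
  change Chart π D s.pt.pt at c
  change KNTangent π D s.pt at v
  change s.eval (absRep s.pt (c.m i)) = v.d (absRep s.pt (c.m i))
  have h1 : KNMonomialAt (absRep s.pt (c.m i)) s.pt := knMonomialAt_absRep _ _
  have hV : s.pt ∈ monomialDomain (absRep s.pt (c.m i)) := h1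
  have h2 := sectionFun_monomialSection (h := absRep s.pt (c.m i)) (fun _ hx ↦ hx) hV
  obtain ⟨t, -, ht⟩ := c.exists_pos (ρ := fun _ ↦ 1) fun _ ↦ one_pos
  have h3 := H _ hV (monomialSection fun _ hx ↦ hx) (c.absRep_eq_zero i)
    ⟨t, by
      rw [germ_sectionFun, KNTangent.d_congr _ h2]
      exact ((ht i).trans_ne one_ne_zero)⟩ v hv
  rwa [germ_sectionFun, v.d_congr h2, s.value_eq_eval hV _ h2] at h3

theorem SmoothMatches.existsUnique_right (hD : IsNormalCrossing π D) [Smooth π] [IsSeparated π]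
    [QuasiCompact π] (s : KNWeakPoint π D) : ∃! b, SmoothMatches s b := by
  obtain ⟨c⟩ := exists_chart hD s.pt.pt
  obtain ⟨v, hv, hvd⟩ := c.exists_pos (ρ := fun i ↦ s.eval (absRep s.pt (c.m i)))
    fun i ↦ s.isPosEval.pos (knMonomialAt_absRep _ _)
  refine ⟨_, .of_eval c rfl hv hvd, fun b hb ↦ ?_⟩
  have hb' := hb
  obtain ⟨_, ⟨w, hw, rfl⟩, rfl, -⟩ := hb
  congr 1
  refine c.mkQ_face_eq_iff.2 fun i ↦ ?_
  exact (hb'.eval_eq c rfl i).symm.trans (hvd i).symm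

theorem SmoothMatches.existsUnique_left (hD : IsNormalCrossing π D) [Smooth π] [IsSeparated π]
    [QuasiCompact π] (b : (KN π D).TangentialBasepoint) : ∃! s, SmoothMatches s b := by
  obtain ⟨x, _, v, hv, rfl⟩ := b
  change KNPoint π D at x
  obtain ⟨c⟩ := exists_chart hD x.pt
  obtain ⟨σ, hσ, hσv⟩ := c.exists_isPosEval (c.mem_posTangent_iff.1 hv)
  refine ⟨KNWeakPoint.ofEval x σ hσ, .of_eval c rfl hv fun i ↦ ?_, fun s hs ↦ ?_⟩
  · rw [KNWeakPoint.ofEval_eval x σ hσ (knMonomialAt_absRep x _), hσv]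
  · have hpt : s.pt = x := hs.pt_eq
    refine KNWeakPoint.ext_eval hpt fun g hg ↦ ?_
    rw [hpt] at hg
    rw [KNWeakPoint.ofEval_eval x σ hσ hg]
    refine IsPosEval.ext (hpt ▸ s.isPosEval) hσ c (fun i ↦ ?_) hg
    exact (hs.eval_eq c rfl i).trans (hσv i).symm

end TangentCone

/-! ### Schemes étale over `Spec ℂ` -/

section EtaleOverPoint

theorem isReduced_and_isArtinianRing_of_etale {R : Type} [CommRing R] {φ : ℂ →+* R}
    (hφ : φ.Etale) : _root_.IsReduced R ∧ IsArtinianRing R := by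
  algebraize [φ]
  have := Algebra.FormallyUnramified.finite_of_free ℂ R
  exact ⟨Algebra.FormallyUnramified.isReduced_of_field ℂ R, IsArtinianRing.of_finite ℂ R⟩

variable {Z : Scheme.{0}} (q : Z ⟶ Spec (.of ℂ)) [Etale q]

/-- Affine locally the ring is étale over `ℂ`, hence finite and reduced. So the scheme is discrete
and its functions are families of complex numbers. -/
theorem isReduced_and_isLocallyArtinian_of_etale {Z : Scheme.{0}} (q : Z ⟶ Spec (.of ℂ))
    [Etale q] : IsReduced Z ∧ IsLocallyArtinian Z := by
  have key (i : Z.affineCover.I₀) :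
      IsReduced (Z.affineCover.X i) ∧ IsLocallyArtinian (Z.affineCover.X i) := by
    have h0 : Etale (Z.affineCover.f i ≫ q) := inferInstance
    obtain ⟨φ, hφ⟩ := Spec.map_surjective (Z.affineCover.f i ≫ q)
    have h1 : Etale (Spec.map φ) := hφ.symm ▸ h0
    have h2 : φ.hom.Etale := (HasRingHomProperty.Spec_iff (P := @Etale)).1 h1
    obtain ⟨h3, h4⟩ := isReduced_and_isArtinianRing_of_etale h2
    exact ⟨affine_isReduced_iff _ |>.2 h3, Scheme.isLocallyArtinianScheme_Spec.2 h4⟩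
  exact ⟨(IsReduced.iff_of_openCover _ Z.affineCover).2 fun i ↦ (key i).1,
    (isLocallyArtinian_iff_openCover Z.affineCover).2 fun i ↦ (key i).2⟩

theorem appTop_eq_zero_iff {a : Spec (.of ℂ) ⟶ Z} {f : Γ(Z, ⊤)} :
    a.appTop f = 0 ↔ a default ∉ Z.basicOpen f := by
  have h1 := Scheme.preimage_basicOpen_top a f
  have h2 : a default ∈ Z.basicOpen f ↔ default ∈ (Spec (.of ℂ)).basicOpen (a.appTop f) := by
    rw [← h1]
    rfl
  rw [h2, ← basicOpen_eq_bot_iff]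
  constructor
  · intro h
    rw [h]
    exact id
  · intro h
    refine Opens.ext (Set.eq_empty_of_forall_notMem fun x hx ↦ h ?_)
    rwa [Subsingleton.elim x default] at hx

theorem exists_section_of_etale (z : Z) : ∃ a : Spec (.of ℂ) ⟶ Z, a ≫ q = 𝟙 _ ∧ a default = z := by
  have := (isReduced_and_isLocallyArtinian_of_etale q).2
  have hz : IsClosed {z} := isClosed_discrete _
  refine ⟨pointOfClosedPoint q z hz, pointOfClosedPoint_comp q z hz, pointOfClosedPoint_apply q z hz _⟩

/-- Every point is the image of a section, and on a reduced scheme a function with empty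
nonvanishing locus is zero. -/
theorem eq_of_forall_section {f g : Γ(Z, ⊤)}
    (h : ∀ a : Spec (.of ℂ) ⟶ Z, a ≫ q = 𝟙 _ → a.appTop f = a.appTop g) : f = g := by
  have := (isReduced_and_isLocallyArtinian_of_etale q).1
  rw [← sub_eq_zero, ← basicOpen_eq_bot_iff]
  refine Opens.ext (Set.eq_empty_of_forall_notMem fun z hz ↦ ?_)
  obtain ⟨a, ha, rfl⟩ := exists_section_of_etale q z
  refine appTop_eq_zero_iff.1 ?_ hz
  rw [map_sub, h a ha, sub_self]

/-- Points are open, so constants prescribed independently at the points glue. -/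
theorem exists_forall_section (b : (Spec (.of ℂ) ⟶ Z) → Γ(Spec (.of ℂ), ⊤)) :
    ∃ f : Γ(Z, ⊤), ∀ a : Spec (.of ℂ) ⟶ Z, a ≫ q = 𝟙 _ → a.appTop f = b a := by
  have := (isReduced_and_isLocallyArtinian_of_etale q).2
  choose s hs hsz using exists_section_of_etale q
  let V (z : Z) : Z.Opens := ⟨{z}, isOpen_discrete _⟩
  let k (z : Z) : Γ(Z, ⊤) := q.appTop (b (s z))
  obtain ⟨f, hf, -⟩ := Z.sheaf.existsUnique_gluing' V ⊤ (fun z ↦ homOfLE le_top)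
    (fun z _ ↦ Opens.mem_iSup.2 ⟨z, rfl⟩) (fun z ↦ Z.presheaf.map (homOfLE le_top).op (k z))
    (fun z z' ↦ by
      by_cases h : z = z'
      · subst h
        rfl
      · have h1 : V z ⊓ V z' = ⊥ := by
          refine Opens.ext (Set.eq_empty_of_forall_notMem fun y hy ↦ h ?_)
          exact hy.1.symm.trans hy.2
        have : Subsingleton Γ(Z, V z ⊓ V z') := by
          rw [h1]
          infer_instance
        exact @Subsingleton.elim _ this _ _)
  change Γ(Z, ⊤) at f
  refine ⟨f, fun a ha ↦ ?_⟩
  have has : s (a default) = a := ext_of_apply_closedPoint_eq q (hs _) ha (by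
    rw [Subsingleton.elim (IsLocalRing.closedPoint ℂ) (default : Spec (.of ℂ))]
    exact hsz (a default))
  have h1 : a.appTop (k (a default)) = b a := by
    have h2 : q.appTop ≫ a.appTop = 𝟙 _ := by
      rw [← Scheme.Hom.comp_appTop, ha]
      rfl
    change a.appTop (q.appTop (b (s (a default)))) = b a
    rw [has]
    exact congr($h2 (b a))
  rw [← h1, ← sub_eq_zero, ← map_sub, appTop_eq_zero_iff]
  intro h
  have h2 : Z.presheaf.map (homOfLE (le_top : V (a default) ≤ ⊤)).op (f - k (a default)) = 0 := by
    rw [map_sub, sub_eq_zero]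
    exact hf (a default)
  have h3 := Z.basicOpen_res (f - k (a default)) (homOfLE (le_top : V (a default) ≤ ⊤)).op
  rw [h2, Scheme.basicOpen_zero] at h3
  have h4 : a default ∈ V (a default) ⊓ Z.basicOpen (f - k (a default)) := ⟨rfl, h⟩
  rw [← h3] at h4
  exact h4

theorem isUnit_of_forall_section {f : Γ(Z, ⊤)}
    (h : ∀ a : Spec (.of ℂ) ⟶ Z, a ≫ q = 𝟙 _ → a.appTop f ≠ 0) : IsUnit f := by
  have h1 : Z.basicOpen f = ⊤ := by
    rw [eq_top_iff]
    intro z _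
    obtain ⟨a, ha, rfl⟩ := exists_section_of_etale q z
    by_contra h0
    exact h a ha (appTop_eq_zero_iff.2 h0)
  refine Z.toRingedSpace.isUnit_of_isUnit_germ _ _ fun x hx ↦ ?_
  have hx' : x ∈ Z.basicOpen f := by rw [h1]; trivial
  exact (Scheme.mem_basicOpen_top Z _ x).1 hx'

end EtaleOverPoint

/-! ### Weak points of `Y log D` as homomorphisms on the stalk -/

section AlgWeakPoints

variable {Y : Scheme.{0}} {π : Y ⟶ Spec (.of ℂ)} {D : Y.IdealSheafData}

/-- The point of the fibre of `U` over `p` given by a lift. -/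
def Lift.fibreSection {p : Spec (.of ℂ) ⟶ Y} {U : Y.Etale} (u : Lift p U) :
    Spec (.of ℂ) ⟶ ((etalePullback p).obj U).left :=
  pullback.lift u.toHom (𝟙 _) (u.toHom_comp.trans (Category.id_comp _).symm)

theorem Lift.fibreSection_fst {p : Spec (.of ℂ) ⟶ Y} {U : Y.Etale} (u : Lift p U) :
    u.fibreSection ≫ etalePullbackFst p U = u.toHom := pullback.lift_fst _ _ _

theorem Lift.fibreSection_hom {p : Spec (.of ℂ) ⟶ Y} {U : Y.Etale} (u : Lift p U) :
    u.fibreSection ≫ ((etalePullback p).obj U).hom = 𝟙 _ := pullback.lift_snd _ _ _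

/-- By the universal property of the fibre product, the `ℂ`-points of the fibre of `U` over `p` are
the lifts of `p` to `U`. Functions on the fibre are therefore functions on the set of lifts. -/
theorem exists_eq_fibreSection {p : Spec (.of ℂ) ⟶ Y} {U : Y.Etale}
    {a : Spec (.of ℂ) ⟶ ((etalePullback p).obj U).left}
    (ha : a ≫ ((etalePullback p).obj U).hom = 𝟙 _) : ∃ u : Lift p U, u.fibreSection = a := by
  have h1 : a ≫ pullback.snd U.hom p = 𝟙 _ := ha
  have h2 : (a ≫ etalePullbackFst p U) ≫ U.hom = p := by
    refine (Category.assoc _ _ _).trans ?_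
    refine (congrArg (a ≫ ·) (pullback.condition (f := U.hom) (g := p))).trans ?_
    refine (Category.assoc _ _ _).symm.trans ?_
    exact (congrArg (· ≫ p) h1).trans (Category.id_comp p)
  refine ⟨Lift.mk _ h2, pullback.hom_ext ?_ ?_⟩
  · exact Lift.fibreSection_fst _
  · exact (Lift.fibreSection_hom _).trans h1.symm

theorem Lift.fibreSection_map {p : Spec (.of ℂ) ⟶ Y} {U V : Y.Etale} (u : Lift p U) (j : U ⟶ V) :
    u.fibreSection ≫ ((etalePullback p).map j).left = (u.map j).fibreSection := by
  refine pullback.hom_ext ?_ ?_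
  · refine Eq.trans ?_ (u.map j).fibreSection_fst.symm
    have h : ((etalePullback p).map j).left ≫ pullback.fst V.hom p =
        pullback.fst U.hom p ≫ j.left := pullback.lift_fst _ _ _
    refine (Category.assoc _ _ _).trans ?_
    refine (congrArg (u.fibreSection ≫ ·) h).trans ?_
    refine (Category.assoc _ _ _).symm.trans ?_
    exact congrArg (· ≫ j.left) u.fibreSection_fst
  · refine Eq.trans ?_ (u.map j).fibreSection_hom.symm
    have h : ((etalePullback p).map j).left ≫ pullback.snd V.hom p =
        pullback.snd U.hom p := pullback.lift_snd _ _ _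
    refine (Category.assoc _ _ _).trans ?_
    exact (congrArg (u.fibreSection ≫ ·) h).trans u.fibreSection_hom

/-- The value at a lift of a function on the fibre over `p`. -/
def Lift.fibreEval {p : Spec (.of ℂ) ⟶ Y} {U : Y.Etale} (u : Lift p U) :
    Γ(((etalePullback p).obj U).left, ⊤) →+* ℂ :=
  (Scheme.ΓSpecIso (.of ℂ)).hom.hom.comp u.fibreSection.appTop.hom

theorem Lift.fibreEval_map {p : Spec (.of ℂ) ⟶ Y} {U V : Y.Etale} (u : Lift p U) (j : U ⟶ V)
    (f : Γ(((etalePullback p).obj V).left, ⊤)) :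
    u.fibreEval (((etalePullback p).map j).left.appTop f) = (u.map j).fibreEval f := by
  change _ = (Scheme.ΓSpecIso (.of ℂ)).hom.hom ((u.map j).fibreSection.appTop.hom f)
  rw [← u.fibreSection_map j]
  rw [Scheme.Hom.comp_appTop]
  rfl

theorem Lift.fibreEval_fst {p : Spec (.of ℂ) ⟶ Y} {U : Y.Etale} (u : Lift p U)
    (f : Γ(U.left, ⊤)) : u.fibreEval ((etalePullbackFst p U).appTop f) = u.eval f := by
  change _ = (Scheme.ΓSpecIso (.of ℂ)).hom.hom (u.toHom.appTop.hom f)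
  rw [← u.fibreSection_fst, Scheme.Hom.comp_appTop]
  rfl

theorem ΓSpecIso_hom_injective :
    Function.Injective (Scheme.ΓSpecIso (.of ℂ)).hom.hom :=
  (ConcreteCategory.bijective_of_isIso (Scheme.ΓSpecIso (.of ℂ)).hom).1

theorem eq_of_fibreEval {p : Spec (.of ℂ) ⟶ Y} {U : Y.Etale}
    {f g : Γ(((etalePullback p).obj U).left, ⊤)}
    (h : ∀ u : Lift p U, u.fibreEval f = u.fibreEval g) : f = g := by
  refine eq_of_forall_section ((etalePullback p).obj U).hom fun a ha ↦ ?_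
  obtain ⟨u, rfl⟩ := exists_eq_fibreSection ha
  exact ΓSpecIso_hom_injective (h u)

open Classical in
theorem exists_fibreEval_eq {p : Spec (.of ℂ) ⟶ Y} {U : Y.Etale} (b : Lift p U → ℂ) :
    ∃ f : Γ(((etalePullback p).obj U).left, ⊤), ∀ u : Lift p U, u.fibreEval f = b u := by
  obtain ⟨f, hf⟩ := exists_forall_section ((etalePullback p).obj U).hom fun a ↦
    if h : ∃ u : Lift p U, u.fibreSection = a then
      (Scheme.ΓSpecIso (.of ℂ)).inv.hom (b h.choose) else 0
  refine ⟨f, fun u ↦ ?_⟩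
  have h : ∃ v : Lift p U, v.fibreSection = u.fibreSection := ⟨u, rfl⟩
  have hu : h.choose = u := Lift.ext_toHom (by
    rw [← Lift.fibreSection_fst, h.choose_spec, Lift.fibreSection_fst])
  have h1 := hf _ u.fibreSection_hom
  rw [dif_pos h, hu] at h1
  change (Scheme.ΓSpecIso (.of ℂ)).hom.hom (u.fibreSection.appTop.hom f) = b u
  rw [show u.fibreSection.appTop.hom f = _ from h1]
  exact congr($((Scheme.ΓSpecIso (.of ℂ)).inv_hom_id) (b u))

theorem isUnit_of_fibreEval {p : Spec (.of ℂ) ⟶ Y} {U : Y.Etale}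
    {f : Γ(((etalePullback p).obj U).left, ⊤)} (h : ∀ u : Lift p U, u.fibreEval f ≠ 0) :
    IsUnit f := by
  refine isUnit_of_forall_section ((etalePullback p).obj U).hom fun a ha h0 ↦ ?_
  obtain ⟨u, rfl⟩ := exists_eq_fibreSection ha
  refine h u ?_
  change (Scheme.ΓSpecIso (.of ℂ)).hom.hom (u.fibreSection.appTop f) = 0
  rw [h0, map_zero]

theorem mem_logSections_top_iff {X : Scheme.{0}} {V : X.Etale} {f : Γ(V.left, ⊤)} :
    f ∈ logSections X ⊤ V ↔ IsUnit f := by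
  constructor
  · intro h
    have h1 : V.left.basicOpen f = ⊤ := top_le_iff.1 h
    refine V.left.toRingedSpace.isUnit_of_isUnit_germ _ _ fun x hx ↦ ?_
    have hx' : x ∈ V.left.basicOpen f := by rw [h1]; trivial
    exact (Scheme.mem_basicOpen_top V.left _ x).1 hx'
  · intro h
    change V.hom ⁻¹ᵁ ⊤ ≤ V.left.basicOpen f
    rw [Scheme.basicOpen_of_isUnit _ h]
    exact le_top

namespace AlgWeakPoint

variable (w : AlgWeakPoint π D)

/-- The pullback of a section of the log structure to the fibre. -/
def pullFun {U : Y.Etale} (m : logSections Y (divisorCompl D) U) :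
    Γ(((etalePullback w.pt).obj U).left, ⊤) :=
  LogScheme.point.α ((etalePullback w.base).obj U) (w.pull.app (op U) m)

theorem value_eq {U : Y.Etale} (u : Lift w.pt U) (m : logSections Y (divisorCompl D) U) :
    w.value u m = u.fibreEval (w.pullFun m) := rfl

theorem pullFun_map {U V : Y.Etale} (j : U ⟶ V) (m : logSections Y (divisorCompl D) V) :
    w.pullFun (logSectionsMap _ j m) = ((etalePullback w.pt).map j).left.appTop (w.pullFun m) := by
  have h1 := congr($(w.pull.naturality j.op) m)
  exact (congrArg (LogScheme.point.α ((etalePullback w.base).obj U)) h1).trans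
    (LogScheme.point.α_naturality ((etalePullback w.base).map j) _)

theorem value_map {U V : Y.Etale} (j : U ⟶ V) (u : Lift w.pt U)
    (m : logSections Y (divisorCompl D) V) :
    w.value u (logSectionsMap _ j m) = w.value (u.map j) m := by
  rw [value_eq, pullFun_map, Lift.fibreEval_map, value_eq]

theorem value_mul {U : Y.Etale} (u : Lift w.pt U) (m n : logSections Y (divisorCompl D) U) :
    w.value u (m * n) = w.value u m * w.value u n := by
  have h : w.pullFun (m * n) = w.pullFun m * w.pullFun n := by
    refine Eq.trans ?_ (map_mul (LogScheme.point.α ((etalePullback w.base).obj U)) _ _)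
    exact congrArg _ (map_mul (w.pull.app (op U)).hom m n)
  rw [value_eq, h, map_mul, value_eq, value_eq]

theorem value_ne_zero {U : Y.Etale} (u : Lift w.pt U) (m : logSections Y (divisorCompl D) U) :
    w.value u m ≠ 0 := by
  have h : IsUnit (w.pullFun m) := mem_logSections_top_iff.1 (w.pull.app (op U) m).2
  exact (h.map u.fibreEval).ne_zero

theorem value_unit {U : Y.Etale} (u : Lift w.pt U) {m : logSections Y (divisorCompl D) U}
    (hm : IsUnit m.1) : w.value u m = u.eval m.1 := by
  have h : w.pullFun m = (etalePullbackFst w.pt U).appTop m.1 := w.pull_unit U m hm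
  rw [value_eq, h, Lift.fibreEval_fst]

theorem value_congr {U V : Y.Etale} {u : Lift w.pt U} {v : Lift w.pt V}
    {m : logSections Y (divisorCompl D) U} {n : logSections Y (divisorCompl D) V}
    (h : u.germM D m = v.germM D n) : w.value u m = w.value v n := by
  obtain ⟨W, a, i, j, rfl, rfl, hij⟩ := Lift.germ_eq_iff.1 (congrArg Subtype.val h)
  rw [← value_map, ← value_map]
  exact congrArg _ (Subtype.ext hij)

/-- Naturality of the pullback makes the value at a lift depend only on the germ (`value_congr`), so
it defines a map on the stalk. -/
theorem exists_hom : ∃ φ : stalkM D w.pt →* ℂ, ∀ (U : Y.Etale) (u : Lift w.pt U)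
    (m : logSections Y (divisorCompl D) U), φ (u.germM D m) = w.value u m := by
  choose V v n h using fun m : stalkM D w.pt ↦ exists_germM_eq m
  let f (m : stalkM D w.pt) : ℂ := w.value (v m) (n m)
  have key (U : Y.Etale) (u : Lift w.pt U) (m : logSections Y (divisorCompl D) U) :
      f (u.germM D m) = w.value u m := w.value_congr (h _)
  refine ⟨⟨⟨f, ?_⟩, fun m m' ↦ ?_⟩, key⟩
  · have h1 : (Lift.self w.pt).germM D 1 = 1 := Subtype.ext (map_one _)
    rw [← h1, key, w.value_unit _ isUnit_one]
    exact map_one _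
  · obtain ⟨U, u, m, n, rfl, rfl⟩ := exists_germM_eq₂ m m'
    change f (u.germM D m * u.germM D n) = f (u.germM D m) * f (u.germM D n)
    rw [← Lift.germM_mul, key, key, key, value_mul]

/-- The homomorphism on the stalk of the log structure given by a weak point. -/
def hom : stalkM D w.pt →* ℂ := w.exists_hom.choose

theorem hom_germM {U : Y.Etale} (u : Lift w.pt U) (m : logSections Y (divisorCompl D) U) :
    w.hom (u.germM D m) = w.value u m := w.exists_hom.choose_spec U u m

theorem hom_ne_zero (m : stalkM D w.pt) : w.hom m ≠ 0 := by
  obtain ⟨U, u, m, rfl⟩ := exists_germM_eq m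
  rw [hom_germM]
  exact w.value_ne_zero u m

theorem hom_unit {m : stalkM D w.pt} (hm : IsUnit (m : stalk w.pt)) :
    w.hom m = stalkEval w.pt m := by
  obtain ⟨U, u, m, rfl⟩ := exists_germM_eq m
  have h0 : stalkEval w.pt (u.germM D m : stalkM D w.pt) = u.eval m.1 := stalkEval_germ _ _
  have h1 : u.eval m.1 ≠ 0 := by
    rw [← h0]
    exact isUnit_stalk_iff.1 hm
  obtain ⟨W, j, v, -, rfl, h2⟩ := u.exists_affine_isUnit m.1 h1
  rw [hom_germM, h0, ← value_map, w.value_unit v (m := logSectionsMap _ j m) h2]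
  exact Lift.eval_map j v m.1

/-- A section of the trivial log structure on the fibre is determined by its values at the lifts. -/
theorem ext_hom {w w' : AlgWeakPoint π D} (hpt : w.pt = w'.pt)
    (h : ∀ (U : Y.Etale) (u : Lift w.pt U) (u' : Lift w'.pt U) (_ : u.toHom = u'.toHom)
      (m : logSections Y (divisorCompl D) U), w.value u m = w'.value u' m) : w = w' := by
  obtain ⟨f, h1, q, h2⟩ := w
  obtain ⟨f', h1', q', h2'⟩ := w'
  obtain rfl : f = f' := hpt
  have : q = q' := by
    ext U m
    refine Subtype.ext (eq_of_fibreEval (p := f) (U := U.unop) fun u ↦ ?_)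
    exact h U.unop u u rfl m
  subst this
  rfl

/-- The function on the fibre given by a homomorphism on the stalk of the log structure. -/
def homFun {p : Spec (.of ℂ) ⟶ Y} (φ : stalkM D p →* ℂ) {U : Y.Etale}
    (m : logSections Y (divisorCompl D) U) : Γ(((etalePullback p).obj U).left, ⊤) :=
  (exists_fibreEval_eq fun u : Lift p U ↦ φ (u.germM D m)).choose

theorem fibreEval_homFun {p : Spec (.of ℂ) ⟶ Y} (φ : stalkM D p →* ℂ) {U : Y.Etale}
    (m : logSections Y (divisorCompl D) U) (u : Lift p U) :
    u.fibreEval (homFun φ m) = φ (u.germM D m) :=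
  (exists_fibreEval_eq fun u : Lift p U ↦ φ (u.germM D m)).choose_spec u

/-- The weak point given by a homomorphism on the stalk of the log structure. -/
def ofHom (p : Spec (.of ℂ) ⟶ Y) (hp : p ≫ π = 𝟙 _) (φ : stalkM D p →* ℂ) (h0 : ∀ m, φ m ≠ 0)
    (hφ : ∀ m : stalkM D p, IsUnit (m : stalk p) → φ m = stalkEval p m) : AlgWeakPoint π D where
  base := p
  base_str := hp
  pull :=
    { app U := CommMonCat.ofHom
        { toFun m := ⟨homFun φ m, mem_logSections_top_iff.2 (isUnit_of_fibreEval fun u ↦ by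
            exact (fibreEval_homFun φ m u).trans_ne (h0 _))⟩
          map_one' := Subtype.ext (eq_of_fibreEval fun u ↦ by
            refine (fibreEval_homFun φ _ u).trans ?_
            refine Eq.trans ?_ (map_one u.fibreEval).symm
            rw [← map_one φ]
            exact congrArg φ (Subtype.ext (map_one u.germ)))
          map_mul' m n := Subtype.ext (eq_of_fibreEval fun u ↦ by
            refine (fibreEval_homFun φ _ u).trans ?_
            refine Eq.trans ?_ (map_mul u.fibreEval _ _).symm
            refine Eq.trans ?_
              (congrArg₂ (· * ·) (fibreEval_homFun φ m u) (fibreEval_homFun φ n u)).symm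
            exact (congrArg φ (Lift.germM_mul u m n)).trans (map_mul φ _ _)) }
      naturality U V i := by
        ext m
        refine Subtype.ext (eq_of_fibreEval (p := p) (U := V.unop) fun u ↦ ?_)
        refine (fibreEval_homFun φ _ u).trans ?_
        refine Eq.trans ?_ (Lift.fibreEval_map u i.unop _).symm
        refine Eq.trans ?_ (fibreEval_homFun φ _ _).symm
        exact congrArg φ (Lift.germM_map i.unop u m) }
  pull_unit U m hm := by
    refine eq_of_fibreEval (p := p) (U := U) fun u ↦ ?_
    refine (fibreEval_homFun φ _ u).trans ?_
    refine Eq.trans ?_ (u.fibreEval_fst _).symm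
    have h1 : IsUnit ((u.germM D m : stalkM D p) : stalk p) := hm.map u.germ
    exact (hφ _ h1).trans (stalkEval_germ _ _)

theorem ofHom_value (p : Spec (.of ℂ) ⟶ Y) (hp : p ≫ π = 𝟙 _) (φ : stalkM D p →* ℂ)
    (h0 : ∀ m, φ m ≠ 0) (hφ : ∀ m : stalkM D p, IsUnit (m : stalk p) → φ m = stalkEval p m)
    {U : Y.Etale} (u : Lift p U) (m : logSections Y (divisorCompl D) U) :
    (ofHom p hp φ h0 hφ).value u m = φ (u.germM D m) :=
  fibreEval_homFun φ m u

theorem exists_eq_ofHom (w : AlgWeakPoint π D) : ∃ p hp φ h0 hφ, w = ofHom p hp φ h0 hφ := by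
  refine ⟨w.pt, w.pt_str, w.hom, w.hom_ne_zero, fun _ ↦ w.hom_unit, ext_hom rfl ?_⟩
  intro U u u' h m
  obtain rfl : u = u' := Lift.ext_toHom h
  rw [ofHom_value, hom_germM]

end AlgWeakPoint

end AlgWeakPoints

/-! ### The bijections and their compatibility -/

section Comparison

variable {Y : Scheme.{0}} {π : Y ⟶ Spec (.of ℂ)} {D : Y.IdealSheafData}
  {p : Spec (.of ℂ) ⟶ Y} {hp : p ≫ π = 𝟙 _} {φ : stalkM D p →* ℂ} {h0 : ∀ m, φ m ≠ 0}
  {hφ : ∀ m : stalkM D p, IsUnit (m : stalk p) → φ m = stalkEval p m}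

theorem knMatches_ofHom_iff {s : KNWeakPoint π D} :
    KNMatches (AlgWeakPoint.ofHom p hp φ h0 hφ) s ↔
      ∃ (arg : stalkM D p →* Circle) (arg_unit : ∀ m : stalkM D p, IsUnit (m : stalk p) →
        (arg m : ℂ) * ‖stalkEval p m‖ = stalkEval p m), s.pt = ⟨p, hp, arg, arg_unit⟩ ∧
        ∀ m : stalkM D p, (arg m : ℂ) * ‖φ m‖ = φ m ∧
          s.eval (absRep ⟨p, hp, arg, arg_unit⟩ m) = ‖φ m‖ := by
  refine exists_congr fun arg ↦ exists_congr fun arg_unit ↦ and_congr_right fun hs ↦ ?_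
  change s.pt = ⟨p, hp, arg, arg_unit⟩ at hs
  constructor
  · intro H m
    obtain ⟨U, u, m, rfl⟩ := exists_germM_eq m
    obtain ⟨h1, h2⟩ := H U u m
    rw [AlgWeakPoint.ofHom_value] at h1 h2
    refine ⟨h1, ?_⟩
    have h3 : KNMonomialAt (absRep ⟨p, hp, arg, arg_unit⟩ (u.germM D m)) s.pt := by
      rw [hs]
      exact knMonomialAt_absRep _ _
    rw [← s.value_eq_eval (V := monomialDomain _) h3 (monomialSection fun _ hx ↦ hx)
      (sectionFun_monomialSection _ h3)]
    refine h2 _ _ _ ?_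
    filter_upwards [evalRep_germ ⟨p, hp, arg, arg_unit⟩ u m.1] with y h4 h5
    exact congrArg norm h4
  · intro H U u m
    have hval : (AlgWeakPoint.ofHom p hp φ h0 hφ).value u m = φ (u.germM D m) :=
      AlgWeakPoint.ofHom_value p hp φ h0 hφ u m
    have key : (arg (Lift.germM (p := p) D u m) : ℂ) * ‖φ (Lift.germM (p := p) D u m)‖ =
          φ (Lift.germM (p := p) D u m) ∧
        ∀ (V : Opens (KN π D).space) (hV : s.pt ∈ V) (r : (KN π D).M.obj (op V)),
          (∀ᶠ y in 𝓝 (⟨⟨p, hp, arg, arg_unit⟩, u⟩ : KNOver π D U),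
            ∀ hy : y.pt ∈ V, (KN π D).α V r ⟨y.pt, hy⟩ = ‖y.lift.eval m.1‖) →
          s.value hV r = ‖φ (Lift.germM (p := p) D u m)‖ := by
      change Lift p U at u
      refine ⟨(H _).1, fun V hV r hr ↦ ?_⟩
      have hV' : ⟨p, hp, arg, arg_unit⟩ ∈ V := hs ▸ hV
      rw [← (H (u.germM D m)).2]
      refine s.value_eq_eval hV r ?_
      rw [hs]
      refine (KNOver.eventually_pt (x := ⟨p, hp, arg, arg_unit⟩) u).1 ?_
      filter_upwards [hr, evalRep_germ ⟨p, hp, arg, arg_unit⟩ u m.1,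
        (KNOver.eventually_pt (x := ⟨p, hp, arg, arg_unit⟩) u).2 (V.isOpen.mem_nhds hV')]
        with y h1 h2 h3
      refine (sectionFun_apply r h3).trans ((h1 h3).trans ?_)
      exact (congrArg norm h2).symm
    rw [hval]
    exact key

/-- It suffices to test one equation per branch: another equation differs by a unit `b`, and both
sides of the condition are multiplied by `b(p)`. -/
theorem algMatches_ofHom_iff {a : AlgBasepoint π D} (c : Chart π D p) :
    AlgMatches (AlgWeakPoint.ofHom p hp φ h0 hφ) a ↔
      ∃ (vec : ∀ q : Branch D p, branchNormal π p q.1) (ne : ∀ q, vec q ≠ 0),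
        a = ⟨p, hp, vec, ne⟩ ∧ ∀ (i : c.S₀) (v : algTangent π p),
          (branchTangent π p (c.branch hp i).1).mkQ v = vec (c.branch hp i) →
            φ (c.m i) = v.1 (c.g i) := by
  refine exists_congr fun vec ↦ exists_congr fun ne ↦ and_congr_right fun _ ↦ ?_
  constructor
  · intro H i v hv
    obtain ⟨U, u, m, hm⟩ := exists_germM_eq (c.m i)
    have hm' : u.germ m.1 = c.g i := congrArg Subtype.val hm
    have h1 := H U u m (c.branch hp i) (congrArg (fun s ↦ Ideal.span {s}) hm') v hv
    refine (congrArg φ hm).symm.trans ?_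
    refine ((AlgWeakPoint.ofHom_value p hp φ h0 hφ u m).symm.trans h1).trans ?_
    exact congrArg v.1 hm'
  · intro H U u m q hq v hv
    change Lift p U at u
    change Branch D p at q
    change algTangent π p at v
    refine (AlgWeakPoint.ofHom_value p hp φ h0 hφ u m).trans ?_
    obtain ⟨i, rfl⟩ := (c.branch_bijective hp).2 q
    have h1 := H i v hv
    have h2 : Ideal.span {u.germ m.1} = Ideal.span {c.g i} := hq
    have := c.isDomain_stalk
    obtain ⟨b, hb⟩ := (Ideal.span_singleton_eq_span_singleton.1 h2).symm
    let b' : stalkM D p := ⟨b, mem_stalkM_of_isUnit b.isUnit⟩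
    have h3 : u.germM D m = c.m i * b' := Subtype.ext hb.symm
    have h4 : v.1 (u.germ m.1) = v.1 (c.g i) * stalkEval p b := by
      rw [← hb, v.2.2.2, (c.mem_S₀.1 i.2).2, zero_mul, zero_add, mul_comm]
    refine Eq.trans ?_ h4.symm
    rw [h3, map_mul, h1, hφ b' b.isUnit]

/-- The point takes `arg = φ / |φ|` and the evaluation takes `|g_i|` to `|φ g_i|`; multiplicativity
gives `|φ m|` on every `|m|`. -/
theorem KNMatches.existsUnique_right (hD : IsNormalCrossing π D) (w : AlgWeakPoint π D) :
    ∃! s, KNMatches w s := by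
  obtain ⟨p, hp, φ, h0, hφ, rfl⟩ := w.exists_eq_ofHom
  obtain ⟨c⟩ := exists_chart hD p
  let arg : stalkM D p →* Circle :=
    { toFun := fun m ↦ direction (φ m) (h0 m)
      map_one' := by
        refine Circle.eq_of_mul_norm (h0 1) (direction_mul_norm _ _) ?_
        rw [map_one]
        simp
      map_mul' := fun m n ↦ by
        refine Circle.eq_of_mul_norm (h0 (m * n)) (direction_mul_norm _ _) ?_
        have h1 := direction_mul_norm (φ m) (h0 m)
        have h2 := direction_mul_norm (φ n) (h0 n)
        rw [map_mul, norm_mul, Circle.coe_mul]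
        push_cast
        linear_combination (direction (φ n) (h0 n) * ‖φ n‖ : ℂ) * h1 + φ m * h2 }
  have harg (m : stalkM D p) : (arg m : ℂ) * ‖φ m‖ = φ m :=
    direction_mul_norm (φ m) (h0 m)
  let x : KNPoint π D := ⟨p, hp, arg, fun m hm ↦ by rw [← hφ m hm]; exact harg m⟩
  obtain ⟨σ, hσ, hσc⟩ := Chart.exists_isPosEval (x := x) c (ρ := fun i ↦ ‖φ (c.m i)‖)
    fun i ↦ norm_pos_iff.2 (h0 _)
  have hσm (m : stalkM D p) : σ (absRep x m) = ‖φ m‖ := by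
    refine c.stalkM_induction hp (P := fun m ↦ σ (absRep x m) = ‖φ m‖) (fun m hm ↦ ?_) hσc
      (fun m n hm hn ↦ ?_) m
    · rw [hφ m hm]
      exact hσ.unit hm
    · rw [map_mul, norm_mul, ← hm, ← hn]
      exact hσ.absRep_mul m n
  refine ⟨KNWeakPoint.ofEval x σ hσ, knMatches_ofHom_iff.2 ⟨arg, _, rfl, fun m ↦ ⟨harg m, ?_⟩⟩,
    fun s hs ↦ ?_⟩
  · exact (KNWeakPoint.ofEval_eval x σ hσ (knMonomialAt_absRep x m)).trans (hσm m)
  · obtain ⟨arg', arg_unit', hpt, H⟩ := knMatches_ofHom_iff.1 hs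
    have harg' : arg' = arg := MonoidHom.ext fun m ↦ Circle.eq_of_mul_norm (h0 m) (H m).1 (harg m)
    subst harg'
    have hpt' : s.pt = x := hpt
    refine KNWeakPoint.ext_eval hpt' fun g hg ↦ ?_
    rw [hpt'] at hg
    rw [KNWeakPoint.ofEval_eval x σ hσ hg]
    refine IsPosEval.ext (hpt' ▸ s.isPosEval) hσ c (fun i ↦ ?_) hg
    exact (H (c.m i)).2.trans (hσc i).symm

/-- The homomorphism is reassembled from polar coordinates as `φ m = arg m · s^*|m|`, which is
multiplicative at once, so no chart is needed. -/
theorem KNMatches.existsUnique_left (s : KNWeakPoint π D) : ∃! w, KNMatches w s := by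
  obtain ⟨x, hx⟩ : ∃ x, s.pt = x := ⟨_, rfl⟩
  have hs : IsPosEval x s.eval := hx ▸ s.isPosEval
  have hpos (m : stalkM D x.pt) : 0 < s.eval (absRep x m) := hs.pos (knMonomialAt_absRep x m)
  have hunit (m : stalkM D x.pt) (hm : IsUnit (m : stalk x.pt)) :
      s.eval (absRep x m) = ‖stalkEval x.pt m‖ := hs.unit hm
  obtain ⟨φ, hφs⟩ : ∃ φ : stalkM D x.pt →* ℂ, ∀ m, φ m = x.arg m * s.eval (absRep x m) :=
    ⟨{ toFun := fun m ↦ x.arg m * s.eval (absRep x m)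
       map_one' := by
        rw [hunit 1 isUnit_one, map_one]
        simp
       map_mul' := fun m n ↦ by
        have h1 : s.eval (absRep x (m * n)) = _ := hs.absRep_mul m n
        rw [map_mul, Circle.coe_mul, h1]
        push_cast
        ring }, fun _ ↦ rfl⟩
  have hφ (m : stalkM D x.pt) (hm : IsUnit (m : stalk x.pt)) : φ m = stalkEval x.pt m := by
    rw [hφs, hunit m hm]
    exact x.arg_unit m hm
  have h0 (m : stalkM D x.pt) : φ m ≠ 0 := by
    rw [hφs]
    exact mul_ne_zero (Circle.coe_ne_zero _) (Complex.ofReal_ne_zero.2 (hpos m).ne')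
  have hnorm (m : stalkM D x.pt) : ‖φ m‖ = s.eval (absRep x m) := by
    rw [hφs, norm_mul, Circle.norm_coe, one_mul, Complex.norm_real, Real.norm_of_nonneg (hpos m).le]
  refine ⟨AlgWeakPoint.ofHom x.pt x.pt_str φ h0 hφ,
    knMatches_ofHom_iff.2 ⟨x.arg, x.arg_unit, hx, fun m ↦ ⟨?_, (hnorm m).symm⟩⟩, fun w hw ↦ ?_⟩
  · rw [hnorm, hφs]
  · obtain ⟨p', hp', φ', h0', hφ', rfl⟩ := w.exists_eq_ofHom
    obtain ⟨arg, arg_unit, hpt, H⟩ := knMatches_ofHom_iff.1 hw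
    obtain rfl : x = ⟨p', hp', arg, arg_unit⟩ := hx.symm.trans hpt
    obtain rfl : φ' = φ := MonoidHom.ext fun m ↦ by
      rw [hφs, ← (H m).1, (H m).2]
    rfl

theorem AlgMatches.existsUnique_right (hD : IsNormalCrossing π D) (w : AlgWeakPoint π D) :
    ∃! a, AlgMatches w a := by
  obtain ⟨p, hp, φ, h0, hφ, rfl⟩ := w.exists_eq_ofHom
  obtain ⟨c⟩ := exists_chart hD p
  classical
  obtain ⟨v, hv⟩ := c.exists_tangent hp fun i ↦ if h : i ∈ c.S₀ then φ (c.m ⟨i, h⟩) else 0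
  have hv (i : c.S₀) : v.1 (c.g i) = φ (c.m i) := by rw [hv, dif_pos i.2]
  have key (i : c.S₀) (v' : algTangent π p) :
      (branchTangent π p (c.branch hp i).1).mkQ v' = (branchTangent π p (c.branch hp i).1).mkQ v ↔
        φ (c.m i) = v'.1 (c.g i) := by
    rw [← hv, eq_comm (a := v.1 _)]
    exact mkQ_branch_eq (c.mem_S₀.1 i.2).2
  refine ⟨⟨p, hp, fun q ↦ (branchTangent π p q.1).mkQ v, fun q ↦ ?_⟩,
    (algMatches_ofHom_iff c).2 ⟨_, _, rfl, fun i v' hv' ↦ (key i v').1 hv'⟩, fun a ha ↦ ?_⟩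
  · obtain ⟨i, rfl⟩ := (c.branch_bijective hp).2 q
    intro h
    have h1 := (key i 0).1 (by rw [map_zero, h])
    exact h0 _ h1
  · obtain ⟨vec, ne, rfl, H⟩ := (algMatches_ofHom_iff c).1 ha
    congr 1
    funext q
    obtain ⟨i, rfl⟩ := (c.branch_bijective hp).2 q
    obtain ⟨v', hv'⟩ := Submodule.mkQ_surjective _ (vec (c.branch hp i))
    rw [← hv']
    exact (key i v').2 (H i v' hv')

/-- Nonvanishing of the normal vectors means that their values on the `g_i` are nonzero, which is
what `Chart.exists_hom` requires. -/
theorem AlgMatches.existsUnique_left (hD : IsNormalCrossing π D) (a : AlgBasepoint π D) :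
    ∃! w, AlgMatches w a := by
  obtain ⟨p, hp, vec, ne⟩ := a
  obtain ⟨c⟩ := exists_chart hD p
  choose v hv using fun i : c.S₀ ↦ Submodule.mkQ_surjective _ (vec (c.branch hp i))
  have key (i : c.S₀) (v' : algTangent π p) :
      (branchTangent π p (c.branch hp i).1).mkQ v' = vec (c.branch hp i) ↔
        v'.1 (c.g i) = (v i).1 (c.g i) := by
    rw [← hv]
    exact mkQ_branch_eq (c.mem_S₀.1 i.2).2
  have hne (i : c.S₀) : (v i).1 (c.g i) ≠ 0 := by
    intro h
    have h1 := (key i 0).2 h.symm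
    rw [map_zero] at h1
    exact ne _ h1.symm
  obtain ⟨φ, h0, hφ, hφc⟩ := c.exists_hom hp hne
  refine ⟨AlgWeakPoint.ofHom p hp φ h0 hφ, (algMatches_ofHom_iff c).2
    ⟨vec, ne, rfl, fun i v' hv' ↦ by rw [hφc, (key i v').1 hv']⟩, fun w hw ↦ ?_⟩
  obtain ⟨p', hp', φ', h0', hφ', rfl⟩ := w.exists_eq_ofHom
  obtain rfl : p = p' := by
    obtain ⟨vec', ne', h, -⟩ := hw
    exact congrArg AlgBasepoint.pt h
  obtain ⟨vec', ne', h, H⟩ := (algMatches_ofHom_iff c).1 hw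
  obtain rfl : vec = vec' := by
    injection h
  obtain rfl : φ' = φ := c.hom_ext hp (fun m hm ↦ (hφ' m hm).trans (hφ m hm).symm)
    fun i ↦ (H i (v i) (hv i)).trans (hφc i).symm
  rfl

theorem Chart.proj_g {x : KNPoint π D} (c : Chart π D x.pt) (v : KNTangent π D x) (i : c.S₀) :
    v.proj.1 (c.g i) = x.arg (c.m i) * v.d (absRep x (c.m i)) := by
  have h : stalkEval x.pt (c.m i) = 0 := (c.mem_S₀.1 i.2).2
  refine (v.proj_eq (c.m i)).trans ?_
  rw [h, norm_zero, Complex.ofReal_zero, zero_mul, add_zero]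

theorem Chart.mkQ_proj_eq_iff {x : KNPoint π D} (c : Chart π D x.pt) {v w : KNTangent π D x}
    (i : c.S₀) : (branchTangent π x.pt (c.branch x.pt_str i).1).mkQ v.proj =
      (branchTangent π x.pt (c.branch x.pt_str i).1).mkQ w.proj ↔
        v.d (absRep x (c.m i)) = w.d (absRep x (c.m i)) := by
  refine (mkQ_branch_eq (c.mem_S₀.1 i.2).2).trans ?_
  rw [c.proj_g, c.proj_g, mul_right_inj' (Circle.coe_ne_zero _), Complex.ofReal_inj]

theorem Chart.mkQ_proj_eq_of_mkQ_eq {x : KNPoint π D} (c : Chart π D x.pt)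
    {v w : KNTangent π D x}
    (h : ((KN π D).tangentFace x).mkQ v = ((KN π D).tangentFace x).mkQ w) (q : Branch D x.pt) :
    (branchTangent π x.pt q.1).mkQ v.proj = (branchTangent π x.pt q.1).mkQ w.proj := by
  obtain ⟨i, rfl⟩ := (c.branch_bijective x.pt_str).2 q
  exact (c.mkQ_proj_eq_iff i).2 (c.mkQ_face_eq_iff.1 h i)

theorem Chart.mkQ_proj_ne_zero {x : KNPoint π D} (c : Chart π D x.pt) {v : KNTangent π D x}
    (hv : v ∈ (KN π D).posTangent x) (q : Branch D x.pt) :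
    (branchTangent π x.pt q.1).mkQ v.proj ≠ 0 := by
  obtain ⟨i, rfl⟩ := (c.branch_bijective x.pt_str).2 q
  intro h
  have h1 : v.proj.1 (c.g i) = 0 :=
    (mkQ_branch_eq (c.mem_S₀.1 i.2).2 (w := 0)).1 (h.trans (map_zero _).symm)
  rw [c.proj_g] at h1
  exact mul_ne_zero (Circle.coe_ne_zero _)
    (Complex.ofReal_ne_zero.2 (c.mem_posTangent_iff.1 hv i).ne') h1

/-- The classes of the projected vector depend only on the normal class of `v`, so one
representative decides the relation. -/
theorem diffMatches_iff (hD : IsNormalCrossing π D) {b : (KN π D).TangentialBasepoint}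
    {v : KNTangent π D (basepointPt b)} (hv : ((KN π D).tangentFace b.pt).mkQ v = b.vec)
    {a : AlgBasepoint π D} :
    DiffMatches b a ↔ ∃ ne, a = ⟨(basepointPt b).pt, (basepointPt b).pt_str,
      fun q ↦ (branchTangent π (basepointPt b).pt q.1).mkQ v.proj, ne⟩ := by
  obtain ⟨c⟩ := exists_chart hD (basepointPt b).pt
  constructor
  · rintro ⟨vec, ne, rfl, H⟩
    obtain ⟨t, ht, htv⟩ := H v hv
    obtain rfl : t = v.proj := v.isDifferential_iff.1 ht
    obtain rfl := funext htv
    exact ⟨ne, rfl⟩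
  · rintro ⟨ne, h⟩
    refine ⟨_, ne, h, fun w hw ↦ ?_⟩
    change KNTangent π D (basepointPt b) at w
    exact ⟨w.proj, w.isDifferential_iff.2 rfl, c.mkQ_proj_eq_of_mkQ_eq (hw.trans hv.symm)⟩

theorem DiffMatches.existsUnique_right (hD : IsNormalCrossing π D)
    [Smooth π] [IsSeparated π] [QuasiCompact π]
    (b : (KN π D).TangentialBasepoint) : ∃! a, DiffMatches b a := by
  obtain ⟨c⟩ := exists_chart hD (basepointPt b).pt
  obtain ⟨v, hv, hvb⟩ := b.pos
  exact ⟨_, (diffMatches_iff hD hvb).2 ⟨c.mkQ_proj_ne_zero hv, rfl⟩,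
    fun a ha ↦ ((diffMatches_iff hD hvb).1 ha).2⟩

/-- On each branch `φ g_i = arg g_i · s^*|g_i|`, the second factor is the derivative of `|g_i|`
along `v`, and the product is the value of the projected vector on `g_i`. -/
theorem KNMatches.algMatches (hD : IsNormalCrossing π D)
    {w : AlgWeakPoint π D} {s : KNWeakPoint π D}
    {b : (KN π D).TangentialBasepoint} {a : AlgBasepoint π D} (hs : KNMatches w s)
    (hb : SmoothMatches s b) (ha : DiffMatches b a) : AlgMatches w a := by
  obtain ⟨p, hp, φ, h0, hφ, rfl⟩ := w.exists_eq_ofHom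
  obtain ⟨arg, arg_unit, hpt, H⟩ := knMatches_ofHom_iff.1 hs
  obtain ⟨v, hv, hvb⟩ := b.pos
  obtain ⟨ne, rfl⟩ := (diffMatches_iff hD hvb).1 ha
  have key := fun c i ↦ hb.eval_eq c hvb i
  change KNTangent π D (basepointPt b) at v
  change ∀ (c : Chart π D (basepointPt b).pt) (i : c.S₀),
    s.eval (absRep (basepointPt b) (c.m i)) = v.d (absRep (basepointPt b) (c.m i)) at key
  have hx : basepointPt b = ⟨p, hp, arg, arg_unit⟩ := hb.pt_eq.symm.trans hpt
  clear hb ha hvb hv hs hpt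
  -- The types of `v` and `key` depend on the basepoint; making it a variable allows it to be
  -- replaced by the explicit point without transport.
  generalize basepointPt b = x at *
  subst hx
  obtain ⟨c⟩ := exists_chart hD p
  refine (algMatches_ofHom_iff c).2 ⟨_, ne, rfl, fun i u hu ↦ ?_⟩
  have h1 : u.1 (c.g i) = v.proj.1 (c.g i) := (mkQ_branch_eq (c.mem_S₀.1 i.2).2).1 hu
  have h3 := Chart.proj_g (x := ⟨p, hp, arg, arg_unit⟩) c v i
  rw [h1, h3, ← key c i, (H _).2, (H _).1]

end Comparison

theorem exists_equiv {α β : Type*} {R : α → β → Prop} (h₁ : ∀ a, ∃! b, R a b)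
    (h₂ : ∀ b, ∃! a, R a b) : ∃ e : α ≃ β, ∀ a b, e a = b ↔ R a b := by
  choose f hf hf' using h₁
  choose g hg hg' using h₂
  refine ⟨⟨f, g, fun a ↦ (hg' _ a (hf a)).symm, fun b ↦ (hf' _ b (hg b)).symm⟩, fun a b ↦ ?_⟩
  exact ⟨fun h ↦ h ▸ hf a, fun h ↦ (hf' a b h).symm⟩

end

end LogGeom

theorem mainTheorem10 (Y : Scheme.{0}) (π : Y ⟶ Spec (CommRingCat.of ℂ))
    [Smooth π] [IsSeparated π] [QuasiCompact π]
    (D : Y.IdealSheafData) (hD : LogGeom.IsNormalCrossing π D) :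
    ∃ (e₁₂ : LogGeom.AlgWeakPoint π D ≃ LogGeom.KNWeakPoint π D)
      (e₁₃ : LogGeom.AlgWeakPoint π D ≃ LogGeom.AlgBasepoint π D)
      (e₂₄ : LogGeom.KNWeakPoint π D ≃ (LogGeom.KN π D).TangentialBasepoint)
      (e₄₃ : (LogGeom.KN π D).TangentialBasepoint ≃ LogGeom.AlgBasepoint π D),
      (∀ w s, e₁₂ w = s ↔ LogGeom.KNMatches w s) ∧
      (∀ w a, e₁₃ w = a ↔ LogGeom.AlgMatches w a) ∧
      (∀ s b, e₂₄ s = b ↔ LogGeom.SmoothMatches s b) ∧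
      (∀ b a, e₄₃ b = a ↔ LogGeom.DiffMatches b a) ∧
      ∀ w, e₄₃ (e₂₄ (e₁₂ w)) = e₁₃ w := by
  obtain ⟨e₁₂, h₁₂⟩ := LogGeom.exists_equiv (R := LogGeom.KNMatches (π := π) (D := D))
    (LogGeom.KNMatches.existsUnique_right hD) LogGeom.KNMatches.existsUnique_left
  obtain ⟨e₁₃, h₁₃⟩ := LogGeom.exists_equiv (R := LogGeom.AlgMatches (π := π) (D := D))
    (LogGeom.AlgMatches.existsUnique_right hD) (LogGeom.AlgMatches.existsUnique_left hD)
  obtain ⟨e₂₄, h₂₄⟩ := LogGeom.exists_equiv (R := LogGeom.SmoothMatches (π := π) (D := D))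
    (LogGeom.SmoothMatches.existsUnique_right hD) (LogGeom.SmoothMatches.existsUnique_left hD)
  -- The last bijection is the composite of the other three, so the triangle commutes by
  -- construction. `DiffMatches` is only known to be functional from left to right, and
  -- `KNMatches.algMatches` identifies its value with the composite.
  refine ⟨e₁₂, e₁₃, e₂₄, e₂₄.symm.trans (e₁₂.symm.trans e₁₃), h₁₂, h₁₃, h₂₄, fun b a ↦ ?_,
    fun w ↦ by simp⟩
  obtain ⟨w, rfl⟩ := (e₁₂.trans e₂₄).surjective b
  obtain ⟨a', ha', huniq⟩ := LogGeom.DiffMatches.existsUnique_right hD ((e₁₂.trans e₂₄) w)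
  have h : e₁₃ w = a' :=
    (h₁₃ w a').2 (((h₁₂ w _).1 rfl).algMatches hD ((h₂₄ _ _).1 rfl) ha')
  have h' : (e₂₄.symm.trans (e₁₂.symm.trans e₁₃)) ((e₁₂.trans e₂₄) w) = a' := by
    simpa using h
  rw [h']
  exact ⟨fun h ↦ h ▸ ha', fun h ↦ (huniq a h).symm⟩
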